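/- Throughout, a system $(\mathcal X,f,\mu)$ consists of a Borel set $\mathcal X\subset\mathbb R$, a Borel map $f:\mathcal X\to\mathcal X$ and an ergodic $f$-invariant Borel probability measure $\mu$ on $\mathcal X$ that is absolutely continuous with respect to Lebesgue measure. Write $\rho\ge 0$ for its density and $d(x,y)=|x-y|$. For $\varphi:\mathcal X\to\mathbb R$ let $\|\varphi\|_{\mathrm{BV}}=\mathrm{var}(\varphi)+\sup|\varphi|$, and let $\mathrm{BV}$ be the set of $\varphi$ for which this is finite. Call $(\mathcal X,f,\mu)$ hyperbolic recurrent if the following hold. (A1) There are $C,\kappa>0$ such that for all $\varphi_1\in\mathrm{BV}$, $\varphi_2\in L^1(\mu)$ and $j\ge 0$, $$\Bigl|\int\varphi_1\cdot\varphi_2\circ f^j\,d\mu-\int\varphi_1\,d\mu\int\varphi_2\,d\mu\Bigr|\le Ce^{-\kappa j}\|\varphi_1\|_{\mathrm{BV}}\|\varphi_2\|_{L^1(\mu)}.$$ (A2) Whenever $a>0$ and $(r_n)$ is a sequence such that, for some $c>1$, $r_n/n^{-a}\in[c^{-1},c]$ for all large $n$, there are $\beta_0\in(0,1)$ and $C>0$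 such that, for all large $n$ and all integers $1\le j\le(\log n)^2$, $\mu\{x\in\mathcal X: d(x,f^jx)\le r_n\}\le C r_n^{\beta_0}$. (A3) $\mu$ has a density belonging to $\mathrm{BV}$. Call $(\mathcal X,f,\mu)$ asymptotically hyperbolic if for every $\varepsilon>0$ there is a countable union $U_\varepsilon\subset\mathcal X$ of connected sets with $\mu(U_\varepsilon)\le\varepsilon$ such that, with $Y_\varepsilon=\mathcal X\setminus U_\varepsilon$ and $F_\varepsilon$ the first return map of $f$ to $Y_\varepsilon$, the system $(Y_\varepsilon,F_\varepsilon,\mu|_{Y_\varepsilon}/\mu(Y_\varepsilon))$ is hyperbolic recurrent. Theorem. Suppose that $(\mathcal X,f,\mu)$ is asymptotically hyperbolic. Then the following hold. (1) For all $\tau>0$ and all integers $k\ge 1$, with $r_n=\tau/(2n)$ and $R_n(r,x)=\#\{1\le j\le n: d(f^jx,x)\le r\}$, $$\lim_{n\to\infty}\mu\{x\in\mathcal X: R_n(r_n,x)=k\}=\int_{\mathcal X}\frac{\tau^k\rho(x)^{k+1}}{k!}e^{-\rho(x)\tau}\,dx.$$ (2)(a) (Almost sure upper bound.) Let $(r_n)$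 be a real sequence, and suppose that one of the following holds: (i) $\rho>0$ on $\mathcal X$ and, for some $c$ with $2c\,\inf_{x\in\mathcal X}\rho(x)>1$, $r_n>\frac{c\log\log n}{n}$ for all large $n$; (ii) $\rho$ is uniformly Hölder continuous on $\mathcal X$ (there are $\eta\in(0,1]$ and $L,\delta>0$ with $|\rho(x)-\rho(y)|\le L|x-y|^{\eta}$ whenever $x,y\in\mathcal X$ and $|x-y|<\delta$) and, for some $\gamma>\gamma_0$, $r_n>\frac{(\log n)^{\gamma}}{2n}$ for all large $n$, where $\gamma_0$ is such that $$\sum_{k\ge 1}\int_{\mathcal X}\rho(x)e^{-\epsilon k^{\gamma_0}\rho(x)}\,dx<\infty\quad\text{for all }\epsilon>0.$$ Then $\mu\{x\in\mathcal X:\min_{1\le k\le n}d(f^kx,x)<r_n\text{ for all sufficiently large }n\}=1$. (2)(b) (Almost sure lower bound.) If $(r_n)_{n\ge1}$ is a non-increasing real sequence with $\sum_{n\ge1}\int_{\mathcal X}\mu(B(x,r_n))\,d\mu(x)<\infty$, where $B(x,r)$ is the open ball, then $\mu\{x\in\mathcal X:\min_{1\le k\le n}d(f^kx,x)>r_n\text{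 for all sufficiently large }n\}=1$. -/

import Mathlib

open MeasureTheory Set Filter Topology

noncomputable section

namespace Recurrence

/-- `X` is a Borel subset of the line, `f` maps `X` to itself, and `μ` is an ergodic `f`-invariant
Borel probability measure carried by `X` and absolutely continuous with respect to Lebesgue
measure (an ergodic acip). Only the values of `f` on `X` matter. -/
structure IsErgodicAcip (X : Set ℝ) (f : ℝ → ℝ) (μ : Measure ℝ) : Prop where
  measurableSet : MeasurableSet X
  mapsTo : MapsTo f X X
  isProbabilityMeasure : IsProbabilityMeasure μ
  measure_compl : μ Xᶜ = 0
  ergodic : Ergodic f μ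
  absolutelyContinuous : μ ≪ volume

/-- `ρ` is a (version of the) density of `μ` with respect to Lebesgue measure on `X`. -/
structure IsDensity (X : Set ℝ) (μ : Measure ℝ) (ρ : ℝ → ℝ) : Prop where
  aemeasurable : AEMeasurable ρ (volume.restrict X)
  nonneg : ∀ x ∈ X, 0 ≤ ρ x
  eq_withDensity : μ = (volume.restrict X).withDensity (fun x => ENNReal.ofReal (ρ x))

/-- The norm `var(φ) + sup |φ|` of a function of bounded variation on `X`. -/
def bvNorm (X : Set ℝ) (φ : ℝ → ℝ) : ℝ :=
  (eVariationOn φ X).toReal + ⨆ x : X, |φ x|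

/-- Exponential decay of correlations for `BV` functions versus `L¹(μ)` functions. -/
def ExpDecayBVL1 (X : Set ℝ) (f : ℝ → ℝ) (μ : Measure ℝ) : Prop :=
  ∃ C κ : ℝ, 0 < C ∧ 0 < κ ∧ ∀ φ₁ φ₂ : ℝ → ℝ, BoundedVariationOn φ₁ X → Integrable φ₂ μ →
    ∀ j : ℕ, |∫ x, φ₁ x * φ₂ (f^[j] x) ∂μ - (∫ x, φ₁ x ∂μ) * ∫ x, φ₂ x ∂μ| ≤
      C * Real.exp (-κ * j) * bvNorm X φ₁ * ∫ x, |φ₂ x| ∂μ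

/-- The set of points of `X` that are `r`-close to their `j`-th iterate. -/
def returnSet (X : Set ℝ) (f : ℝ → ℝ) (j : ℕ) (r : ℝ) : Set ℝ :=
  {x ∈ X | dist x (f^[j] x) ≤ r}

/-- Short return times: whenever `r n ≈ n ^ (-a)` with `a > 0`, the sets of points that are
`r n`-close to their `j`-th iterate have measure at most `C * (r n) ^ β₀`, uniformly in
`1 ≤ j ≤ (log n)²`. -/
def ShortReturns (X : Set ℝ) (f : ℝ → ℝ) (μ : Measure ℝ) : Prop :=
  ∀ (a : ℝ) (r : ℕ → ℝ), 0 < a →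
    (∃ c : ℝ, 1 < c ∧ ∀ᶠ n : ℕ in atTop, r n / (n : ℝ) ^ (-a) ∈ Icc c⁻¹ c) →
    ∃ β₀ ∈ Ioo (0 : ℝ) 1, ∃ C : ℝ, 0 < C ∧ ∀ᶠ n : ℕ in atTop, ∀ j : ℕ, 1 ≤ j →
      (j : ℝ) ≤ Real.log n ^ 2 → μ.real (returnSet X f j (r n)) ≤ C * r n ^ β₀

/-- Hyperbolic recurrent systems. -/
structure HyperbolicRecurrent (X : Set ℝ) (f : ℝ → ℝ) (μ : Measure ℝ) : Prop where
  isErgodicAcip : IsErgodicAcip X f μ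
  expDecay : ExpDecayBVL1 X f μ
  shortReturns : ShortReturns X f μ
  density_bv : ∃ ρ : ℝ → ℝ, IsDensity X μ ρ ∧ BoundedVariationOn ρ X

/-- The first return time to `Y` (with value `0` at points that never return). -/
def firstReturn (f : ℝ → ℝ) (Y : Set ℝ) (x : ℝ) : ℕ :=
  sInf {n : ℕ | 1 ≤ n ∧ f^[n] x ∈ Y}

/-- The first return map to `Y`; the points of `Y` that never return, which form a null set for
an invariant probability measure, are left fixed. -/
def returnMap (f : ℝ → ℝ) (Y : Set ℝ) (x : ℝ) : ℝ :=
  f^[firstReturn f Y x] x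

/-- Asymptotically hyperbolic systems: for each `ε > 0` one may remove a countable union of
connected sets, of measure at most `ε`, such that the first return map to the rest, with the
normalised restriction of `μ`, is hyperbolic recurrent. -/
def AsymptoticallyHyperbolic (X : Set ℝ) (f : ℝ → ℝ) (μ : Measure ℝ) : Prop :=
  ∀ ε : ℝ, 0 < ε → ∃ (ι : Type) (_ : Countable ι) (U : ι → Set ℝ),
    (∀ i, IsConnected (U i) ∧ U i ⊆ X) ∧
    μ (⋃ i, U i) ≤ ENNReal.ofReal ε ∧
    HyperbolicRecurrent (X \ ⋃ i, U i) (returnMap f (X \ ⋃ i, U i))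
      (ProbabilityTheory.cond μ (X \ ⋃ i, U i))

/-- The number of `1 ≤ j ≤ n` with `d(f^j x, x) ≤ r`. -/
def recCount (f : ℝ → ℝ) (n : ℕ) (r x : ℝ) : ℕ :=
  {j ∈ Finset.Icc 1 n | dist (f^[j] x) x ≤ r}.card

/-- `min_{1 ≤ k ≤ n} d(f^k x, x)`, for `n ≥ 1`. -/
def recMin (f : ℝ → ℝ) (n : ℕ) (x : ℝ) : ℝ :=
  sInf ((fun k : ℕ => dist (f^[k] x) x) '' Icc 1 n)

/-- `ρ` is uniformly Hölder continuous on `X`. -/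
def UniformlyHolderOn (X : Set ℝ) (ρ : ℝ → ℝ) : Prop :=
  ∃ η L δ : ℝ, η ∈ Ioc (0 : ℝ) 1 ∧ 0 < L ∧ 0 < δ ∧
    ∀ x ∈ X, ∀ y ∈ X, |x - y| < δ → |ρ x - ρ y| ≤ L * |x - y| ^ η

end Recurrence

end

/-! Everything is first proved for the return map F to a set Y of measure close to 1, where
correlations decay exponentially against L¹. Let ν be the normalised restriction of μ to Y.

Cut the line into cells of length ℓ. For a starting point in the i-th cell, coming close to oneself
is nearly the same as entering the fixed interval `cell ℓ q i`, which contains the ball of radius qℓ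
about the point and lies in the one of radius (q+1)ℓ; the loss disappears as q grows. For a fixed
interval J the mean a(N) of (1-u) to the number of visits before time N satisfies a(N+1) ≈ (1 -
uν(J)) a(N), hence a(N) ≈ (1 - uν(J))^N (`abs_integral_weight_sub_pow_le`). A gap of (log n)² steps
decouples the initial cell from the later visits. No single interval need have few short returns,
but summing over the grid turns returns of intervals into points close to their own iterates, which
is what the short-return hypothesis controls. The total error is a negative power of n
(`GoodSystem.sum_abs_le`, `GoodSystem.sum_abs_le_rpow`).

To go back from F to f, the ergodic theorem gives about μ(Y)n returns in time n, while normalising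
divides the density by μ(Y); the two factors cancel. Approaches to the starting point that occur
outside Y are attributed to the excursion containing them: the points of Y whose excursion meets B
form a set of measure at most μ(B) (`measure_hull_le`), to which decay against L¹ applies.

Limit law: by Lebesgue differentiation (1 - uν(J))^N tends to exp(-uτρ(x)) pointwise, and then in
mean (`tendsto_integral_localWeight`). Almost every point of Y is a density point of Y, so returns
outside Y are negligible (`tendsto_outsideReturn`). The limit is the generating function of a
Poisson law with random parameter τρ, and `tendsto_coeff_of_tendsto_tsum` recovers the
probabilities.

Upper bound: u = 1 gives the probability of no close return. Borel–Cantelli is applied along ⌊a^k⌋,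
and monotonicity of the minimum fills in the other times (`ae_eventually_recMin_lt`). Lower bound: a
first-moment bound and Borel–Cantelli over the successive returns suffice
(`ae_eventually_lt_recMin`). -/

noncomputable section

namespace Recurrence

/-! ### Grid cells and their neighbourhoods. -/

/-- The interval made of the `2 * q + 1` cells of the grid of mesh `ℓ` around the `i`-th one. -/
def cell (ℓ : ℝ) (q : ℕ) (i : ℤ) : Set ℝ := Ico ((i - q) * ℓ) ((i + q + 1) * ℓ)

lemma measurableSet_cell (ℓ : ℝ) (q : ℕ) (i : ℤ) : MeasurableSet (cell ℓ q i) :=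
  measurableSet_Ico

lemma mem_cell_iff {ℓ : ℝ} (hℓ : 0 < ℓ) (q : ℕ) (i : ℤ) (y : ℝ) :
    y ∈ cell ℓ q i ↔ i - q ≤ ⌊y / ℓ⌋ ∧ ⌊y / ℓ⌋ ≤ i + q := by
  have h1 : (i - q : ℤ) ≤ ⌊y / ℓ⌋ ↔ ((i : ℝ) - q) * ℓ ≤ y := by
    rw [Int.le_floor, le_div_iff₀ hℓ]; push_cast; rfl
  have h2 : ⌊y / ℓ⌋ ≤ i + q ↔ y < ((i : ℝ) + q + 1) * ℓ := by
    rw [← Int.lt_add_one_iff, Int.floor_lt, div_lt_iff₀ hℓ]; push_cast; rfl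
  rw [h1, h2]; rfl

lemma mem_cell_zero_iff {ℓ : ℝ} (hℓ : 0 < ℓ) (i : ℤ) (y : ℝ) :
    y ∈ cell ℓ 0 i ↔ ⌊y / ℓ⌋ = i := by
  rw [mem_cell_iff hℓ]; simp only [Nat.cast_zero, sub_zero, add_zero]; omega

lemma mem_cell_floor {ℓ : ℝ} (hℓ : 0 < ℓ) (q : ℕ) (y : ℝ) : y ∈ cell ℓ q ⌊y / ℓ⌋ := by
  rw [mem_cell_iff hℓ]; omega

lemma cell_zero_subset {ℓ : ℝ} (hℓ : 0 < ℓ) (q : ℕ) (i : ℤ) : cell ℓ 0 i ⊆ cell ℓ q i := by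
  intro y hy
  rw [mem_cell_zero_iff hℓ] at hy
  rw [← hy]; exact mem_cell_floor hℓ q y

lemma dist_lt_of_mem_cell {ℓ : ℝ} {q : ℕ} {x y : ℝ} (hℓ : 0 < ℓ)
    (hy : y ∈ cell ℓ q ⌊x / ℓ⌋) : dist y x < (q + 1) * ℓ := by
  obtain ⟨h1, h2⟩ := hy
  obtain ⟨h3, h4⟩ := mem_cell_floor hℓ 0 x
  simp only [Nat.cast_zero, sub_zero, add_zero] at h3 h4
  rw [Real.dist_eq, abs_lt]
  constructor <;> nlinarith

/-- With `dist_lt_of_mem_cell` this traps the enlarged cell of x between the balls of radius qℓ and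
(q+1)ℓ, so a moving target is replaced by countably many fixed ones. -/
lemma mem_cell_of_dist_le {ℓ : ℝ} {q : ℕ} {x y : ℝ} (hℓ : 0 < ℓ) (h : dist y x ≤ q * ℓ) :
    y ∈ cell ℓ q ⌊x / ℓ⌋ := by
  rw [mem_cell_iff hℓ]
  rw [Real.dist_eq, abs_le] at h
  have h1 : y / ℓ ≤ x / ℓ + (q : ℤ) := by
    rw [div_add' _ _ _ hℓ.ne']; push_cast; gcongr; linarith
  have h2 : x / ℓ + ((-q : ℤ) : ℝ) ≤ y / ℓ := by
    rw [div_add' _ _ _ hℓ.ne']; push_cast; gcongr; linarith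
  have h3 := Int.floor_mono h1
  have h4 := Int.floor_mono h2
  rw [Int.floor_add_intCast] at h3 h4
  omega

lemma dist_le_of_mem_cell_of_mem_cell {ℓ : ℝ} {q : ℕ} {i : ℤ} {x y : ℝ}
    (hx : x ∈ cell ℓ q i) (hy : y ∈ cell ℓ q i) : dist x y ≤ (2 * q + 1) * ℓ := by
  obtain ⟨h1, h2⟩ := hx
  obtain ⟨h3, h4⟩ := hy
  rw [Real.dist_eq, abs_le]
  constructor <;> nlinarith

lemma volume_cell (ℓ : ℝ) (q : ℕ) (i : ℤ) :
    volume (cell ℓ q i) = ENNReal.ofReal ((2 * q + 1) * ℓ) := by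
  rw [cell, Real.volume_Ico]; congr 1; ring

lemma card_filter_mem_cell_le {ℓ : ℝ} (hℓ : 0 < ℓ) (q : ℕ) (s : Finset ℤ) (y : ℝ)
    [DecidablePred fun i => y ∈ cell ℓ q i] :
    (s.filter fun i => y ∈ cell ℓ q i).card ≤ 2 * q + 1 := by
  refine (Finset.card_le_card (t := Finset.Icc (⌊y / ℓ⌋ - q) (⌊y / ℓ⌋ + q)) ?_).trans ?_
  · intro i hi
    rw [Finset.mem_filter, mem_cell_iff hℓ] at hi
    rw [Finset.mem_Icc]; omega
  · rw [Int.card_Icc]; omega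

/-- Each point lies in at most 2q+1 of the overlapping cells, so the sum of the indicators is at
most 2q+1 times that of B. This is how bounds cell by cell become a bound for one global set. -/
lemma sum_measureReal_inter_cell_le {ν : Measure ℝ} [IsFiniteMeasure ν] {ℓ : ℝ} (hℓ : 0 < ℓ)
    (q : ℕ) (s : Finset ℤ) (E : ℤ → Set ℝ) (B : Set ℝ) (hB : MeasurableSet B)
    (hE : ∀ i, MeasurableSet (E i)) (hEB : ∀ i, E i ⊆ B) (hEc : ∀ i, E i ⊆ cell ℓ q i) :
    ∑ i ∈ s, ν.real (E i) ≤ (2 * q + 1) * ν.real B := by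
  classical
  calc ∑ i ∈ s, ν.real (E i) = ∑ i ∈ s, ∫ y, (E i).indicator (1 : ℝ → ℝ) y ∂ν := by
        simp_rw [integral_indicator_one (hE _)]
    _ = ∫ y, ∑ i ∈ s, (E i).indicator (1 : ℝ → ℝ) y ∂ν := by
        rw [integral_finsetSum]
        exact fun i _ => (integrable_const (1 : ℝ)).indicator (hE i)
    _ ≤ ∫ y, (2 * q + 1) * B.indicator (1 : ℝ → ℝ) y ∂ν := by
        refine integral_mono
          (integrable_finsetSum _ fun i _ => (integrable_const (1 : ℝ)).indicator (hE i))
          (((integrable_const (1 : ℝ)).indicator hB).const_mul _) fun y => ?_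
        by_cases hy : y ∈ B
        · have h := card_filter_mem_cell_le hℓ q s y
          have : ∀ i, (E i).indicator (1 : ℝ → ℝ) y ≤ if y ∈ cell ℓ q i then 1 else 0 := by
            intro i
            by_cases hi : y ∈ E i
            · simp [hi, hEc i hi]
            · simp only [indicator_of_notMem hi]; positivity
          refine (Finset.sum_le_sum fun i _ => this i).trans ?_
          rw [Finset.sum_boole]
          simp only [indicator_of_mem hy, Pi.one_apply, mul_one]
          exact_mod_cast h
        · have : ∀ i, (E i).indicator (1 : ℝ → ℝ) y = 0 := fun i =>
            indicator_of_notMem (fun h => hy (hEB i h)) _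
          simp [this, hy]
    _ = (2 * q + 1) * ν.real B := by rw [integral_const_mul, integral_indicator_one hB]

/-! ### Interval indicators as test functions of bounded variation. -/

lemma eVariationOn_indicator_Ico_le (a b : ℝ) (X : Set ℝ) :
    eVariationOn ((Ico a b).indicator (1 : ℝ → ℝ)) X ≤ 2 := by
  by_cases hab : b ≤ a
  · rw [Ico_eq_empty (not_lt.2 hab), indicator_empty, eVariationOn.constant_on]
    · exact zero_le
    · rintro _ ⟨x, _, rfl⟩ _ ⟨y, _, rfl⟩; rfl
  push Not at hab
  refine iSup_le fun ⟨n, u, hu, hus⟩ => ?_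
  dsimp only
  -- G counts the jumps already passed. It is monotone with values between 0 and 2, and its
  -- increments dominate those of the indicator, so the variation sums telescope.
  set G : ℝ → ℝ := fun x => (if a ≤ x then 1 else 0) + (if b ≤ x then 1 else 0) with hG
  have key : ∀ x y, x ≤ y →
      |(Ico a b).indicator (1 : ℝ → ℝ) y - (Ico a b).indicator (1 : ℝ → ℝ) x| ≤ G y - G x := by
    intro x y hxy
    simp only [hG, indicator, mem_Ico, Pi.one_apply]
    split_ifs <;> first | (exfalso; grind) | norm_num
  calc ∑ i ∈ Finset.range n, edist ((Ico a b).indicator (1 : ℝ → ℝ) (u (i + 1)))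
          ((Ico a b).indicator (1 : ℝ → ℝ) (u i))
      ≤ ∑ i ∈ Finset.range n, ENNReal.ofReal (G (u (i + 1)) - G (u i)) := by
        refine Finset.sum_le_sum fun i _ => ?_
        rw [edist_dist, Real.dist_eq]
        exact ENNReal.ofReal_le_ofReal (key _ _ (hu (Nat.le_succ i)))
    _ = ENNReal.ofReal (G (u n) - G (u 0)) := by
        rw [← ENNReal.ofReal_sum_of_nonneg, Finset.sum_range_sub (fun i => G (u i))]
        exact fun i _ => (abs_nonneg _).trans (key _ _ (hu (Nat.le_succ i)))
    _ ≤ ENNReal.ofReal 2 := by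
        apply ENNReal.ofReal_le_ofReal
        simp only [hG]
        split_ifs <;> norm_num
    _ = 2 := by norm_num

lemma bvNorm_indicator_Ico_le (a b : ℝ) (X : Set ℝ) :
    bvNorm X ((Ico a b).indicator (1 : ℝ → ℝ)) ≤ 3 := by
  have h1 : (eVariationOn ((Ico a b).indicator (1 : ℝ → ℝ)) X).toReal ≤ 2 :=
    ENNReal.toReal_le_of_le_ofReal (by norm_num)
      ((eVariationOn_indicator_Ico_le a b X).trans (by norm_num))
  have h2 : ⨆ x : X, |(Ico a b).indicator (1 : ℝ → ℝ) x| ≤ 1 := by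
    refine Real.iSup_le (fun x => ?_) zero_le_one
    by_cases hx : (x : ℝ) ∈ Ico a b <;> simp [hx]
  unfold bvNorm; linarith

/-- Exponential decay of correlations of indicators of grid intervals against `L¹`. -/
def CellDecay (F : ℝ → ℝ) (ν : Measure ℝ) (C κ : ℝ) : Prop :=
  ∀ (ℓ : ℝ) (q : ℕ) (i : ℤ) (φ : ℝ → ℝ), Integrable φ ν → ∀ j : ℕ,
    |∫ x, (cell ℓ q i).indicator 1 x * φ (F^[j] x) ∂ν - ν.real (cell ℓ q i) * ∫ x, φ x ∂ν| ≤
      C * Real.exp (-κ * j) * ∫ x, |φ x| ∂ν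

/-- The norm of an interval indicator is at most 3 whatever its length and position; hence a single
constant serves all meshes at once. -/
lemma ExpDecayBVL1.exists_cellDecay {Y : Set ℝ} {F : ℝ → ℝ} {ν : Measure ℝ}
    (h : ExpDecayBVL1 Y F ν) : ∃ C κ : ℝ, 0 < C ∧ 0 < κ ∧ CellDecay F ν C κ := by
  obtain ⟨C, κ, hC, hκ, h⟩ := h
  refine ⟨3 * C, κ, by positivity, hκ, fun ℓ q i φ hφ j => ?_⟩
  have hbv : BoundedVariationOn ((cell ℓ q i).indicator (1 : ℝ → ℝ)) Y :=
    ((eVariationOn_indicator_Ico_le _ _ Y).trans_lt (by norm_num)).ne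
  have := h _ φ hbv hφ j
  rw [integral_indicator_one (measurableSet_cell ℓ q i)] at this
  refine this.trans ?_
  have h3 := bvNorm_indicator_Ico_le ((i - q) * ℓ) ((i + q + 1) * ℓ) Y
  have h4 : 0 ≤ ∫ x, |φ x| ∂ν := integral_nonneg fun x => abs_nonneg _
  calc _ ≤ C * Real.exp (-κ * j) * 3 * ∫ x, |φ x| ∂ν := by unfold cell; gcongr
    _ = _ := by ring

/-! ### Generating function of the number of visits to a fixed set. -/

lemma integral_comp_eq {α : Type*} [MeasurableSpace α] {ν : Measure α} {F : α → α}
    (hF : MeasurePreserving F ν ν) {g : α → ℝ} (hg : AEStronglyMeasurable g ν) :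
    ∫ x, g (F x) ∂ν = ∫ x, g x ∂ν := by
  conv_rhs => rw [← hF.map_eq]
  rw [integral_map hF.measurable.aemeasurable (by rwa [hF.map_eq])]

lemma one_sub_sum_le_prod_one_sub {ι : Type*} (s : Finset ι) (b : ι → ℝ)
    (h0 : ∀ i, 0 ≤ b i) (h1 : ∀ i, b i ≤ 1) : 1 - ∑ i ∈ s, b i ≤ ∏ i ∈ s, (1 - b i) := by
  classical
  induction s using Finset.induction_on with
  | empty => simp
  | insert a s ha ih =>
    rw [Finset.sum_insert ha, Finset.prod_insert ha]
    have h2 : ∏ i ∈ s, (1 - b i) ≤ 1 :=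
      Finset.prod_le_one (fun i _ => sub_nonneg.2 (h1 i)) fun i _ => by linarith [h0 i]
    nlinarith [h0 a, h1 a]

/-- The product over `0 ≤ m < N` of `1 - u`, taken over the times `m` at which `y` visits `J`. -/
def weight (F : ℝ → ℝ) (J : Set ℝ) (u : ℝ) (N : ℕ) (y : ℝ) : ℝ :=
  ∏ m ∈ Finset.range N, (1 - u * J.indicator 1 (F^[m] y))

section weight

variable {F : ℝ → ℝ} {J : Set ℝ} {u : ℝ}

lemma mul_indicator_mem_Icc (hu : u ∈ Icc (0 : ℝ) 1) (J : Set ℝ) (y : ℝ) :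
    u * J.indicator 1 y ∈ Icc (0 : ℝ) 1 := by
  by_cases hy : y ∈ J
  · simpa [hy] using hu
  · simp [hy]

lemma weight_nonneg (hu : u ∈ Icc (0 : ℝ) 1) (N : ℕ) (y : ℝ) : 0 ≤ weight F J u N y :=
  Finset.prod_nonneg fun _ _ => sub_nonneg.2 (mul_indicator_mem_Icc hu J _).2

lemma weight_le_one (hu : u ∈ Icc (0 : ℝ) 1) (N : ℕ) (y : ℝ) : weight F J u N y ≤ 1 :=
  Finset.prod_le_one (fun _ _ => sub_nonneg.2 (mul_indicator_mem_Icc hu J _).2)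
    fun _ _ => by linarith [(mul_indicator_mem_Icc hu J (F^[‹ℕ›] y)).1]

lemma measurable_weight (hF : Measurable F) (hJ : MeasurableSet J) (u : ℝ) (N : ℕ) :
    Measurable (weight F J u N) :=
  Finset.measurable_fun_prod _ fun m _ => measurable_const.sub <| measurable_const.mul <|
    (measurable_one.indicator hJ).comp (hF.iterate m)

lemma integrable_weight {ν : Measure ℝ} [IsFiniteMeasure ν] (hF : Measurable F)
    (hJ : MeasurableSet J) (hu : u ∈ Icc (0 : ℝ) 1) (N : ℕ) :
    Integrable (weight F J u N) ν :=
  Integrable.of_bound (measurable_weight hF hJ u N).aestronglyMeasurable 1 <|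
    Eventually.of_forall fun y => by
      rw [Real.norm_of_nonneg (weight_nonneg hu N y)]; exact weight_le_one hu N y

lemma weight_succ (N : ℕ) (y : ℝ) :
    weight F J u (N + 1) y = (1 - u * J.indicator 1 y) * weight F J u N (F y) := by
  simp only [weight, Finset.prod_range_succ', Function.iterate_succ_apply,
    Function.iterate_zero_apply]
  ring

lemma weight_add (M N : ℕ) (y : ℝ) :
    weight F J u (M + N) y = weight F J u M y * weight F J u N (F^[M] y) := by
  simp only [weight, Finset.prod_range_add, ← Function.iterate_add_apply]
  congr 1
  exact Finset.prod_congr rfl fun m _ => by rw [add_comm M m]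

lemma one_sub_sum_le_weight (hu : u ∈ Icc (0 : ℝ) 1) (M : ℕ) (y : ℝ) :
    1 - ∑ m ∈ Finset.range M, J.indicator 1 (F^[m] y) ≤ weight F J u M y := by
  refine le_trans ?_ (one_sub_sum_le_prod_one_sub (Finset.range M)
    (fun m => u * J.indicator 1 (F^[m] y)) (fun m => (mul_indicator_mem_Icc hu J _).1)
    (fun m => (mul_indicator_mem_Icc hu J _).2))
  gcongr with m
  have : 0 ≤ J.indicator (1 : ℝ → ℝ) (F^[m] y) := indicator_nonneg (fun _ _ => zero_le_one) _
  nlinarith [hu.2]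

/-- The left product runs over the times 1 to N of y, the other one over p to N. Dropping factors in
[0,1] only increases a product, and the increase is at most the number of visits at the dropped
times. -/
lemma weight_comp_bounds (hu : u ∈ Icc (0 : ℝ) 1) (N : ℕ) {p : ℕ} (hp : 1 ≤ p) (y : ℝ) :
    weight F J u N (F y) ≤ weight F J u (N + 1 - p) (F^[p] y) ∧
    weight F J u (N + 1 - p) (F^[p] y) - weight F J u N (F y) ≤
      ∑ j ∈ Finset.Ico 1 p, J.indicator 1 (F^[j] y) := by
  have hsum : ∀ M, M ≤ p - 1 → ∑ m ∈ Finset.range M, J.indicator (1 : ℝ → ℝ) (F^[m] (F y)) ≤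
      ∑ j ∈ Finset.Ico 1 p, J.indicator 1 (F^[j] y) := by
    intro M hM
    rw [Finset.sum_Ico_eq_sum_range]
    refine (Finset.sum_le_sum_of_subset_of_nonneg (Finset.range_subset_range.2 hM)
      fun _ _ _ => indicator_nonneg (fun _ _ => zero_le_one) _).trans (le_of_eq ?_)
    refine Finset.sum_congr rfl fun m _ => ?_
    rw [← Function.iterate_succ_apply, add_comm 1 m]; rfl
  rcases Nat.lt_or_ge N p with h | h
  · rw [Nat.sub_eq_zero_of_le h]
    have h0 : weight F J u 0 (F^[p] y) = 1 := by simp [weight]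
    rw [h0]
    have h1 := one_sub_sum_le_weight (F := F) (J := J) hu N (F y)
    exact ⟨weight_le_one hu _ _, by linarith [hsum N (by omega)]⟩
  · obtain ⟨k, rfl⟩ : ∃ k, p = k + 1 := ⟨p - 1, by omega⟩
    obtain ⟨M, rfl⟩ : ∃ M, N = k + M := ⟨N - k, by omega⟩
    have e : k + M + 1 - (k + 1) = M := by omega
    rw [e, weight_add, Function.iterate_succ_apply]
    have h1 := one_sub_sum_le_weight (F := F) (J := J) hu k (F y)
    have h2 := hsum k (by omega)
    have h3 := weight_le_one (F := F) (J := J) hu k (F y)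
    have h4 := weight_nonneg (F := F) (J := J) hu M (F^[k] (F y))
    have h5 := weight_le_one (F := F) (J := J) hu M (F^[k] (F y))
    exact ⟨by nlinarith, by nlinarith⟩


variable {ν : Measure ℝ}

/-- Expanding the first factor gives a(N+1) = a(N) - u ∫ 1_J · (weight after time 0). Deleting the
times before p costs the short returns of J, decay at lag p then separates the two factors, and
restoring the deleted times costs ν(J) · pν(J). The resulting one-step error is simply added N
times, because |1 - uν(J)| ≤ 1. -/
lemma abs_integral_weight_sub_pow_le [IsProbabilityMeasure ν] (hF : MeasurePreserving F ν ν)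
    (hJ : MeasurableSet J) (hu : u ∈ Icc (0 : ℝ) 1) {p : ℕ} (hp : 1 ≤ p) {δ : ℝ}
    (hdec : ∀ φ : ℝ → ℝ, Integrable φ ν →
      |∫ x, J.indicator 1 x * φ (F^[p] x) ∂ν - ν.real J * ∫ x, φ x ∂ν| ≤ δ * ∫ x, |φ x| ∂ν)
    (hδ : 0 ≤ δ) (N : ℕ) :
    |∫ x, weight F J u N x ∂ν - (1 - u * ν.real J) ^ N| ≤
      N * (∑ j ∈ Finset.Ico 1 p, ν.real (J ∩ F^[j] ⁻¹' J) + p * ν.real J ^ 2 + δ) := by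
  set a : ℕ → ℝ := fun N => ∫ x, weight F J u N x ∂ν with ha
  set v := ν.real J with hv
  set η := ∑ j ∈ Finset.Ico 1 p, ν.real (J ∩ F^[j] ⁻¹' J) + p * v ^ 2 + δ with hη
  have hv0 : 0 ≤ v := measureReal_nonneg
  have hv1 : v ≤ 1 := measureReal_le_one
  have hmJ : ∀ j, Measurable fun x => J.indicator (1 : ℝ → ℝ) (F^[j] x) := fun j =>
    (measurable_one.indicator hJ).comp (hF.measurable.iterate j)
  have hiJ : ∀ j, Integrable (fun x => J.indicator (1 : ℝ → ℝ) (F^[j] x)) ν := fun j =>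
    Integrable.of_bound (hmJ j).aestronglyMeasurable 1 <| Eventually.of_forall fun y => by
      by_cases hy : F^[j] y ∈ J <;> simp [hy]
  have hrec : ∀ N, |a (N + 1) - (1 - u * v) * a N| ≤ η := by
    intro N
    set Ψ := weight F J u (N + 1 - p) with hΨ
    have hiΨ : Integrable Ψ ν := integrable_weight hF.measurable hJ hu _
    have hiN : Integrable (weight F J u N) ν := integrable_weight hF.measurable hJ hu _
    have hiΨp : Integrable (fun x => Ψ (F^[p] x)) ν :=
      ((hF.iterate p).integrable_comp hiΨ.aestronglyMeasurable).2 hiΨ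
    have hiNF : Integrable (fun x => weight F J u N (F x)) ν :=
      (hF.integrable_comp hiN.aestronglyMeasurable).2 hiN
    have hJmul : ∀ {g : ℝ → ℝ}, Integrable g ν → Integrable (fun x => J.indicator 1 x * g x) ν := by
      intro g hg
      have : (fun x => J.indicator 1 x * g x) = J.indicator g := by
        ext x; by_cases hx : x ∈ J <;> simp [hx]
      rw [this]; exact hg.indicator hJ
    have e1 : ∫ x, Ψ (F^[p] x) ∂ν = ∫ x, Ψ x ∂ν :=
      integral_comp_eq (hF.iterate p) hiΨ.aestronglyMeasurable
    have e2 : ∫ x, weight F J u N (F x) ∂ν = a N := integral_comp_eq hF hiN.aestronglyMeasurable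
    have e3 : a (N + 1) = a N - u * ∫ x, J.indicator 1 x * weight F J u N (F x) ∂ν := by
      rw [← e2, ← integral_const_mul, ← integral_sub hiNF ((hJmul hiNF).const_mul u)]
      refine integral_congr_ae (Eventually.of_forall fun x => ?_)
      dsimp only
      rw [weight_succ]; ring
    have hΨ1 : ∫ x, |Ψ x| ∂ν ≤ 1 := by
      have hab : ∀ x, |Ψ x| = Ψ x := fun x => abs_of_nonneg (weight_nonneg hu _ x)
      simp_rw [hab]
      calc ∫ x, Ψ x ∂ν ≤ ∫ _, (1 : ℝ) ∂ν :=
            integral_mono hiΨ (integrable_const _) fun x => weight_le_one hu _ x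
        _ = 1 := by simp
    have b1 := hdec Ψ hiΨ
    have b2 : ∫ x, J.indicator 1 x * weight F J u N (F x) ∂ν ≤
        ∫ x, J.indicator 1 x * Ψ (F^[p] x) ∂ν :=
      integral_mono (hJmul hiNF) (hJmul hiΨp) fun x => mul_le_mul_of_nonneg_left
        (weight_comp_bounds hu N hp x).1 (indicator_nonneg (fun _ _ => zero_le_one) _)
    have b3 : ∫ x, J.indicator 1 x * Ψ (F^[p] x) ∂ν -
        ∫ x, J.indicator 1 x * weight F J u N (F x) ∂ν ≤
          ∑ j ∈ Finset.Ico 1 p, ν.real (J ∩ F^[j] ⁻¹' J) := by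
      rw [← integral_sub (hJmul hiΨp) (hJmul hiNF)]
      calc _ ≤ ∫ x, J.indicator 1 x * ∑ j ∈ Finset.Ico 1 p, J.indicator 1 (F^[j] x) ∂ν := by
            refine integral_mono ((hJmul hiΨp).sub (hJmul hiNF))
              (hJmul (integrable_finsetSum _ fun j _ => hiJ j)) fun x => ?_
            dsimp only
            rw [← mul_sub]
            exact mul_le_mul_of_nonneg_left (weight_comp_bounds hu N hp x).2
              (indicator_nonneg (fun _ _ => zero_le_one) _)
        _ = ∑ j ∈ Finset.Ico 1 p, ∫ x, J.indicator 1 x * J.indicator 1 (F^[j] x) ∂ν := by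
            simp_rw [Finset.mul_sum]
            exact integral_finsetSum _ fun j _ => hJmul (hiJ j)
        _ = _ := by
            refine Finset.sum_congr rfl fun j _ => ?_
            rw [← integral_indicator_one (hJ.inter (hF.measurable.iterate j hJ))]
            congr 1; ext x
            by_cases hx : x ∈ J <;> by_cases hx' : F^[j] x ∈ J <;> simp [hx, hx']
    have b4 : a N ≤ ∫ x, Ψ x ∂ν := by
      rw [← e1, ← e2]
      exact integral_mono hiNF hiΨp fun x => (weight_comp_bounds hu N hp x).1
    -- Decorrelation produces the mean of the shortened product; this brings back `a N` itself, so
    -- that the recursion closes.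
    have b5 : ∫ x, Ψ x ∂ν - a N ≤ p * v := by
      rw [← e1, ← e2, ← integral_sub hiΨp hiNF]
      calc _ ≤ ∫ x, ∑ j ∈ Finset.Ico 1 p, J.indicator 1 (F^[j] x) ∂ν :=
            integral_mono (hiΨp.sub hiNF) (integrable_finsetSum _ fun j _ => hiJ j)
              fun x => (weight_comp_bounds hu N hp x).2
        _ = ∑ j ∈ Finset.Ico 1 p, v := by
            rw [integral_finsetSum _ fun j _ => hiJ j]
            refine Finset.sum_congr rfl fun j _ => ?_
            rw [integral_comp_eq (hF.iterate j) (g := J.indicator 1)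
              (measurable_one.indicator hJ).aestronglyMeasurable, integral_indicator_one hJ]
        _ ≤ p * v := by
            rw [Finset.sum_const, nsmul_eq_mul, Nat.card_Ico]
            gcongr; omega
    have hS : 0 ≤ ∑ j ∈ Finset.Ico 1 p, ν.real (J ∩ F^[j] ⁻¹' J) :=
      Finset.sum_nonneg fun _ _ => measureReal_nonneg
    rw [e3]
    set A := ∫ x, J.indicator 1 x * weight F J u N (F x) ∂ν
    set B := ∫ x, J.indicator 1 x * Ψ (F^[p] x) ∂ν
    set P := ∫ x, Ψ x ∂ν
    have b6 : |B - v * P| ≤ δ := b1.trans (by nlinarith)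
    have b7 : |A - v * a N| ≤ η := by
      rw [abs_le] at b6 ⊢
      have : v * (P - a N) ≤ p * v ^ 2 := by nlinarith
      have : 0 ≤ v * (P - a N) := mul_nonneg hv0 (by linarith)
      constructor <;> nlinarith
    calc |a N - u * A - (1 - u * v) * a N| = u * |A - v * a N| := by
          rw [show a N - u * A - (1 - u * v) * a N = -(u * (A - v * a N)) by ring, abs_neg,
            abs_mul, abs_of_nonneg hu.1]
      _ ≤ 1 * η := mul_le_mul hu.2 b7 (abs_nonneg _) zero_le_one
      _ = η := one_mul η
  have huv : |1 - u * v| ≤ 1 := by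
    rw [abs_le]; constructor <;> nlinarith [hu.1, hu.2, mul_nonneg hu.1 hv0]
  induction N with
  | zero => simp [weight]
  | succ N ih =>
    have h := hrec N
    change |a (N + 1) - _| ≤ _
    calc |a (N + 1) - (1 - u * v) ^ (N + 1)|
        = |(a (N + 1) - (1 - u * v) * a N) + (1 - u * v) * (a N - (1 - u * v) ^ N)| := by
          congr 1; ring
      _ ≤ η + 1 * (N * η) := by
          refine (abs_add_le _ _).trans (add_le_add h ?_)
          rw [abs_mul]
          exact mul_le_mul huv ih (abs_nonneg _) zero_le_one
      _ = ((N + 1 : ℕ) : ℝ) * η := by push_cast; ring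

end weight

/-! ### Quantitative data extracted from hyperbolic recurrence. -/

/-- What the recurrence estimates use of a hyperbolic recurrent system: invariance, decay of
correlations for grid intervals, a bounded density, and rarity of short returns. -/
structure GoodSystem (F : ℝ → ℝ) (ν : Measure ℝ) (C κ S β : ℝ) : Prop where
  measurePreserving : MeasurePreserving F ν ν
  pos : 0 < C ∧ 0 < κ ∧ 0 < S ∧ 0 < β
  decay : CellDecay F ν C κ
  density : ∀ ℓ : ℝ, 0 < ℓ → ∀ (q : ℕ) (i : ℤ), ν.real (cell ℓ q i) ≤ S * ((2 * q + 1) * ℓ)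
  short : ∀ᶠ n : ℕ in atTop, ∀ j : ℕ, 1 ≤ j → (j : ℝ) ≤ Real.log n ^ 2 →
    ν.real {x | dist x (F^[j] x) ≤ (n : ℝ) ^ (-(1 / 2) : ℝ)} ≤ C * (n : ℝ) ^ (-β)

/-- Short returns are needed only at the scale n^(-1/2), which eventually exceeds every cell
diameter used later. Since the radius is a power of n, β₀ becomes the exponent β₀/2. -/
lemma HyperbolicRecurrent.exists_goodSystem {Y : Set ℝ} {F : ℝ → ℝ} {ν : Measure ℝ}
    (h : HyperbolicRecurrent Y F ν) : ∃ C κ S β : ℝ, GoodSystem F ν C κ S β := by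
  have := h.isErgodicAcip.isProbabilityMeasure
  obtain ⟨C₁, κ, hC₁, hκ, hdec⟩ := h.expDecay.exists_cellDecay
  obtain ⟨ρ, hρ, hbv⟩ := h.density_bv
  obtain ⟨β₀, hβ₀, C₂, hC₂, hshort⟩ := h.shortReturns (1 / 2) (fun n => (n : ℝ) ^ (-(1 / 2) : ℝ))
    (by norm_num) ⟨2, by norm_num, by
      filter_upwards [eventually_gt_atTop 0] with n hn
      rw [div_self (by positivity)]
      constructor <;> norm_num⟩
  obtain ⟨S, hS, hSb⟩ : ∃ S : ℝ, 0 < S ∧ ∀ x ∈ Y, ρ x ≤ S := by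
    rcases Y.eq_empty_or_nonempty with rfl | ⟨x₀, hx₀⟩
    · exact ⟨1, one_pos, by simp⟩
    -- A function of bounded variation is bounded by one value plus its variation; the summand 1
    -- keeps S positive.
    · refine ⟨|ρ x₀| + (eVariationOn ρ Y).toReal + 1, by positivity, fun x hx => ?_⟩
      have := hbv.sub_le hx hx₀
      linarith [le_abs_self (ρ x₀)]
  refine ⟨max C₁ C₂, κ, S, β₀ / 2, ⟨h.isErgodicAcip.ergodic.toMeasurePreserving,
    ⟨lt_max_of_lt_left hC₁, hκ, hS, half_pos hβ₀.1⟩, ?_, ?_, ?_⟩⟩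
  · intro ℓ q i φ hφ j
    refine (hdec ℓ q i φ hφ j).trans ?_
    have : 0 ≤ ∫ x, |φ x| ∂ν := integral_nonneg fun x => abs_nonneg _
    gcongr
    exact le_max_left _ _
  · intro ℓ hℓ q i
    have key : ν (cell ℓ q i) ≤ ENNReal.ofReal S * volume (cell ℓ q i) := by
      rw [hρ.eq_withDensity, withDensity_apply _ (measurableSet_cell ℓ q i),
        Measure.restrict_restrict (measurableSet_cell ℓ q i)]
      calc ∫⁻ x in cell ℓ q i ∩ Y, ENNReal.ofReal (ρ x)
          ≤ ∫⁻ _ in cell ℓ q i ∩ Y, ENNReal.ofReal S :=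
            setLIntegral_mono measurable_const fun x hx => ENNReal.ofReal_le_ofReal (hSb x hx.2)
        _ ≤ _ := by
            rw [setLIntegral_const]
            gcongr
            exact inter_subset_left
    rw [volume_cell, ← ENNReal.ofReal_mul hS.le] at key
    exact ENNReal.toReal_le_of_le_ofReal (by positivity) key
  · filter_upwards [hshort] with n hn j h1 h2
    have e : ν.real {x | dist x (F^[j] x) ≤ (n : ℝ) ^ (-(1 / 2) : ℝ)} =
        ν.real (returnSet Y F j ((n : ℝ) ^ (-(1 / 2) : ℝ))) := by
      apply measureReal_congr
      have hY : ∀ᵐ x ∂ν, x ∈ Y := h.isErgodicAcip.measure_compl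
      filter_upwards [hY] with x hx
      apply propext
      exact ⟨fun h => ⟨hx, h⟩, fun h => h.2⟩
    rw [e]
    refine (hn j h1 h2).trans ?_
    rw [← Real.rpow_mul (Nat.cast_nonneg n), show -(1 / 2) * β₀ = -(β₀ / 2) by ring]
    gcongr
    exact le_max_right _ _

/-! ### Summing the fixed-interval estimate over the grid. -/

variable {F : ℝ → ℝ} {ν : Measure ℝ} {C κ S β : ℝ}

lemma sum_measureReal_cell_zero_le [IsProbabilityMeasure ν] {ℓ : ℝ} (hℓ : 0 < ℓ)
    (s : Finset ℤ) : ∑ i ∈ s, ν.real (cell ℓ 0 i) ≤ 1 := by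
  have := sum_measureReal_inter_cell_le (ν := ν) hℓ 0 s (cell ℓ 0) univ MeasurableSet.univ
    (measurableSet_cell ℓ 0) (fun _ => subset_univ _) fun _ => Subset.rfl
  simpa using this

lemma integrable_indicator_one_mul {A : Set ℝ} (hA : MeasurableSet A)
    {g : ℝ → ℝ} (hg : Integrable g ν) : Integrable (fun x => A.indicator 1 x * g x) ν := by
  have : (fun x => A.indicator 1 x * g x) = A.indicator g := by
    ext x; by_cases hx : x ∈ A <;> simp [hx]
  rw [this]; exact hg.indicator hA

lemma integral_abs_weight_le [IsProbabilityMeasure ν] (hF : Measurable F) {J : Set ℝ}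
    (hJ : MeasurableSet J) {u : ℝ} (hu : u ∈ Icc (0 : ℝ) 1) (N : ℕ) :
    ∫ x, |weight F J u N x| ∂ν ≤ 1 := by
  calc ∫ x, |weight F J u N x| ∂ν ≤ ∫ _, (1 : ℝ) ∂ν :=
        integral_mono (integrable_weight hF hJ hu N).abs (integrable_const _) fun x => by
          dsimp only
          rw [abs_of_nonneg (weight_nonneg hu N x)]; exact weight_le_one hu N x
    _ = 1 := by simp

/-- Decay at lag p splits off the initial cell, and `abs_integral_weight_sub_pow_le` evaluates what
remains. Points of one interval that return to it at time j are (2q+1)ℓ-close to their j-th iterate,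
so the short-return terms add up to the measure of such points. -/
lemma GoodSystem.sum_abs_le [IsProbabilityMeasure ν] (h : GoodSystem F ν C κ S β) {u : ℝ}
    (hu : u ∈ Icc (0 : ℝ) 1) (q : ℕ) {ℓ : ℝ} (hℓ : 0 < ℓ) {p : ℕ} (hp : 1 ≤ p) (N : ℕ)
    (s : Finset ℤ) :
    ∑ i ∈ s, |∫ x, (cell ℓ 0 i).indicator 1 x * weight F (cell ℓ q i) u N (F^[p] x) ∂ν -
        ν.real (cell ℓ 0 i) * (1 - u * ν.real (cell ℓ q i)) ^ N| ≤
      s.card * (C * Real.exp (-κ * p)) +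
        N * (S * ℓ * ((2 * q + 1) * ∑ j ∈ Finset.Ico 1 p,
          ν.real {x | dist x (F^[j] x) ≤ (2 * q + 1) * ℓ}) +
          p * (S * ((2 * q + 1) * ℓ)) ^ 2 + C * Real.exp (-κ * p)) := by
  obtain ⟨hC, hκ, hS, hβ⟩ := h.pos
  have hFm := h.measurePreserving.measurable
  set ε := C * Real.exp (-κ * p) with hε
  have hε0 : 0 ≤ ε := by positivity
  set A : ℤ → ℝ := fun i => ∑ j ∈ Finset.Ico 1 p, ν.real (cell ℓ q i ∩ F^[j] ⁻¹' cell ℓ q i)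
  have hA0 : ∀ i, 0 ≤ A i := fun i => Finset.sum_nonneg fun _ _ => measureReal_nonneg
  set B := (p : ℝ) * (S * ((2 * q + 1) * ℓ)) ^ 2
  have hB0 : 0 ≤ B := by positivity
  have each : ∀ i, |∫ x, (cell ℓ 0 i).indicator 1 x * weight F (cell ℓ q i) u N (F^[p] x) ∂ν -
        ν.real (cell ℓ 0 i) * (1 - u * ν.real (cell ℓ q i)) ^ N| ≤
      ε + (N * (S * ℓ) * A i + ν.real (cell ℓ 0 i) * (N * (B + ε))) := by
    intro i
    have h1 := h.decay ℓ 0 i _ (integrable_weight (ν := ν) hFm (measurableSet_cell ℓ q i) hu N) p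
    have h2 : C * Real.exp (-κ * p) * ∫ x, |weight F (cell ℓ q i) u N x| ∂ν ≤ ε :=
      mul_le_of_le_one_right hε0 (integral_abs_weight_le hFm (measurableSet_cell ℓ q i) hu N)
    have h3 := abs_integral_weight_sub_pow_le h.measurePreserving (measurableSet_cell ℓ q i) hu hp
      (fun φ hφ => h.decay ℓ q i φ hφ p) hε0 N
    have h4 : (p : ℝ) * ν.real (cell ℓ q i) ^ 2 ≤ B := by
      exact mul_le_mul_of_nonneg_left (pow_le_pow_left₀ measureReal_nonneg
        (h.density ℓ hℓ q i) 2) (Nat.cast_nonneg p)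
    have h5 : ν.real (cell ℓ 0 i) ≤ S * ℓ := by
      simpa using h.density ℓ hℓ 0 i
    have h6 : 0 ≤ ν.real (cell ℓ 0 i) := measureReal_nonneg
    set w := ∫ x, weight F (cell ℓ q i) u N x ∂ν
    set z := (1 - u * ν.real (cell ℓ q i)) ^ N
    calc _ ≤ |∫ x, (cell ℓ 0 i).indicator 1 x * weight F (cell ℓ q i) u N (F^[p] x) ∂ν -
              ν.real (cell ℓ 0 i) * w| + |ν.real (cell ℓ 0 i) * (w - z)| := by
            rw [mul_sub]; exact abs_sub_le _ _ _
      _ ≤ ε + ν.real (cell ℓ 0 i) * (N * (A i + B + ε)) := by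
            rw [abs_mul, abs_of_nonneg h6]
            refine add_le_add (h1.trans h2) (mul_le_mul_of_nonneg_left (h3.trans ?_) h6)
            gcongr
      _ = ε + (ν.real (cell ℓ 0 i) * (N * A i) + ν.real (cell ℓ 0 i) * (N * (B + ε))) := by ring
      -- Only the sum of the A i over all cells is controlled, so here the mass of the small cell is
      -- replaced by its uniform bound Sℓ. In the other term the mass is kept, since these masses
      -- sum to at most 1.
      _ ≤ ε + (S * ℓ * (N * A i) + ν.real (cell ℓ 0 i) * (N * (B + ε))) := by
            have := hA0 i
            gcongr
      _ = _ := by ring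
  have hAsum : ∑ i ∈ s, A i ≤ (2 * q + 1) * ∑ j ∈ Finset.Ico 1 p,
      ν.real {x | dist x (F^[j] x) ≤ (2 * q + 1) * ℓ} := by
    rw [Finset.sum_comm, Finset.mul_sum]
    refine Finset.sum_le_sum fun j _ => ?_
    refine sum_measureReal_inter_cell_le hℓ q s _ _
      (measurableSet_le (measurable_id.dist (hFm.iterate j)) measurable_const) (fun i =>
        (measurableSet_cell ℓ q i).inter (hFm.iterate j (measurableSet_cell ℓ q i)))
      (fun i x hx => dist_le_of_mem_cell_of_mem_cell hx.1 hx.2) fun i => inter_subset_left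
  refine (Finset.sum_le_sum fun i _ => each i).trans ?_
  rw [Finset.sum_add_distrib, Finset.sum_add_distrib, Finset.sum_const, nsmul_eq_mul,
    ← Finset.mul_sum, ← Finset.sum_mul]
  have h7 := sum_measureReal_cell_zero_le (ν := ν) hℓ s
  calc _ ≤ s.card * ε + (N * (S * ℓ) * ((2 * q + 1) * ∑ j ∈ Finset.Ico 1 p,
          ν.real {x | dist x (F^[j] x) ≤ (2 * q + 1) * ℓ}) + 1 * (N * (B + ε))) := by gcongr
    _ = _ := by ring

/-! ### Meshes depending on time, and the size of the errors. -/

/-- The mesh `ℓ n` of the grid is, up to powers of `log n`, at most `1 / n`, and it is not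
smaller than `n ^ (-3)`. -/
def AdmissibleMesh (ℓ : ℕ → ℝ) : Prop :=
  ∃ D : ℝ, ∀ᶠ n : ℕ in atTop, ((n : ℝ) ^ 3)⁻¹ ≤ ℓ n ∧ n * ℓ n ≤ Real.log n ^ D

/-- The gap `⌊(log n)²⌋`. -/
def gap (n : ℕ) : ℕ := ⌊Real.log n ^ 2⌋₊

/-- The indices of the grid cells meeting `[-n, n]`. -/
def gridRange (ℓ : ℕ → ℝ) (n : ℕ) : Finset ℤ := Finset.Icc (-⌈n / ℓ n⌉) ⌈n / ℓ n⌉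

lemma eventually_log_rpow_mul_le (c D : ℝ) {b : ℝ} (hb : 0 < b) :
    ∀ᶠ n : ℕ in atTop, c * Real.log n ^ D ≤ (n : ℝ) ^ b := by
  have h := (isLittleO_log_rpow_rpow_atTop D hb).comp_tendsto tendsto_natCast_atTop_atTop
  have hc : (0 : ℝ) < 1 / (|c| + 1) := by positivity
  filter_upwards [h.bound hc, eventually_ge_atTop 1] with n hn hn1
  simp only [Function.comp_apply, Real.norm_eq_abs] at hn
  have h0 : (0 : ℝ) ≤ Real.log n := Real.log_natCast_nonneg n
  rw [abs_of_nonneg (Real.rpow_nonneg h0 D),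
    abs_of_nonneg (Real.rpow_nonneg (Nat.cast_nonneg n) b)] at hn
  have h1 : (0 : ℝ) ≤ Real.log n ^ D := Real.rpow_nonneg h0 D
  calc c * Real.log n ^ D ≤ (|c| + 1) * Real.log n ^ D := by
        gcongr; linarith [le_abs_self c]
    _ ≤ (|c| + 1) * (1 / (|c| + 1) * (n : ℝ) ^ b) := by gcongr
    _ = (n : ℝ) ^ b := by field_simp

lemma tendsto_log_natCast : Tendsto (fun n : ℕ => Real.log n) atTop atTop :=
  Real.tendsto_log_atTop.comp tendsto_natCast_atTop_atTop

lemma eventually_one_le_gap : ∀ᶠ n : ℕ in atTop, 1 ≤ gap n := by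
  filter_upwards [tendsto_log_natCast.eventually_ge_atTop 1] with n hn
  rw [gap, Nat.one_le_floor_iff]
  nlinarith

lemma gap_le (n : ℕ) : (gap n : ℝ) ≤ Real.log n ^ 2 := Nat.floor_le (sq_nonneg _)

lemma AdmissibleMesh.eventually_pos {ℓ : ℕ → ℝ} (hℓ : AdmissibleMesh ℓ) :
    ∀ᶠ n : ℕ in atTop, 0 < ℓ n := by
  obtain ⟨D, hD⟩ := hℓ
  filter_upwards [hD, eventually_gt_atTop 0] with n hn hn0
  exact lt_of_lt_of_le (by positivity) hn.1

lemma AdmissibleMesh.eventually_mul_le {ℓ : ℕ → ℝ} (hℓ : AdmissibleMesh ℓ) (c : ℝ)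
    (hc : 0 ≤ c) :
    ∀ᶠ n : ℕ in atTop, c * ℓ n ≤ (n : ℝ) ^ (-(1 / 2) : ℝ) := by
  obtain ⟨D, hD⟩ := hℓ
  filter_upwards [hD, eventually_gt_atTop 0,
    eventually_log_rpow_mul_le c D (b := 1 / 2) (by norm_num)] with n hn hn0 hlog
  have hn' : (0 : ℝ) < n := by exact_mod_cast hn0
  have h1 : c * (n * ℓ n) ≤ (n : ℝ) ^ (1 / 2 : ℝ) := le_trans (by gcongr; exact hn.2) hlog
  have h2 : (n : ℝ) ^ (-(1 / 2) : ℝ) = (n : ℝ) ^ (1 / 2 : ℝ) / n := by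
    rw [show (-(1 / 2) : ℝ) = 1 / 2 - 1 by norm_num, Real.rpow_sub hn', Real.rpow_one]
  rw [h2, le_div_iff₀ hn']
  linarith

lemma AdmissibleMesh.tendsto_zero {ℓ : ℕ → ℝ} (hℓ : AdmissibleMesh ℓ) :
    Tendsto ℓ atTop (𝓝[>] 0) := by
  refine tendsto_nhdsWithin_iff.2 ⟨?_, hℓ.eventually_pos⟩
  have h := hℓ.eventually_mul_le 1 zero_le_one
  simp only [one_mul] at h
  refine squeeze_zero' (hℓ.eventually_pos.mono fun _ h => h.le) h ?_
  exact (tendsto_rpow_neg_atTop (y := 1 / 2) (by norm_num)).comp tendsto_natCast_atTop_atTop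

/-- exp(-κ(log n)²) is at most n^(-6) once κ log n ≥ 6, and exp κ pays for the integer part in the
gap. The power 4 is the order of the number of cells. -/
lemma eventually_mul_exp_gap_le (hκ : 0 < κ) (c : ℝ) (hc : 0 ≤ c) :
    ∀ᶠ n : ℕ in atTop, c * (n : ℝ) ^ 4 * Real.exp (-κ * gap n) ≤ (n : ℝ) ^ (-1 : ℝ) := by
  filter_upwards [tendsto_log_natCast.eventually_ge_atTop (6 / κ), eventually_gt_atTop 0,
    tendsto_natCast_atTop_atTop.eventually_ge_atTop (c * Real.exp κ)] with n hlog hn0 hnc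
  have hn' : (0 : ℝ) < n := by exact_mod_cast hn0
  have hg : Real.log n ^ 2 - 1 ≤ gap n := by
    have := Nat.lt_floor_add_one (Real.log n ^ 2)
    rw [gap]; linarith
  have h6 : 6 ≤ κ * Real.log n := by
    rw [div_le_iff₀ hκ] at hlog; linarith
  have hl0 : (0 : ℝ) ≤ Real.log n := Real.log_natCast_nonneg n
  have h1 : Real.exp (-κ * gap n) ≤ Real.exp κ * ((n : ℝ) ^ 6)⁻¹ := by
    have : ((n : ℝ) ^ 6)⁻¹ = Real.exp (-(6 * Real.log n)) := by
      rw [Real.exp_neg]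
      congr 1
      rw [show (6 : ℝ) = ((6 : ℕ) : ℝ) by norm_num, Real.exp_nat_mul, Real.exp_log hn']
    rw [this, ← Real.exp_add]
    apply Real.exp_le_exp.2
    nlinarith
  calc c * (n : ℝ) ^ 4 * Real.exp (-κ * gap n)
      ≤ c * (n : ℝ) ^ 4 * (Real.exp κ * ((n : ℝ) ^ 6)⁻¹) := by gcongr
    _ = (c * Real.exp κ) * ((n : ℝ) ^ 2)⁻¹ := by field_simp
    _ ≤ n * ((n : ℝ) ^ 2)⁻¹ := by gcongr
    _ = (n : ℝ) ^ (-1 : ℝ) := by rw [Real.rpow_neg_one]; field_simp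

lemma card_gridRange_le {ℓ : ℕ → ℝ} {n : ℕ} (hn : 0 < n) (hℓ : ((n : ℝ) ^ 3)⁻¹ ≤ ℓ n) :
    ((gridRange ℓ n).card : ℝ) ≤ 5 * (n : ℝ) ^ 4 := by
  have hn' : (1 : ℝ) ≤ n := by exact_mod_cast hn
  have hpos : 0 < ℓ n := lt_of_lt_of_le (by positivity) hℓ
  have h0 : 0 ≤ ⌈n / ℓ n⌉ := Int.ceil_nonneg (by positivity)
  have h1 : (n : ℝ) / ℓ n ≤ (n : ℝ) ^ 4 := by
    rw [div_le_iff₀ hpos]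
    calc (n : ℝ) = (n : ℝ) ^ 4 * ((n : ℝ) ^ 3)⁻¹ := by field_simp
      _ ≤ _ := by gcongr
  have h2 := (Int.ceil_lt_add_one ((n : ℝ) / ℓ n)).le
  have h3 : ((gridRange ℓ n).card : ℤ) = 2 * ⌈n / ℓ n⌉ + 1 := by
    rw [gridRange, Int.card_Icc]; omega
  have h4 : ((gridRange ℓ n).card : ℝ) = 2 * ⌈n / ℓ n⌉ + 1 := by exact_mod_cast h3
  rw [h4]
  have : (1 : ℝ) ≤ (n : ℝ) ^ 4 := one_le_pow₀ hn'
  linarith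

/-- Up to powers of log n, the errors are n⁴ exp(-κ(log n)²) from decorrelation, nℓ · n^(-β) from
short returns, and nℓ² from coincidences within the gap; since nℓ is at most a power of log n, all
are negative powers of n. -/
lemma GoodSystem.sum_abs_le_rpow [IsProbabilityMeasure ν] (h : GoodSystem F ν C κ S β) {u : ℝ}
    (hu : u ∈ Icc (0 : ℝ) 1) (q : ℕ) {ℓ : ℕ → ℝ} (hℓ : AdmissibleMesh ℓ) {N : ℕ → ℕ}
    (hN : ∀ᶠ n in atTop, N n ≤ 2 * n) :
    ∃ b : ℝ, 0 < b ∧ ∀ᶠ n : ℕ in atTop,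
      ∑ i ∈ gridRange ℓ n, |∫ x, (cell (ℓ n) 0 i).indicator 1 x *
          weight F (cell (ℓ n) q i) u (N n) (F^[gap n] x) ∂ν -
        ν.real (cell (ℓ n) 0 i) * (1 - u * ν.real (cell (ℓ n) q i)) ^ N n| ≤ (n : ℝ) ^ (-b) := by
  obtain ⟨hC, hκ, hS, hβ⟩ := h.pos
  have hmesh := hℓ
  obtain ⟨D, hD⟩ := hℓ
  -- Half of the available exponents β and 1: the other half absorbs the logarithms and constants.
  set b := min β 1 / 2 with hb
  have hb0 : 0 < b := by positivity
  refine ⟨b, hb0, ?_⟩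
  filter_upwards [hD, hN, hmesh.eventually_pos, eventually_one_le_gap, h.short,
    hmesh.eventually_mul_le (2 * q + 1) (by positivity),
    eventually_mul_exp_gap_le hκ (7 * C) (by positivity), eventually_gt_atTop 0,
    eventually_log_rpow_mul_le (6 * (S * (2 * q + 1) * C)) (D + 2) (b := β / 2) (by positivity),
    eventually_log_rpow_mul_le (6 * (S * (2 * q + 1)) ^ 2) (2 * D + 2) (b := 1 / 2) (by norm_num),
    eventually_ge_atTop 9, tendsto_log_natCast.eventually_gt_atTop 0]
    with n hD hN hpos hgap hshort hhalf hexp hn0 hl1 hl2 hn9 hlog0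
  have hn' : (0 : ℝ) < n := by exact_mod_cast hn0
  have hn1 : (1 : ℝ) ≤ n := by exact_mod_cast hn0
  refine (h.sum_abs_le hu q hpos hgap (N n) (gridRange ℓ n)).trans ?_
  set L := Real.log n with hL
  have hN' : (N n : ℝ) ≤ 2 * n := by exact_mod_cast hN
  have hsh : ∑ j ∈ Finset.Ico 1 (gap n), ν.real {x | dist x (F^[j] x) ≤ (2 * q + 1) * ℓ n} ≤
      L ^ 2 * (C * (n : ℝ) ^ (-β)) := by
    calc _ ≤ ∑ j ∈ Finset.Ico 1 (gap n), C * (n : ℝ) ^ (-β) := by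
          refine Finset.sum_le_sum fun j hj => ?_
          rw [Finset.mem_Ico] at hj
          refine (measureReal_mono fun x hx => ?_).trans (hshort j hj.1 ?_)
          · exact le_trans hx hhalf
          · have : (j : ℝ) ≤ gap n := by exact_mod_cast hj.2.le
            exact this.trans (gap_le n)
      _ ≤ L ^ 2 * (C * (n : ℝ) ^ (-β)) := by
          rw [Finset.sum_const, nsmul_eq_mul, Nat.card_Ico]
          gcongr
          refine le_trans ?_ (gap_le n)
          exact_mod_cast Nat.sub_le _ _
  have hcard := card_gridRange_le hn0 hD.1
  set E := Real.exp (-κ * gap n)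
  have hE : 0 < E := Real.exp_pos _
  have hnn : (n : ℝ) ≤ (n : ℝ) ^ 4 := le_self_pow₀ hn1 (by norm_num)
  have t1 : ((gridRange ℓ n).card : ℝ) * (C * E) + N n * (C * E) ≤ (n : ℝ) ^ (-1 : ℝ) := by
    refine le_trans ?_ hexp
    calc _ ≤ 5 * (n : ℝ) ^ 4 * (C * E) + (2 * (n : ℝ) ^ 4) * (C * E) := by
          have : (N n : ℝ) ≤ 2 * (n : ℝ) ^ 4 := by linarith
          gcongr
      _ = _ := by ring
  have hLD : 0 ≤ L ^ D := Real.rpow_nonneg hlog0.le D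
  have t2 : N n * (S * ℓ n * ((2 * q + 1) * (L ^ 2 * (C * (n : ℝ) ^ (-β))))) ≤
      (n : ℝ) ^ (-b) / 3 := by
    have e1 : L ^ (D + 2) = L ^ D * L ^ 2 := by
      rw [Real.rpow_add hlog0]; norm_num
    have : (n : ℝ) ^ (β / 2) * (n : ℝ) ^ (-β) ≤ (n : ℝ) ^ (-b) := by
      rw [← Real.rpow_add hn']
      apply Real.rpow_le_rpow_of_exponent_le hn1
      have := min_le_left β 1; rw [hb]; linarith
    calc _ ≤ 2 * n * (S * ℓ n * ((2 * q + 1) * (L ^ 2 * (C * (n : ℝ) ^ (-β))))) := by gcongr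
      _ = 2 * (n * ℓ n) * (S * (2 * q + 1) * C) * L ^ 2 * (n : ℝ) ^ (-β) := by ring
      _ ≤ 2 * L ^ D * (S * (2 * q + 1) * C) * L ^ 2 * (n : ℝ) ^ (-β) := by gcongr; exact hD.2
      _ = (6 * (S * (2 * q + 1) * C) * L ^ (D + 2)) * (n : ℝ) ^ (-β) / 3 := by rw [e1]; ring
      _ ≤ (n : ℝ) ^ (β / 2) * (n : ℝ) ^ (-β) / 3 := by gcongr
      _ ≤ _ := by gcongr
  have t3 : N n * (gap n * (S * ((2 * q + 1) * ℓ n)) ^ 2) ≤ (n : ℝ) ^ (-b) / 3 := by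
    have e1 : L ^ (2 * D + 2) = L ^ D * L ^ D * L ^ 2 := by
      rw [show 2 * D + 2 = D + D + 2 by ring, Real.rpow_add hlog0, Real.rpow_add hlog0]; norm_num
    have : (n : ℝ) ^ (1 / 2 : ℝ) * (n : ℝ)⁻¹ ≤ (n : ℝ) ^ (-b) := by
      rw [← Real.rpow_neg_one, ← Real.rpow_add hn']
      apply Real.rpow_le_rpow_of_exponent_le hn1
      have := min_le_right β 1; rw [hb]; linarith
    calc _ ≤ 2 * n * (L ^ 2 * (S * ((2 * q + 1) * ℓ n)) ^ 2) := by
          have := gap_le n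
          gcongr
      _ = 2 * (n * ℓ n) * (n * ℓ n) * (S * (2 * q + 1)) ^ 2 * L ^ 2 * (n : ℝ)⁻¹ := by field_simp
      _ ≤ 2 * L ^ D * L ^ D * (S * (2 * q + 1)) ^ 2 * L ^ 2 * (n : ℝ)⁻¹ := by
          gcongr; exacts [hD.2, hD.2]
      _ = (6 * (S * (2 * q + 1)) ^ 2 * L ^ (2 * D + 2)) * (n : ℝ)⁻¹ / 3 := by rw [e1]; ring
      _ ≤ (n : ℝ) ^ (1 / 2 : ℝ) * (n : ℝ)⁻¹ / 3 := by gcongr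
      _ ≤ _ := by gcongr
  have t4 : (n : ℝ) ^ (-1 : ℝ) ≤ (n : ℝ) ^ (-b) / 3 := by
    have h9 : (3 : ℝ) ≤ (n : ℝ) ^ (1 / 2 : ℝ) := by
      rw [← Real.sqrt_eq_rpow]
      apply Real.le_sqrt_of_sq_le
      have : (9 : ℝ) ≤ n := by exact_mod_cast hn9
      linarith
    rw [le_div_iff₀ (by norm_num)]
    calc (n : ℝ) ^ (-1 : ℝ) * 3 ≤ (n : ℝ) ^ (-1 : ℝ) * (n : ℝ) ^ (1 / 2 : ℝ) := by gcongr
      _ = (n : ℝ) ^ (-1 + 1 / 2 : ℝ) := by rw [Real.rpow_add hn']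
      _ ≤ _ := by
          apply Real.rpow_le_rpow_of_exponent_le hn1
          have := min_le_right β 1; rw [hb]; linarith
  calc _ ≤ ((gridRange ℓ n).card : ℝ) * (C * E) +
        N n * (S * ℓ n * ((2 * q + 1) * (L ^ 2 * (C * (n : ℝ) ^ (-β)))) +
          gap n * (S * ((2 * q + 1) * ℓ n)) ^ 2 + C * E) := by gcongr
    _ = (((gridRange ℓ n).card : ℝ) * (C * E) + N n * (C * E)) +
        N n * (S * ℓ n * ((2 * q + 1) * (L ^ 2 * (C * (n : ℝ) ^ (-β))))) +
        N n * (gap n * (S * ((2 * q + 1) * ℓ n)) ^ 2) := by ring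
    _ ≤ _ := by linarith

/-! ### Densities and Lebesgue differentiation. -/

section density

variable {X : Set ℝ} {μ : Measure ℝ} {ρ : ℝ → ℝ}

lemma IsDensity.ae_nonneg (hX : MeasurableSet X) (h : IsDensity X μ ρ) :
    0 ≤ᵐ[volume.restrict X] ρ :=
  (ae_restrict_iff' hX).2 (Eventually.of_forall h.nonneg)

lemma IsDensity.integrableOn [IsFiniteMeasure μ] (hX : MeasurableSet X) (h : IsDensity X μ ρ) :
    IntegrableOn ρ X := by
  refine ⟨h.aemeasurable.aestronglyMeasurable, ?_⟩
  rw [hasFiniteIntegral_iff_ofReal (h.ae_nonneg hX)]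
  have := measure_lt_top μ univ
  rw [h.eq_withDensity, withDensity_apply _ MeasurableSet.univ, Measure.restrict_univ] at this
  exact this

lemma IsDensity.measureReal_eq (hX : MeasurableSet X) (h : IsDensity X μ ρ) {E : Set ℝ}
    (hE : MeasurableSet E) : μ.real E = ∫ x in E ∩ X, ρ x := by
  rw [measureReal_def, h.eq_withDensity, withDensity_apply _ hE, Measure.restrict_restrict hE,
    integral_eq_lintegral_of_nonneg_ae]
  · exact ae_mono (Measure.restrict_mono_set _ inter_subset_right) (h.ae_nonneg hX)
  · exact (h.aemeasurable.mono_measure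
      (Measure.restrict_mono_set _ inter_subset_right)).aestronglyMeasurable

lemma IsDensity.integral_eq (hX : MeasurableSet X) (h : IsDensity X μ ρ) (g : ℝ → ℝ) :
    ∫ x, g x ∂μ = ∫ x in X, ρ x * g x := by
  conv_lhs => rw [h.eq_withDensity]
  rw [integral_withDensity_eq_integral_toReal_smul₀ h.aemeasurable.ennreal_ofReal
    (Eventually.of_forall fun x => ENNReal.ofReal_lt_top)]
  refine integral_congr_ae ?_
  filter_upwards [h.ae_nonneg hX] with x hx
  rw [ENNReal.toReal_ofReal hx, smul_eq_mul]

/-- Lebesgue differentiation along grid intervals. -/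
lemma IsDensity.ae_tendsto_cell [IsFiniteMeasure μ] (hX : MeasurableSet X)
    (h : IsDensity X μ ρ) {B : Set ℝ} (hB : MeasurableSet B) :
    ∀ᵐ x, ∀ (q : ℕ) (ℓ : ℕ → ℝ), Tendsto ℓ atTop (𝓝[>] 0) →
      Tendsto (fun n => μ.real (B ∩ cell (ℓ n) q ⌊x / ℓ n⌋) / ((2 * q + 1) * ℓ n)) atTop
        (𝓝 ((B ∩ X).indicator ρ x)) := by
  have hint : Integrable ((B ∩ X).indicator ρ) :=
    ((h.integrableOn hX).mono_set inter_subset_right).integrable_indicator (hB.inter hX)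
  filter_upwards [IsUnifLocDoublingMeasure.ae_tendsto_average (μ := volume)
    hint.locallyIntegrable 1] with x hx q ℓ hℓ
  have hpos : ∀ᶠ n in atTop, 0 < ℓ n := (tendsto_nhdsWithin_iff.1 hℓ).2
  have hq : (0 : ℝ) < q + 1 / 2 := by positivity
  have hδ : Tendsto (fun n => ((q : ℝ) + 1 / 2) * ℓ n) atTop (𝓝[>] 0) := by
    refine tendsto_nhdsWithin_iff.2 ⟨?_, hpos.mono fun n hn => mul_pos hq hn⟩
    simpa using (tendsto_nhdsWithin_iff.1 hℓ).1.const_mul ((q : ℝ) + 1 / 2)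
  -- The enlarged cell is a ball about the midpoint of the small cell. This ball is not centred at x
  -- but contains it, which the differentiation theorem with constant 1 allows.
  have := hx (fun n => ((⌊x / ℓ n⌋ : ℝ) + 1 / 2) * ℓ n) (fun n => (q + 1 / 2) * ℓ n) hδ (by
    filter_upwards [hpos] with n hn
    obtain ⟨h1, h2⟩ := mem_cell_floor hn 0 x
    simp only [Nat.cast_zero, sub_zero, add_zero] at h1 h2
    have : 0 ≤ (q : ℝ) * ℓ n := by positivity
    rw [Metric.mem_closedBall, Real.dist_eq, abs_le]
    constructor <;> nlinarith)
  refine this.congr' ?_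
  filter_upwards [hpos] with n hn
  have hball : Metric.closedBall (((⌊x / ℓ n⌋ : ℝ) + 1 / 2) * ℓ n) ((q + 1 / 2) * ℓ n) =
      Icc (((⌊x / ℓ n⌋ : ℝ) - q) * ℓ n) ((⌊x / ℓ n⌋ + q + 1) * ℓ n) := by
    rw [Real.closedBall_eq_Icc]; congr 1 <;> ring
  have hae : (Icc (((⌊x / ℓ n⌋ : ℝ) - q) * ℓ n) ((⌊x / ℓ n⌋ + q + 1) * ℓ n) : Set ℝ) =ᵐ[volume]
      cell (ℓ n) q ⌊x / ℓ n⌋ := Ico_ae_eq_Icc.symm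
  rw [hball, setAverage_congr hae, setAverage_eq, measureReal_def, volume_cell,
    ENNReal.toReal_ofReal (by positivity), smul_eq_mul, inv_mul_eq_div,
    setIntegral_indicator (hB.inter hX), h.measureReal_eq hX (hB.inter (measurableSet_cell _ _ _))]
  congr 3
  ext y; simp only [mem_inter_iff]; tauto

end density

/-! ### The pointwise ergodic theorem for indicators. -/

section birkhoff

variable {f : ℝ → ℝ} {μ : Measure ℝ} {B : Set ℝ}

/-- The number of visits to `B` at times `0 ≤ j < n`. -/
def visitSum (f : ℝ → ℝ) (B : Set ℝ) (n : ℕ) (x : ℝ) : ℝ :=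
  ∑ j ∈ Finset.range n, B.indicator 1 (f^[j] x)

lemma visitSum_add (m n : ℕ) (x : ℝ) :
    visitSum f B (m + n) x = visitSum f B m x + visitSum f B n (f^[m] x) := by
  simp only [visitSum, Finset.sum_range_add, ← Function.iterate_add_apply]
  congr 1
  exact Finset.sum_congr rfl fun j _ => by rw [add_comm]

lemma visitSum_one (x : ℝ) : visitSum f B 1 x = B.indicator 1 x := by simp [visitSum]

lemma indicator_one_nonneg (B : Set ℝ) (x : ℝ) : (0 : ℝ) ≤ B.indicator 1 x :=
  indicator_nonneg (fun _ _ => zero_le_one) _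

lemma indicator_one_le (B : Set ℝ) (x : ℝ) : B.indicator (1 : ℝ → ℝ) x ≤ 1 :=
  indicator_le_self' (fun _ _ => zero_le_one) _

lemma visitSum_nonneg (n : ℕ) (x : ℝ) : 0 ≤ visitSum f B n x :=
  Finset.sum_nonneg fun _ _ => indicator_one_nonneg _ _

lemma visitSum_le (n : ℕ) (x : ℝ) : visitSum f B n x ≤ n := by
  calc visitSum f B n x ≤ ∑ j ∈ Finset.range n, (1 : ℝ) :=
        Finset.sum_le_sum fun _ _ => indicator_one_le _ _
    _ = n := by simp

lemma measurable_visitSum (hf : Measurable f) (hB : MeasurableSet B) (n : ℕ) :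
    Measurable (visitSum f B n) :=
  Finset.measurable_fun_sum _ fun j _ => (measurable_one.indicator hB).comp (hf.iterate j)

lemma integrable_indicator_one_comp [IsFiniteMeasure μ] {g : ℝ → ℝ} (hg : Measurable g)
    (hB : MeasurableSet B) : Integrable (fun x => B.indicator (1 : ℝ → ℝ) (g x)) μ :=
  Integrable.of_bound ((measurable_one.indicator hB).comp hg).aestronglyMeasurable 1 <|
    Eventually.of_forall fun y => by
      rw [Real.norm_of_nonneg (indicator_one_nonneg _ _)]; exact indicator_one_le _ _

lemma integral_visitSum [IsFiniteMeasure μ] (hf : MeasurePreserving f μ μ)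
    (hB : MeasurableSet B) (n : ℕ) : ∫ x, visitSum f B n x ∂μ = n * μ.real B := by
  unfold visitSum
  rw [integral_finsetSum _ fun j _ => integrable_indicator_one_comp (hf.measurable.iterate j) hB]
  have : ∀ j, ∫ x, B.indicator (1 : ℝ → ℝ) (f^[j] x) ∂μ = μ.real B := fun j => by
    rw [integral_comp_eq (hf.iterate j) (g := B.indicator 1)
      (measurable_one.indicator hB).aestronglyMeasurable, integral_indicator_one hB]
  simp [this]

/-- The covering argument in the proof of the ergodic theorem. -/
lemma mul_sub_le_visitSum {a : ℝ} (ha0 : 0 ≤ a) (ha1 : a ≤ 1) {D : Set ℝ} {M : ℕ}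
    (hD : ∀ x, x ∉ D → ∃ n, 1 ≤ n ∧ n ≤ M ∧ a * n ≤ visitSum f B n x) (L : ℕ) :
    ∀ x, a * ((L : ℝ) - M) ≤ visitSum f (B ∪ D) L x := by
  induction L using Nat.strong_induction_on with
  | _ L ih =>
    intro x
    rcases le_or_gt L M with hL | hL
    · refine le_trans (mul_nonpos_of_nonneg_of_nonpos ha0 ?_) (visitSum_nonneg L x)
      rw [sub_nonpos]; exact_mod_cast hL
    · by_cases hx : x ∈ D
      · obtain ⟨K, rfl⟩ : ∃ K, L = 1 + K := ⟨L - 1, by omega⟩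
        rw [visitSum_add, visitSum_one, indicator_of_mem (show x ∈ B ∪ D from Or.inr hx)]
        have := ih K (by omega) (f^[1] x)
        push_cast at this ⊢
        simp only [Pi.one_apply]
        linarith
      · obtain ⟨n, hn1, hnM, hn⟩ := hD x hx
        obtain ⟨K, rfl⟩ : ∃ K, L = n + K := ⟨L - n, by omega⟩
        rw [visitSum_add]
        have h1 := ih K (by omega) (f^[n] x)
        have h2 : visitSum f B n x ≤ visitSum f (B ∪ D) n x :=
          Finset.sum_le_sum fun j _ => indicator_le_indicator_of_subset subset_union_left
            (fun _ => zero_le_one) _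
        push_cast at h1 ⊢
        linarith

/-- If the upper frequency reached c on a set of positive measure, ergodicity would make it do so
almost everywhere. Adding to B a small set where the first good block is too long, orbits can be cut
into bounded blocks of frequency at least a, up to a bounded end; integrating then contradicts
invariance. -/
lemma ae_eventually_visitSum_lt [IsProbabilityMeasure μ] (hf : Ergodic f μ)
    (hB : MeasurableSet B) {c : ℝ} (hc : μ.real B < c) :
    ∀ᵐ x ∂μ, ∀ᶠ n : ℕ in atTop, visitSum f B n x < c * n := by
  -- The covering argument needs a ≤ 1, because a point of the exceptional set is a block of length
  -- 1 with one visit.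
  rcases lt_or_ge 1 c with hc1 | hc1
  · refine Eventually.of_forall fun x => ?_
    filter_upwards [eventually_gt_atTop 0] with n hn
    have : (0 : ℝ) < n := by exact_mod_cast hn
    nlinarith [visitSum_le (f := f) (B := B) n x]
  -- The upper frequency is at least c. The room between a and c absorbs the single term changed by
  -- a shift, so E is exactly invariant; rational a keeps it measurable.
  set E : Set ℝ := {x | ∀ a : ℚ, (a : ℝ) < c → ∀ M : ℕ, ∃ n, M ≤ n ∧ a * n ≤ visitSum f B n x}
    with hE
  have hfm := hf.measurable
  have hEm : MeasurableSet E := by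
    have : E = ⋂ a : ℚ, ⋂ (_ : (a : ℝ) < c), ⋂ M : ℕ, ⋃ n, ⋃ (_ : M ≤ n),
        {x | a * n ≤ visitSum f B n x} := by
      ext x; simp [hE]
    rw [this]
    exact MeasurableSet.iInter fun a => MeasurableSet.iInter fun _ => MeasurableSet.iInter fun M =>
      MeasurableSet.iUnion fun n => MeasurableSet.iUnion fun _ =>
        measurableSet_le measurable_const (measurable_visitSum hfm hB n)
  have hshift : ∀ n x, visitSum f B (n + 1) x = B.indicator 1 x + visitSum f B n (f x) := by
    intro n x; rw [add_comm n, visitSum_add, visitSum_one]; rfl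
  have hinv : f ⁻¹' E = E := by
    ext x
    constructor
    · intro hx a ha M
      obtain ⟨a', h1, h2⟩ := exists_rat_btwn ha
      obtain ⟨K, hK⟩ := exists_nat_gt ((a : ℝ) / (a' - a))
      obtain ⟨n, hn, hn'⟩ := hx a' h2 (max M K)
      refine ⟨n + 1, by omega, ?_⟩
      rw [hshift]
      have h3 : (K : ℝ) ≤ n := by exact_mod_cast (le_max_right M K).trans hn
      rw [div_lt_iff₀ (by linarith)] at hK
      have := indicator_one_nonneg B x
      push_cast
      nlinarith
    · intro hx a ha M
      obtain ⟨a', h1, h2⟩ := exists_rat_btwn ha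
      obtain ⟨K, hK⟩ := exists_nat_gt ((1 - a' : ℝ) / (a' - a))
      obtain ⟨n, hn, hn'⟩ := hx a' h2 (max M K + 1)
      obtain ⟨k, rfl⟩ : ∃ k, n = k + 1 := ⟨n - 1, by omega⟩
      refine ⟨k, by omega, ?_⟩
      rw [hshift] at hn'
      have h3 : (K : ℝ) ≤ k := by
        exact_mod_cast (le_max_right M K).trans (Nat.le_of_succ_le_succ hn)
      rw [div_lt_iff₀ (by linarith)] at hK
      have := indicator_one_le B x
      push_cast at hn'
      nlinarith
  rcases eventuallyConst_set'.1 (hf.toPreErgodic.aeconst_set hEm hinv) with h | h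
  · filter_upwards [h] with x hx
    have hx' : x ∉ E := fun hxE => by
      have : (∅ : Set ℝ) x := hx ▸ hxE
      exact this
    simp only [hE, mem_ofPred_eq] at hx'
    push Not at hx'
    obtain ⟨a, ha, M, hM⟩ := hx'
    filter_upwards [eventually_ge_atTop M] with n hn
    exact (hM n hn).trans_le (by gcongr)
  · exfalso
    -- Then a exceeds μ(B) + 3ε, while the enlarged set has measure at most μ(B) + ε, so the loss aM
    -- < Lε cannot save the inequality `key`.
    set ε := (c - μ.real B) / 4 with hε
    have hε0 : 0 < ε := by rw [hε]; linarith
    obtain ⟨a, ha1, ha2⟩ := exists_rat_btwn (show c - ε < c by linarith)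
    set D : ℕ → Set ℝ := fun M => {x | ∀ n, 1 ≤ n → n ≤ M → visitSum f B n x < a * n} with hD
    have hDm : ∀ M, MeasurableSet (D M) := by
      intro M
      have : D M = ⋂ n, ⋂ (_ : 1 ≤ n), ⋂ (_ : n ≤ M), {x | visitSum f B n x < a * n} := by
        ext x; simp [hD]
      rw [this]
      exact MeasurableSet.iInter fun n => MeasurableSet.iInter fun _ => MeasurableSet.iInter
        fun _ => measurableSet_lt (measurable_visitSum hfm hB n) measurable_const
    have hDanti : Antitone D := fun M M' h x hx n h1 h2 => hx n h1 (h2.trans h)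
    have hDnull : μ (⋂ M, D M) = 0 := by
      refine measure_mono_null (t := Eᶜ) (fun x hx hxE => ?_) ?_
      · obtain ⟨n, hn, hn'⟩ := hxE a ha2 1
        exact absurd (mem_iInter.1 hx n n hn le_rfl) (not_lt.2 hn')
      · exact (ae_eq_univ.1 h)
    have hlim := tendsto_measure_iInter_atTop (μ := μ) (fun M => (hDm M).nullMeasurableSet)
      hDanti ⟨0, measure_ne_top _ _⟩
    rw [hDnull] at hlim
    obtain ⟨M, hM⟩ := (hlim.eventually (gt_mem_nhds (ENNReal.ofReal_pos.2 hε0))).exists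
    have hM' : μ.real (D M) ≤ ε := ENNReal.toReal_le_of_le_ofReal hε0.le hM.le
    have hB0 : 0 ≤ μ.real B := measureReal_nonneg
    have ha0 : (0 : ℝ) ≤ a := by linarith
    have key : ∀ L : ℕ, (a : ℝ) * ((L : ℝ) - M) ≤ L * μ.real (B ∪ D M) := by
      intro L
      rw [← integral_visitSum hf.toMeasurePreserving (hB.union (hDm M))]
      calc (a : ℝ) * ((L : ℝ) - M) = ∫ _, (a : ℝ) * ((L : ℝ) - M) ∂μ := by simp
        _ ≤ _ := by
          refine integral_mono (integrable_const _) ?_ (mul_sub_le_visitSum ha0 (by linarith)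
            (fun x hx => ?_) L)
          · exact Integrable.of_bound
              (measurable_visitSum hfm (hB.union (hDm M)) L).aestronglyMeasurable L
              (Eventually.of_forall fun x => by
                rw [Real.norm_of_nonneg (visitSum_nonneg _ _)]; exact visitSum_le _ _)
          · simp only [hD, mem_ofPred_eq] at hx
            push Not at hx
            exact hx
    have hU : μ.real (B ∪ D M) ≤ μ.real B + ε := (measureReal_union_le _ _).trans (by linarith)
    obtain ⟨L, hL⟩ := exists_nat_gt ((a : ℝ) * M / ε)
    rw [div_lt_iff₀ hε0] at hL
    have h1 := key L
    have hL0 : (0 : ℝ) ≤ L := Nat.cast_nonneg L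
    nlinarith

lemma visitSum_compl (n : ℕ) (x : ℝ) : visitSum f Bᶜ n x = n - visitSum f B n x := by
  have : ∀ y, Bᶜ.indicator (1 : ℝ → ℝ) y = 1 - B.indicator 1 y := fun y => by
    by_cases hy : y ∈ B <;> simp [hy]
  simp [visitSum, this]

/-- The pointwise ergodic theorem for the indicator of a set. -/
lemma ae_tendsto_visitSum [IsProbabilityMeasure μ] (hf : Ergodic f μ) (hB : MeasurableSet B) :
    ∀ᵐ x ∂μ, Tendsto (fun n : ℕ => visitSum f B n x / n) atTop (𝓝 (μ.real B)) := by
  have h1 : ∀ᵐ x ∂μ, ∀ k : ℕ, ∀ᶠ n : ℕ in atTop,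
      visitSum f B n x < (μ.real B + 1 / ((k : ℝ) + 1)) * n :=
    ae_all_iff.2 fun k => ae_eventually_visitSum_lt hf hB
      (by have : 0 < 1 / ((k : ℝ) + 1) := by positivity
          linarith)
  have h2 : ∀ᵐ x ∂μ, ∀ k : ℕ, ∀ᶠ n : ℕ in atTop,
      visitSum f Bᶜ n x < (μ.real Bᶜ + 1 / ((k : ℝ) + 1)) * n :=
    ae_all_iff.2 fun k => ae_eventually_visitSum_lt hf hB.compl
      (by have : 0 < 1 / ((k : ℝ) + 1) := by positivity
          linarith)
  filter_upwards [h1, h2] with x hx1 hx2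
  rw [Metric.tendsto_atTop']
  intro ε hε
  obtain ⟨k, hk⟩ := exists_nat_one_div_lt hε
  have := (hx1 k).and ((hx2 k).and (eventually_gt_atTop 0))
  obtain ⟨M, hM⟩ := eventually_atTop.1 this
  refine ⟨M, fun n hn => ?_⟩
  obtain ⟨h3, h4, h5⟩ := hM n hn.le
  have h5' : (0 : ℝ) < n := by exact_mod_cast h5
  rw [visitSum_compl, probReal_compl_eq_one_sub hB] at h4
  rw [Real.dist_eq, abs_lt]
  constructor
  · rw [lt_sub_iff_add_lt, lt_div_iff₀ h5']; nlinarith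
  · rw [sub_lt_iff_lt_add, div_lt_iff₀ h5']; nlinarith

end birkhoff

/-! ### Excursions from the inducing set and time change. -/

section excursion

variable {f : ℝ → ℝ} {Y : Set ℝ} {μ : Measure ℝ}

/-- The number of visits to `Y` at times `1 ≤ j ≤ n`. -/
def visits (f : ℝ → ℝ) (Y : Set ℝ) (n : ℕ) (x : ℝ) : ℕ :=
  ∑ j ∈ Finset.range n, Y.indicator 1 (f^[j + 1] x)

lemma visits_zero (x : ℝ) : visits f Y 0 x = 0 := rfl

lemma visits_succ_of_mem {n : ℕ} {x : ℝ} (h : f^[n + 1] x ∈ Y) :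
    visits f Y (n + 1) x = visits f Y n x + 1 := by
  rw [visits, Finset.sum_range_succ, indicator_of_mem h]; rfl

lemma visits_succ_of_notMem {n : ℕ} {x : ℝ} (h : f^[n + 1] x ∉ Y) :
    visits f Y (n + 1) x = visits f Y n x := by
  rw [visits, Finset.sum_range_succ, indicator_of_notMem h]; rfl

lemma visits_le (n : ℕ) (x : ℝ) : visits f Y n x ≤ n := by
  induction n with
  | zero => simp [visits]
  | succ n ih =>
    by_cases h : f^[n + 1] x ∈ Y
    · rw [visits_succ_of_mem h]; omega
    · rw [visits_succ_of_notMem h]; omega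

lemma natCast_visits (n : ℕ) (x : ℝ) : (visits f Y n x : ℝ) = visitSum f Y n (f x) := by
  rw [visits, visitSum, Nat.cast_sum]
  refine Finset.sum_congr rfl fun j _ => ?_
  rw [Function.iterate_succ_apply]
  by_cases h : f^[j] (f x) ∈ Y <;> simp [h]

lemma measurable_visits (hf : Measurable f) (hY : MeasurableSet Y) (n : ℕ) :
    Measurable (visits f Y n) :=
  Finset.measurable_fun_sum _ fun j _ => (measurable_one.indicator hY).comp (hf.iterate (j + 1))

lemma ae_tendsto_visits [IsProbabilityMeasure μ] (hf : Ergodic f μ) (hY : MeasurableSet Y) :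
    ∀ᵐ x ∂μ, Tendsto (fun n : ℕ => (visits f Y n x : ℝ) / n) atTop (𝓝 (μ.real Y)) := by
  filter_upwards [hf.toMeasurePreserving.quasiMeasurePreserving.ae (ae_tendsto_visitSum hf hY)]
    with x hx
  simpa only [natCast_visits] using hx

lemma firstReturn_eq {y : ℝ} {i : ℕ} (h : f^[i + 1] y ∈ Y)
    (h' : ∀ j, 1 ≤ j → j ≤ i → f^[j] y ∉ Y) : firstReturn f Y y = i + 1 := by
  refine le_antisymm (Nat.sInf_le ⟨by omega, h⟩) ?_
  have hmem : firstReturn f Y y ∈ {n : ℕ | 1 ≤ n ∧ f^[n] y ∈ Y} :=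
    Nat.sInf_mem ⟨i + 1, by omega, h⟩
  by_contra! hlt
  exact h' _ hmem.1 (by omega) hmem.2

/-- Every orbit point of a point of `Y` lies on the excursion that starts at the last visit
to `Y`, and this visit is an iterate of the return map. -/
lemma exists_excursion {x : ℝ} (hx : x ∈ Y) (n : ℕ) :
    (returnMap f Y)^[visits f Y n x] x ∈ Y ∧
      ∃ i, f^[n] x = f^[i] ((returnMap f Y)^[visits f Y n x] x) ∧
        ∀ j, 1 ≤ j → j ≤ i → f^[j] ((returnMap f Y)^[visits f Y n x] x) ∉ Y := by
  induction n with
  | zero => exact ⟨hx, 0, rfl, fun j h1 h2 => by omega⟩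
  | succ n ih =>
    obtain ⟨hy, i, hi, hj⟩ := ih
    set y := (returnMap f Y)^[visits f Y n x] x with hydef
    have e : f^[n + 1] x = f^[i + 1] y := by
      rw [Function.iterate_succ_apply', hi, Function.iterate_succ_apply']
    by_cases h : f^[n + 1] x ∈ Y
    · have hret : (returnMap f Y)^[visits f Y (n + 1) x] x = f^[n + 1] x := by
        rw [visits_succ_of_mem h, Function.iterate_succ_apply', ← hydef, returnMap,
          firstReturn_eq (e ▸ h) hj, e]
      rw [hret]
      exact ⟨h, 0, rfl, fun j h1 h2 => by omega⟩
    · rw [visits_succ_of_notMem h, ← hydef]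
      refine ⟨hy, i + 1, e, fun j h1 h2 => ?_⟩
      rcases Nat.lt_or_ge j (i + 1) with h3 | h3
      · exact hj j h1 (by omega)
      · rw [show j = i + 1 by omega, ← e]; exact h

lemma iterate_eq_iterate_returnMap {x : ℝ} (hx : x ∈ Y) {n : ℕ} (h : f^[n] x ∈ Y) :
    f^[n] x = (returnMap f Y)^[visits f Y n x] x := by
  obtain ⟨_, i, hi, hj⟩ := exists_excursion hx n (f := f)
  rcases Nat.eq_zero_or_pos i with rfl | hi0
  · exact hi
  · exact absurd (hi ▸ h) (hj i hi0 le_rfl)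

lemma exists_iterate_eq_iterate_returnMap {x : ℝ} (hx : x ∈ Y) {n m : ℕ} (hm1 : 1 ≤ m)
    (hm : m ≤ visits f Y n x) : ∃ j ∈ Icc 1 n, f^[j] x = (returnMap f Y)^[m] x := by
  induction n with
  | zero => rw [visits_zero] at hm; omega
  | succ n ih =>
    rcases Nat.lt_or_ge (visits f Y n x) m with h | h
    · by_cases hY : f^[n + 1] x ∈ Y
      · have e := iterate_eq_iterate_returnMap hx hY
        have := visits_succ_of_mem hY
        rw [show visits f Y (n + 1) x = m by omega] at e
        exact ⟨n + 1, ⟨by omega, le_rfl⟩, e⟩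
      · rw [visits_succ_of_notMem hY] at hm; omega
    · obtain ⟨j, hj, e⟩ := ih h
      exact ⟨j, ⟨hj.1, hj.2.trans n.le_succ⟩, e⟩

lemma recCount_succ (f : ℝ → ℝ) (n : ℕ) (r x : ℝ) :
    recCount f (n + 1) r x = recCount f n r x + if dist (f^[n + 1] x) x ≤ r then 1 else 0 := by
  unfold recCount
  rw [← Finset.insert_Icc_right_eq_Icc_add_one (by omega), Finset.filter_insert]
  split_ifs with h
  · rw [Finset.card_insert_of_notMem (by simp)]
  · rfl

/-- If all close returns take place in Y, each is an iterate of the return map, and `visits` is the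
corresponding change of clock. -/
lemma recCount_eq_recCount_returnMap {x r : ℝ} (hx : x ∈ Y) {n : ℕ}
    (h : ∀ j, 1 ≤ j → j ≤ n → dist (f^[j] x) x ≤ r → f^[j] x ∈ Y) :
    recCount f n r x = recCount (returnMap f Y) (visits f Y n x) r x := by
  induction n with
  | zero => rw [visits_zero]; rfl
  | succ n ih =>
    rw [recCount_succ, ih fun j h1 h2 => h j h1 (by omega)]
    by_cases hY : f^[n + 1] x ∈ Y
    · have e := iterate_eq_iterate_returnMap hx hY
      rw [visits_succ_of_mem hY] at e ⊢
      rw [recCount_succ, e]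
    · rw [visits_succ_of_notMem hY, if_neg fun hd => hY (h (n + 1) (by omega) le_rfl hd), add_zero]

/-- The points of `Y` whose excursion meets `B`. -/
def hull (f : ℝ → ℝ) (Y B : Set ℝ) : Set ℝ :=
  {y ∈ Y | ∃ i, (∀ j, 1 ≤ j → j ≤ i → f^[j] y ∉ Y) ∧ f^[i] y ∈ B}

lemma hull_eq_iUnion (f : ℝ → ℝ) (Y B : Set ℝ) : hull f Y B =
    ⋃ i, (Y ∩ (⋂ j, ⋂ (_ : 1 ≤ j), ⋂ (_ : j ≤ i), f^[j] ⁻¹' Yᶜ)) ∩ f^[i] ⁻¹' B := by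
  ext y; simp [hull]; tauto

lemma measurableSet_hull_piece (hf : Measurable f) (hY : MeasurableSet Y) {B : Set ℝ}
    (hB : MeasurableSet B) (i : ℕ) : MeasurableSet
      ((Y ∩ (⋂ j, ⋂ (_ : 1 ≤ j), ⋂ (_ : j ≤ i), f^[j] ⁻¹' Yᶜ)) ∩ f^[i] ⁻¹' B) :=
  (hY.inter (MeasurableSet.iInter fun j => MeasurableSet.iInter fun _ =>
    MeasurableSet.iInter fun _ => hf.iterate j hY.compl)).inter (hf.iterate i hB)

lemma measurableSet_hull (hf : Measurable f) (hY : MeasurableSet Y) {B : Set ℝ}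
    (hB : MeasurableSet B) : MeasurableSet (hull f Y B) := by
  rw [hull_eq_iUnion]
  exact MeasurableSet.iUnion fun i => measurableSet_hull_piece hf hY hB i

/-- Pull the points whose excursion meets B at height i back by N-i steps. By invariance the measure
is unchanged; the pulled-back pieces all lie in the preimage of B under the N-th iterate, and they
are disjoint because N-i is the time of the last visit to Y up to N. -/
lemma measure_hull_le (hf : MeasurePreserving f μ μ) (hY : MeasurableSet Y) {B : Set ℝ}
    (hB : MeasurableSet B) : μ (hull f Y B) ≤ μ B := by
  rw [hull_eq_iUnion]
  set P : ℕ → Set ℝ := fun i =>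
    (Y ∩ (⋂ j, ⋂ (_ : 1 ≤ j), ⋂ (_ : j ≤ i), f^[j] ⁻¹' Yᶜ)) ∩ f^[i] ⁻¹' B with hP
  have hPm : ∀ i, MeasurableSet (P i) := measurableSet_hull_piece hf.measurable hY hB
  refine (measure_iUnion_le P).trans (ENNReal.tsum_le_of_sum_range_le fun N => ?_)
  have e : ∀ i, μ (P i) = μ (f^[N - i] ⁻¹' P i) := fun i =>
    ((hf.iterate (N - i)).measure_preimage (hPm i).nullMeasurableSet).symm
  simp_rw [fun i => e i]
  rw [← measure_biUnion_finset]
  · rw [← (hf.iterate N).measure_preimage hB.nullMeasurableSet]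
    refine measure_mono (iUnion₂_subset fun i hi x hx => ?_)
    have : f^[i] (f^[N - i] x) ∈ B := hx.2
    rw [← Function.iterate_add_apply] at this
    rwa [Nat.add_sub_cancel' (Finset.mem_range.1 hi).le] at this
  · have key : ∀ i k, i < k → k < N → Disjoint (f^[N - i] ⁻¹' P i) (f^[N - k] ⁻¹' P k) := by
      intro i k hik hk
      rw [Set.disjoint_left]
      intro x h1 h2
      have h3 : f^[N - i] x ∈ Y := h1.1.1
      have h4 := h2.1.2
      simp only [mem_iInter] at h4
      have h5 := h4 (k - i) (by omega) (by omega)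
      simp only [mem_preimage, ← Function.iterate_add_apply] at h5
      rw [show k - i + (N - k) = N - i by omega] at h5
      exact h5 h3
    intro i hi k hk hik
    rcases lt_or_gt_of_ne hik with h | h
    · exact key i k h (Finset.mem_range.1 hk)
    · exact (key k i h (Finset.mem_range.1 hi)).symm
  · exact fun i _ => hf.measurable.iterate (N - i) (hPm i)

lemma mem_hull_of_mem {x : ℝ} (hx : x ∈ Y) {n : ℕ} {B : Set ℝ} (h : f^[n] x ∈ B) :
    (returnMap f Y)^[visits f Y n x] x ∈ hull f Y B := by
  obtain ⟨hy, i, hi, hj⟩ := exists_excursion hx n (f := f)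
  exact ⟨hy, i, hj, hi ▸ h⟩

lemma cond_real_le_div (hY : MeasurableSet Y) [IsFiniteMeasure μ] (E : Set ℝ) :
    (ProbabilityTheory.cond μ Y).real E ≤ μ.real E / μ.real Y := by
  rw [measureReal_def, ProbabilityTheory.cond_apply hY, ENNReal.toReal_mul, ENNReal.toReal_inv,
    inv_mul_eq_div]
  exact div_le_div_of_nonneg_right (measureReal_mono inter_subset_right) measureReal_nonneg

/-- The error in the decay of correlations is proportional to the L¹ norm of the second function.
The excursion set therefore multiplies the exponential error too, and the bound stays summable over
infinitely many cells. -/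
lemma cond_real_hull_inter_le {C κ : ℝ} (hf : MeasurePreserving f μ μ) [IsFiniteMeasure μ]
    [IsFiniteMeasure (ProbabilityTheory.cond μ Y)]
    (hY : MeasurableSet Y) (hF : Measurable (returnMap f Y)) (hC : 0 < C)
    (hdec : CellDecay (returnMap f Y) (ProbabilityTheory.cond μ Y) C κ)
    {B : Set ℝ} (hB : MeasurableSet B) (ℓ : ℝ) (i : ℤ) (m : ℕ) :
    (ProbabilityTheory.cond μ Y).real
        (cell ℓ 0 i ∩ (returnMap f Y)^[m] ⁻¹' hull f Y B) ≤
      ((ProbabilityTheory.cond μ Y).real (cell ℓ 0 i) + C * Real.exp (-κ * m)) *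
        (μ.real B / μ.real Y) := by
  set ν := ProbabilityTheory.cond μ Y with hν
  have hH := measurableSet_hull hf.measurable hY hB
  have hHle : ν.real (hull f Y B) ≤ μ.real B / μ.real Y := by
    refine (cond_real_le_div hY _).trans (div_le_div_of_nonneg_right ?_ measureReal_nonneg)
    exact ENNReal.toReal_mono (measure_ne_top _ _) (measure_hull_le hf hY hB)
  have h := hdec ℓ 0 i ((hull f Y B).indicator 1) (integrable_indicator_one_comp measurable_id hH) m
  have e1 : ∫ x, (cell ℓ 0 i).indicator 1 x *
      (hull f Y B).indicator 1 ((returnMap f Y)^[m] x) ∂ν =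
        ν.real (cell ℓ 0 i ∩ (returnMap f Y)^[m] ⁻¹' hull f Y B) := by
    rw [← integral_indicator_one ((measurableSet_cell ℓ 0 i).inter (hF.iterate m hH))]
    congr 1; ext x
    by_cases h1 : x ∈ cell ℓ 0 i <;> by_cases h2 : (returnMap f Y)^[m] x ∈ hull f Y B <;>
      simp [h1, h2]
  have e2 : ∫ x, |(hull f Y B).indicator (1 : ℝ → ℝ) x| ∂ν = ν.real (hull f Y B) := by
    simp_rw [abs_of_nonneg (indicator_one_nonneg _ _)]
    exact integral_indicator_one hH
  rw [e1, e2, integral_indicator_one hH] at h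
  have h' := (abs_le.1 h).2
  have h0 : 0 ≤ ν.real (cell ℓ 0 i) + C * Real.exp (-κ * m) :=
    add_nonneg measureReal_nonneg (by positivity)
  calc _ ≤ (ν.real (cell ℓ 0 i) + C * Real.exp (-κ * m)) * ν.real (hull f Y B) := by linarith
    _ ≤ _ := mul_le_mul_of_nonneg_left hHle h0

end excursion

/-! ### Passing between μ and its restriction to an inducing set. -/

section induced

variable {X : Set ℝ} {f : ℝ → ℝ} {μ : Measure ℝ} {Y : Set ℝ}

lemma ae_mem_imp_of_ae_cond [IsFiniteMeasure μ] (hY : MeasurableSet Y) {P : ℝ → Prop}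
    (h : ∀ᵐ x ∂(ProbabilityTheory.cond μ Y), P x) : ∀ᵐ x ∂μ, x ∈ Y → P x := by
  rw [ProbabilityTheory.cond,
    Measure.ae_ennreal_smul_measure_iff (ENNReal.inv_ne_zero.2 (measure_ne_top μ Y))] at h
  exact (ae_restrict_iff' hY).1 h

lemma measureReal_pos_of_cond [h : IsProbabilityMeasure (ProbabilityTheory.cond μ Y)]
    [IsFiniteMeasure μ] : 0 < μ.real Y := by
  refine lt_of_le_of_ne measureReal_nonneg fun h0 => ?_
  have h1 : μ Y = 0 := (measureReal_eq_zero_iff (measure_ne_top _ _)).1 h0.symm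
  have h2 := h.measure_univ
  rw [ProbabilityTheory.cond_eq_zero_of_meas_eq_zero h1] at h2
  simp at h2

/-- This reduces the almost sure statements to one inducing set at a time, with no uniformity in ε.
-/
lemma ae_of_forall_exists_measure_compl_le {P : ℝ → Prop}
    (h : ∀ ε : ℝ, 0 < ε → ∃ Y : Set ℝ, μ Yᶜ ≤ ENNReal.ofReal ε ∧ ∀ᵐ x ∂μ, x ∈ Y → P x) :
    ∀ᵐ x ∂μ, P x := by
  rw [ae_iff]
  refine le_antisymm (ENNReal.le_of_forall_pos_le_add fun ε hε _ => ?_) zero_le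
  obtain ⟨Y, hY, hP⟩ := h ε (by exact_mod_cast hε)
  rw [zero_add]
  calc μ {x | ¬P x} ≤ μ (Yᶜ ∪ {x | ¬(x ∈ Y → P x)}) :=
        measure_mono fun x hx => by
          by_cases hxY : x ∈ Y
          · exact Or.inr fun h => hx (h hxY)
          · exact Or.inl hxY
    _ ≤ μ Yᶜ + μ {x | ¬(x ∈ Y → P x)} := measure_union_le _ _
    _ ≤ ε := by
        rw [ae_iff.1 hP, add_zero]
        simpa using hY

lemma AsymptoticallyHyperbolic.exists_goodSystem (hsys : IsErgodicAcip X f μ)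
    (hasym : AsymptoticallyHyperbolic X f μ) {ε : ℝ} (hε : 0 < ε) :
    ∃ (Y : Set ℝ) (C κ S β : ℝ), MeasurableSet Y ∧ Y ⊆ X ∧ μ Yᶜ ≤ ENNReal.ofReal ε ∧
      IsProbabilityMeasure (ProbabilityTheory.cond μ Y) ∧
      GoodSystem (returnMap f Y) (ProbabilityTheory.cond μ Y) C κ S β := by
  obtain ⟨ι, _, U, _, hU, hH⟩ := hasym ε hε
  obtain ⟨C, κ, S, β, hgood⟩ := hH.exists_goodSystem
  refine ⟨_, C, κ, S, β, hH.isErgodicAcip.measurableSet, sdiff_subset, ?_,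
    hH.isErgodicAcip.isProbabilityMeasure, hgood⟩
  calc μ (X \ ⋃ i, U i)ᶜ ≤ μ (Xᶜ ∪ ⋃ i, U i) := measure_mono fun x hx => by
        by_cases hxX : x ∈ X
        · exact Or.inr (by_contra fun h => hx ⟨hxX, h⟩)
        · exact Or.inl hxX
    _ ≤ μ Xᶜ + μ (⋃ i, U i) := measure_union_le _ _
    _ ≤ _ := by rw [hsys.measure_compl, zero_add]; exact hU

end induced

/-! ### The minimum of the return distances. -/

section recMin

variable {f : ℝ → ℝ}

lemma recMin_le {n k : ℕ} (hk : k ∈ Icc 1 n) (x : ℝ) : recMin f n x ≤ dist (f^[k] x) x :=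
  csInf_le ⟨0, by rintro _ ⟨j, _, rfl⟩; exact dist_nonneg⟩ (mem_image_of_mem _ hk)

lemma exists_recMin_eq {n : ℕ} (hn : 1 ≤ n) (x : ℝ) :
    ∃ k ∈ Icc 1 n, recMin f n x = dist (f^[k] x) x := by
  obtain ⟨k, hk, h⟩ := Set.Nonempty.csInf_mem (s := (fun k : ℕ => dist (f^[k] x) x) '' Icc 1 n)
    ((nonempty_Icc.2 hn).image _) ((finite_Icc 1 n).image _)
  exact ⟨k, hk, h.symm⟩

end recMin

/-! ### The almost sure lower bound. -/

section lowerBound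

variable {X : Set ℝ} {f : ℝ → ℝ} {μ : Measure ℝ} {Y : Set ℝ} {C κ S β : ℝ}

lemma tsum_measure_cell_zero {μ : Measure ℝ} {ℓ : ℝ} (hℓ : 0 < ℓ) (g : ℝ → ENNReal) :
    ∑' i : ℤ, ∫⁻ x in cell ℓ 0 i, g x ∂μ = ∫⁻ x, g x ∂μ := by
  rw [← lintegral_iUnion (measurableSet_cell ℓ 0)]
  · rw [show (⋃ i, cell ℓ 0 i) = univ from
      eq_univ_of_forall fun x => mem_iUnion.2 ⟨_, mem_cell_floor hℓ 0 x⟩, Measure.restrict_univ]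
  · intro i j hij
    rw [Function.onFun, Set.disjoint_left]
    intro x hi hj
    rw [mem_cell_zero_iff hℓ] at hi hj
    exact hij (hi.symm.trans hj)

lemma tsum_measure_cell_zero_one {μ : Measure ℝ} {ℓ : ℝ} (hℓ : 0 < ℓ) :
    ∑' i : ℤ, μ (cell ℓ 0 i) = μ univ := by
  simpa using tsum_measure_cell_zero (μ := μ) hℓ 1

lemma measure_cell_one_le {μ : Measure ℝ} {ℓ : ℝ} (hℓ : 0 < ℓ) (i : ℤ) :
    μ (cell ℓ 1 i) ≤ μ (cell ℓ 0 (i - 1)) + μ (cell ℓ 0 i) + μ (cell ℓ 0 (i + 1)) := by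
  refine (measure_mono fun x hx => ?_).trans ((measure_union_le _ _).trans
    (add_le_add_left (measure_union_le _ _) _))
  simp only [mem_union, mem_cell_zero_iff hℓ]
  rw [mem_cell_iff hℓ] at hx
  push_cast at hx
  omega

lemma tsum_comp_sub_one (g : ℤ → ENNReal) : ∑' i, g (i - 1) = ∑' i, g i :=
  (Equiv.subRight (1 : ℤ)).tsum_eq g

lemma tsum_comp_add_one (g : ℤ → ENNReal) : ∑' i, g (i + 1) = ∑' i, g i :=
  (Equiv.addRight (1 : ℤ)).tsum_eq g

lemma tsum_measure_cell_one_le {μ : Measure ℝ} {ℓ : ℝ} (hℓ : 0 < ℓ) :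
    ∑' i : ℤ, μ (cell ℓ 1 i) ≤ 3 * μ univ := by
  refine (ENNReal.tsum_le_tsum fun i => measure_cell_one_le hℓ i).trans (le_of_eq ?_)
  rw [ENNReal.tsum_add, ENNReal.tsum_add, tsum_comp_sub_one fun i => μ (cell ℓ 0 i),
    tsum_comp_add_one fun i => μ (cell ℓ 0 i), tsum_measure_cell_zero_one hℓ]
  ring

/-- Products of masses of neighbouring cells are dominated by squares via xy ≤ x² + y², giving 3 + 1
+ 1 = 5 sums of squares. Each square is an integral of ball measures, since a small cell lies in the
ball of radius ℓ about any of its points. -/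
lemma tsum_measure_cell_mul_le {μ : Measure ℝ} {ℓ : ℝ} (hℓ : 0 < ℓ) :
    ∑' i : ℤ, μ (cell ℓ 0 i) * μ (cell ℓ 1 i) ≤ 5 * ∫⁻ x, μ (Metric.ball x ℓ) ∂μ := by
  set a : ℤ → ENNReal := fun i => μ (cell ℓ 0 i) with ha
  have hmul : ∀ x y : ENNReal, x * y ≤ x * x + y * y := by
    intro x y
    rcases le_total x y with h | h
    · exact (mul_le_mul_left h y).trans le_add_self
    · exact (mul_le_mul_right h x).trans le_self_add
  have h1 : ∀ i, a i * μ (cell ℓ 1 i) ≤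
      3 * (a i * a i) + a (i - 1) * a (i - 1) + a (i + 1) * a (i + 1) := by
    intro i
    calc a i * μ (cell ℓ 1 i) ≤ a i * (a (i - 1) + a i + a (i + 1)) :=
          mul_le_mul_right (measure_cell_one_le hℓ i) _
      _ = a i * a (i - 1) + a i * a i + a i * a (i + 1) := by ring
      _ ≤ (a i * a i + a (i - 1) * a (i - 1)) + a i * a i +
          (a i * a i + a (i + 1) * a (i + 1)) := by
            gcongr <;> exact hmul _ _
      _ = _ := by ring
  have h2 : ∑' i, a i * a i ≤ ∫⁻ x, μ (Metric.ball x ℓ) ∂μ := by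
    rw [← tsum_measure_cell_zero hℓ]
    refine ENNReal.tsum_le_tsum fun i => ?_
    calc a i * a i = ∫⁻ _ in cell ℓ 0 i, a i ∂μ := by rw [setLIntegral_const]
      _ ≤ _ := setLIntegral_mono' (measurableSet_cell ℓ 0 i) fun x hx => measure_mono fun y hy => by
          rw [mem_cell_zero_iff hℓ] at hx
          subst hx
          simpa using dist_lt_of_mem_cell hℓ hy
  calc ∑' i : ℤ, μ (cell ℓ 0 i) * μ (cell ℓ 1 i)
      ≤ ∑' i, (3 * (a i * a i) + a (i - 1) * a (i - 1) + a (i + 1) * a (i + 1)) :=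
        ENNReal.tsum_le_tsum h1
    _ = 5 * ∑' i, a i * a i := by
        rw [ENNReal.tsum_add, ENNReal.tsum_add, ENNReal.tsum_mul_left,
          tsum_comp_sub_one fun i => a i * a i,
          tsum_comp_add_one fun i => a i * a i]
        ring
    _ ≤ _ := by gcongr

lemma cond_le_mul (hY : MeasurableSet Y) (E : Set ℝ) :
    ProbabilityTheory.cond μ Y E ≤ (μ Y)⁻¹ * μ E := by
  rw [ProbabilityTheory.cond_apply hY]
  gcongr
  exact inter_subset_right

/-- The points `x` for which the excursion of the `m`-th return comes `ℓ`-close to `x` form a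
small set. -/
lemma cond_excursion_le [IsProbabilityMeasure μ] (hf : MeasurePreserving f μ μ)
    [IsProbabilityMeasure (ProbabilityTheory.cond μ Y)] (hY : MeasurableSet Y)
    (hgood : GoodSystem (returnMap f Y) (ProbabilityTheory.cond μ Y) C κ S β) {ℓ : ℝ}
    (hℓ : 0 < ℓ) (m : ℕ) :
    ProbabilityTheory.cond μ Y
        {x | (returnMap f Y)^[m] x ∈ hull f Y (cell ℓ 1 ⌊x / ℓ⌋)} ≤
      5 * ((μ Y)⁻¹ * (μ Y)⁻¹) * ∫⁻ x, μ (Metric.ball x ℓ) ∂μ +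
        ENNReal.ofReal (C * Real.exp (-κ * m)) * (3 * (μ Y)⁻¹) := by
  have hYpos := measureReal_pos_of_cond (μ := μ) (Y := Y)
  have hY0 : μ Y ≠ 0 := fun h => by simp [measureReal_def, h] at hYpos
  set ν := ProbabilityTheory.cond μ Y with hν
  set a : ENNReal := ENNReal.ofReal (C * Real.exp (-κ * m)) with ha
  set E : ℤ → Set ℝ := fun i => cell ℓ 0 i ∩ (returnMap f Y)^[m] ⁻¹' hull f Y (cell ℓ 1 i)
  have hEle : ∀ i, ν (E i) ≤ ((μ Y)⁻¹ * μ (cell ℓ 0 i) + a) * (μ (cell ℓ 1 i) * (μ Y)⁻¹) := by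
    intro i
    have h := cond_real_hull_inter_le hf hY hgood.measurePreserving.measurable hgood.pos.1
      hgood.decay (measurableSet_cell ℓ 1 i) ℓ i m
    have hC := hgood.pos.1
    have h0 : 0 ≤ ν.real (cell ℓ 0 i) := measureReal_nonneg
    rw [measureReal_def, ← ENNReal.le_ofReal_iff_toReal_le (measure_ne_top _ _) (by positivity)] at h
    refine h.trans ?_
    rw [ENNReal.ofReal_mul (by positivity), ENNReal.ofReal_add h0 (by positivity),
      ENNReal.ofReal_div_of_pos hYpos, ofReal_measureReal, ofReal_measureReal, ofReal_measureReal,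
      div_eq_mul_inv]
    gcongr
    exact cond_le_mul hY _
  calc ν {x | (returnMap f Y)^[m] x ∈ hull f Y (cell ℓ 1 ⌊x / ℓ⌋)} ≤ ν (⋃ i, E i) :=
        measure_mono fun x hx => mem_iUnion.2 ⟨⌊x / ℓ⌋, mem_cell_floor hℓ 0 x, hx⟩
    _ ≤ ∑' i, ν (E i) := measure_iUnion_le _
    _ ≤ ∑' i, ((μ Y)⁻¹ * μ (cell ℓ 0 i) + a) * (μ (cell ℓ 1 i) * (μ Y)⁻¹) :=
        ENNReal.tsum_le_tsum hEle
    _ = ∑' i, (((μ Y)⁻¹ * (μ Y)⁻¹) * (μ (cell ℓ 0 i) * μ (cell ℓ 1 i)) +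
          (a * (μ Y)⁻¹) * μ (cell ℓ 1 i)) := by
        congr 1; ext i; ring
    _ = ((μ Y)⁻¹ * (μ Y)⁻¹) * ∑' i, μ (cell ℓ 0 i) * μ (cell ℓ 1 i) +
          (a * (μ Y)⁻¹) * ∑' i, μ (cell ℓ 1 i) := by
        rw [ENNReal.tsum_add, ENNReal.tsum_mul_left, ENNReal.tsum_mul_left]
    _ ≤ ((μ Y)⁻¹ * (μ Y)⁻¹) * (5 * ∫⁻ x, μ (Metric.ball x ℓ) ∂μ) +
          (a * (μ Y)⁻¹) * (3 * μ univ) := by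
        gcongr
        · exact tsum_measure_cell_mul_le hℓ
        · exact tsum_measure_cell_one_le hℓ
    _ = _ := by rw [measure_univ]; ring

/-- Absolute continuity rules out atoms, so the ball measures tend to 0 pointwise and the integral
follows by dominated convergence. -/
lemma exists_pos_lintegral_ball_le [IsFiniteMeasure μ] (hμ : μ ≪ volume) {ε : ENNReal}
    (hε : 0 < ε) : ∃ s : ℝ, 0 < s ∧ ∫⁻ x, μ (Metric.ball x s) ∂μ ≤ ε := by
  have hlim : Tendsto (fun k : ℕ => ∫⁻ x, μ (Metric.ball x (1 / ((k : ℝ) + 1))) ∂μ) atTop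
      (𝓝 (∫⁻ _, 0 ∂μ)) := by
    refine tendsto_lintegral_of_dominated_convergence (fun _ => μ univ) (fun k => ?_) (fun k => ?_)
      ?_ ?_
    · have hm : MeasurableSet {p : ℝ × ℝ | dist p.2 p.1 < 1 / ((k : ℝ) + 1)} :=
        measurableSet_lt (measurable_snd.dist measurable_fst) measurable_const
      exact measurable_measure_prodMk_left hm
    · exact Eventually.of_forall fun x => measure_mono (subset_univ _)
    · rw [lintegral_const]
      exact ENNReal.mul_ne_top (measure_ne_top _ _) (measure_ne_top _ _)
    · refine Eventually.of_forall fun x => ?_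
      have h := tendsto_measure_iInter_atTop (μ := μ)
        (s := fun k : ℕ => Metric.ball x (1 / ((k : ℝ) + 1)))
        (fun k => measurableSet_ball.nullMeasurableSet)
        (fun i j hij => Metric.ball_subset_ball (by gcongr)) ⟨0, measure_ne_top _ _⟩
      have e : μ (⋂ k : ℕ, Metric.ball x (1 / ((k : ℝ) + 1))) = 0 := by
        refine measure_mono_null (t := {x}) (fun y hy => ?_) (hμ (measure_singleton x))
        by_contra hne
        obtain ⟨k, hk⟩ := exists_nat_one_div_lt (dist_pos.2 hne)
        exact absurd (Metric.mem_ball.1 (mem_iInter.1 hy k)) (not_lt.2 hk.le)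
      rwa [e] at h
  rw [lintegral_zero] at hlim
  obtain ⟨k, hk⟩ := (hlim.eventually (gt_mem_nhds hε)).exists
  exact ⟨_, by positivity, hk.le⟩

/-- The almost sure lower bound, at a point of the inducing domain whose excursions come close
only finitely often. -/
lemma eventually_lt_recMin {r ρ : ℕ → ℝ} (hr : AntitoneOn r (Ici 1))
    (hr0 : ∀ δ : ℝ, 0 < δ → ∀ᶠ n in atTop, r n < δ) (hρ : ∀ m, 0 < ρ m)
    (hrρ : ∀ m, r (m + 1) ≤ ρ m) {x : ℝ} (hx : x ∈ Y)
    (hv : Tendsto (fun n => visits f Y n x) atTop atTop)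
    (hE : ∀ᶠ m : ℕ in atTop,
      (returnMap f Y)^[m + 1] x ∉ hull f Y (cell (ρ m) 1 ⌊x / ρ m⌋)) :
    ∀ᶠ n : ℕ in atTop, r n < recMin f n x := by
  obtain ⟨m₀, hm₀⟩ := eventually_atTop.1 hE
  obtain ⟨n₀, hn₀⟩ := eventually_atTop.1 (hv.eventually_ge_atTop (m₀ + 1))
  -- There cannot be more than k visits by time k. As the radii decrease, r k ≤ r (m+1), so counting
  -- returns instead of iterates loses nothing in this direction.
  have far : ∀ k, n₀ ≤ k → ∃ m, m + 1 ≤ k ∧ ρ m < dist (f^[k] x) x := by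
    intro k hk
    obtain ⟨m, hm⟩ : ∃ m, visits f Y k x = m + 1 := ⟨visits f Y k x - 1, by have := hn₀ k hk; omega⟩
    refine ⟨m, hm ▸ visits_le k x, ?_⟩
    by_contra! hle
    refine hm₀ m (by have := hn₀ k hk; omega) ?_
    rw [← hm]
    exact mem_hull_of_mem hx (mem_cell_of_dist_le (hρ m) (by simpa using hle))
  -- A periodic point would come back at distance 0 at arbitrarily late times, against `far`.
  have pos : ∀ k, 1 ≤ k → 0 < dist (f^[k] x) x := by
    intro k hk
    refine dist_pos.2 fun h => ?_
    have hper : f^[k * (n₀ + 1)] x = x := by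
      rw [Function.iterate_mul]
      exact Function.iterate_fixed h _
    obtain ⟨m, _, hm⟩ := far (k * (n₀ + 1)) (by nlinarith)
    rw [hper, dist_self] at hm
    exact absurd (hρ m) (not_lt.2 hm.le)
  have small : ∀ᶠ n in atTop, ∀ k ∈ Finset.Icc 1 n₀, r n < dist (f^[k] x) x :=
    (eventually_all_finset _).2 fun k hk => hr0 _ (pos k (Finset.mem_Icc.1 hk).1)
  filter_upwards [small, eventually_ge_atTop 1] with n hn hn1
  obtain ⟨k, hk, e⟩ := exists_recMin_eq (f := f) hn1 x
  rw [e]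
  rcases le_total k n₀ with h | h
  · exact hn k (Finset.mem_Icc.2 ⟨hk.1, h⟩)
  · obtain ⟨m, hmk, hm⟩ := far k h
    have : r n ≤ r (m + 1) := hr (by simp) (by simpa using hn1) (hmk.trans hk.2)
    exact (this.trans (hrρ m)).trans_lt hm

lemma tsum_ofReal_exp_lt_top (hC : 0 < C) (hκ : 0 < κ) :
    ∑' m : ℕ, ENNReal.ofReal (C * Real.exp (-κ * (m + 1 : ℕ))) < ⊤ := by
  have hs : Summable fun m : ℕ => C * Real.exp (-κ * (m + 1 : ℕ)) := by
    refine Summable.mul_left _ ?_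
    refine (summable_nat_add_iff 1 (f := fun m : ℕ => Real.exp (-κ * m))).2 ?_
    have := Real.summable_exp_nat_mul_iff.2 (neg_lt_zero.2 hκ)
    simpa only [mul_comm] using this
  rw [← ENNReal.ofReal_tsum_of_nonneg (fun m => by positivity) hs]
  exact ENNReal.ofReal_lt_top

/-- Balls of a fixed radius δ have positive mean measure, since otherwise every cell would be null;
so the terms of a convergent series cannot all come from radii at least δ. -/
lemma eventually_lt_of_tsum_lintegral_ball_lt_top [IsProbabilityMeasure μ]
    {r : ℕ → ℝ} (hr : AntitoneOn r (Ici 1))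
    (hsum : ∑' n : ℕ, ∫⁻ x, μ (Metric.ball x (r (n + 1))) ∂μ < ⊤) (δ : ℝ) (hδ : 0 < δ) :
    ∀ᶠ n in atTop, r n < δ := by
  have hpos : 0 < ∫⁻ x, μ (Metric.ball x δ) ∂μ := by
    have h2 : ∑' i : ℤ, μ (cell δ 0 i) * μ (cell δ 1 i) ≠ 0 := by
      intro h
      rw [ENNReal.tsum_eq_zero] at h
      have : ∀ i, μ (cell δ 0 i) = 0 := fun i => by
        rcases mul_eq_zero.1 (h i) with h | h
        · exact h
        · exact measure_mono_null (cell_zero_subset hδ 1 i) h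
      have h3 := tsum_measure_cell_zero_one (μ := μ) hδ
      simp [this] at h3
    refine pos_iff_ne_zero.2 fun h => h2 ?_
    have := tsum_measure_cell_mul_le (μ := μ) hδ
    rw [h, mul_zero] at this
    exact le_antisymm this zero_le
  have htend := ENNReal.tendsto_atTop_zero_of_tsum_ne_top hsum.ne
  obtain ⟨k, hk⟩ := (htend.eventually (gt_mem_nhds hpos)).exists
  have hlt : r (k + 1) < δ := by
    by_contra! h
    exact absurd hk (not_lt.2 (lintegral_mono fun x => measure_mono (Metric.ball_subset_ball h)))
  filter_upwards [eventually_ge_atTop (k + 1)] with n hn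
  exact (hr (by simp) (by simp only [mem_Ici]; omega) hn).trans_lt hlt

/-- By `cond_excursion_le` the m-th event has measure at most a multiple of the mean ball measure
plus one of exp(-κm). Both are summable, so Borel–Cantelli leaves only finitely many bad returns. -/
theorem ae_eventually_lt_recMin (hsys : IsErgodicAcip X f μ)
    (hasym : AsymptoticallyHyperbolic X f μ) {r : ℕ → ℝ} (hr : AntitoneOn r (Ici 1))
    (hsum : ∑' n : ℕ, ∫⁻ x, μ (Metric.ball x (r (n + 1))) ∂μ < ⊤) :
    ∀ᵐ x ∂μ, ∀ᶠ n : ℕ in atTop, r n < recMin f n x := by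
  have := hsys.isProbabilityMeasure
  refine ae_of_forall_exists_measure_compl_le fun ε hε => ?_
  obtain ⟨Y, C, κ, S, β, hYm, -, hYε, hprob, hgood⟩ := hasym.exists_goodSystem hsys hε
  refine ⟨Y, hYε, ?_⟩
  have hYpos := measureReal_pos_of_cond (μ := μ) (Y := Y)
  have hYinv : (μ Y)⁻¹ ≠ ⊤ := ENNReal.inv_ne_top.2 fun h => by simp [measureReal_def, h] at hYpos
  have hs : ∀ m : ℕ, ∃ s : ℝ, 0 < s ∧ ∫⁻ x, μ (Metric.ball x s) ∂μ ≤ 2⁻¹ ^ (m + 1) := fun m =>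
    exists_pos_lintegral_ball_le hsys.absolutelyContinuous
      (ENNReal.pow_pos (ENNReal.inv_pos.2 (by norm_num)) _)
  choose s hs0 hs using hs
  -- The given radii may be nonpositive or extremely small. Enlarging them to positive values adds
  -- only a geometric series to the hypothesis.
  set ρ : ℕ → ℝ := fun m => max (r (m + 1)) (s m) with hρ
  have hρ0 : ∀ m, 0 < ρ m := fun m => lt_max_of_lt_right (hs0 m)
  have hball : ∀ m, ∫⁻ x, μ (Metric.ball x (ρ m)) ∂μ ≤
      ∫⁻ x, μ (Metric.ball x (r (m + 1))) ∂μ + 2⁻¹ ^ (m + 1) := by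
    intro m
    rcases max_cases (r (m + 1)) (s m) with h | h
    · simp only [hρ, h.1]; exact le_self_add
    · simp only [hρ, h.1]; exact (hs m).trans le_add_self
  have hBC : ∀ᵐ x ∂(ProbabilityTheory.cond μ Y), ∀ᶠ m : ℕ in atTop,
      x ∉ {x | (returnMap f Y)^[m + 1] x ∈ hull f Y (cell (ρ m) 1 ⌊x / ρ m⌋)} := by
    refine ae_eventually_notMem (ne_top_of_le_ne_top ?_ (ENNReal.tsum_le_tsum fun m =>
      (cond_excursion_le hsys.ergodic.toMeasurePreserving hYm hgood (hρ0 m) (m + 1)).trans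
        (add_le_add_left (mul_le_mul_right (hball m) _) _)))
    rw [ENNReal.tsum_add, ENNReal.tsum_mul_left, ENNReal.tsum_add, ENNReal.tsum_mul_right]
    refine ENNReal.add_ne_top.2 ⟨ENNReal.mul_ne_top (ENNReal.mul_ne_top (by norm_num)
      (ENNReal.mul_ne_top hYinv hYinv)) (ENNReal.add_ne_top.2 ⟨hsum.ne, ?_⟩),
      ENNReal.mul_ne_top (tsum_ofReal_exp_lt_top hgood.pos.1 hgood.pos.2.1).ne
        (ENNReal.mul_ne_top (by norm_num) hYinv)⟩
    rw [ENNReal.tsum_geometric_add_one]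
    simp
  filter_upwards [ae_mem_imp_of_ae_cond hYm hBC, ae_tendsto_visits hsys.ergodic hYm] with x h1 h2 hx
  refine eventually_lt_recMin hr (eventually_lt_of_tsum_lintegral_ball_lt_top hr hsum) hρ0
    (fun m => le_max_left _ _) hx ?_ (h1 hx)
  have h3 : Tendsto (fun n : ℕ => (visits f Y n x : ℝ) / n * n) atTop atTop :=
    h2.pos_mul_atTop hYpos tendsto_natCast_atTop_atTop
  refine tendsto_natCast_atTop_iff.1 (h3.congr' ?_)
  filter_upwards [eventually_gt_atTop 0] with n hn
  rw [div_mul_cancel₀]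
  exact_mod_cast hn.ne'

end lowerBound

/-! ### Geometric sequences of times. -/

section geometric

variable {a : ℝ}

lemma half_pow_le_floor (ha : 1 < a) (k : ℕ) : a ^ k / 2 ≤ (⌊a ^ k⌋₊ : ℝ) := by
  have h1 : 1 ≤ a ^ k := one_le_pow₀ ha.le
  have h2 := Nat.lt_floor_add_one (a ^ k)
  have h3 : (1 : ℝ) ≤ ⌊a ^ k⌋₊ := by exact_mod_cast Nat.one_le_floor_iff _ |>.2 h1
  linarith

lemma tendsto_floor_pow (ha : 1 < a) : Tendsto (fun k : ℕ => ⌊a ^ k⌋₊) atTop atTop :=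
  tendsto_nat_floor_atTop.comp (tendsto_pow_atTop_atTop_of_one_lt ha)

lemma summable_floor_pow_rpow_neg (ha : 1 < a) {b : ℝ} (hb : 0 < b) :
    Summable fun k : ℕ => (⌊a ^ k⌋₊ : ℝ) ^ (-b) := by
  have ha0 : 0 < a := by linarith
  have hs : Summable fun k : ℕ => (2 : ℝ) ^ b * (a ^ (-b)) ^ k :=
    (summable_geometric_of_lt_one (by positivity)
      (Real.rpow_lt_one_of_one_lt_of_neg ha (by linarith))).mul_left _
  refine Summable.of_nonneg_of_le (fun k => by positivity) (fun k => ?_) hs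
  calc (⌊a ^ k⌋₊ : ℝ) ^ (-b) ≤ (a ^ k / 2) ^ (-b) :=
        Real.rpow_le_rpow_of_nonpos (by positivity) (half_pow_le_floor ha k) (by linarith)
    _ = (2 : ℝ) ^ b * (a ^ (-b)) ^ k := by
        rw [Real.div_rpow (by positivity) (by norm_num), Real.rpow_neg (by norm_num : (0 : ℝ) ≤ 2),
          ← Real.rpow_natCast, ← Real.rpow_natCast, ← Real.rpow_mul ha0.le, ← Real.rpow_mul ha0.le,
          mul_comm (k : ℝ)]
        field_simp

/-- One factor a comes from passing to the next power, the other from the integer part. -/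
lemma exists_floor_pow_le (ha : 1 < a) (K : ℕ) : ∀ᶠ n : ℕ in atTop,
    ∃ k, K ≤ k ∧ ⌊a ^ k⌋₊ ≤ n ∧ (n : ℝ) ≤ a ^ 2 * ⌊a ^ k⌋₊ := by
  have ha0 : 0 < a := by linarith
  obtain ⟨K', hK'⟩ := eventually_atTop.1
    ((tendsto_natCast_atTop_atTop.comp (tendsto_floor_pow ha)).eventually_ge_atTop (1 / (a - 1)))
  filter_upwards [eventually_ge_atTop 1, tendsto_natCast_atTop_atTop.eventually_ge_atTop
    (a ^ (max K K'))] with n hn1 hn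
  obtain ⟨k, h1, h2⟩ := exists_nat_pow_near (x := (n : ℝ)) (by exact_mod_cast hn1) ha
  have hk : max K K' ≤ k := by
    by_contra! h
    exact absurd (hn.trans_lt h2) (not_lt.2 (pow_le_pow_right₀ ha.le h))
  refine ⟨k, (le_max_left _ _).trans hk, Nat.floor_le_of_le h1, ?_⟩
  have h3 := hK' k ((le_max_right _ _).trans hk)
  simp only [Function.comp_apply] at h3
  rw [div_le_iff₀ (by linarith)] at h3
  have h4 := Nat.lt_floor_add_one (a ^ k)
  calc (n : ℝ) ≤ a * a ^ k := by rw [← pow_succ']; exact h2.le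
    _ ≤ a * (a * ⌊a ^ k⌋₊) := by gcongr; linarith
    _ = _ := by ring

end geometric

/-! ### No-return probabilities and Borel–Cantelli. -/

section upperBound

variable {X : Set ℝ} {f : ℝ → ℝ} {μ : Measure ℝ} {ρ : ℝ → ℝ} {Y : Set ℝ} {F : ℝ → ℝ}
  {ν : Measure ℝ} {C κ S β : ℝ}

lemma ae_eventually_notMem_of_summable [IsFiniteMeasure ν] {E : ℕ → Set ℝ} {b : ℕ → ℝ}
    (hb : Summable b) (h : ∀ᶠ k in atTop, ν.real (E k) ≤ b k) :
    ∀ᵐ x ∂ν, ∀ᶠ k in atTop, x ∉ E k := by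
  obtain ⟨K, hK⟩ := eventually_atTop.1 h
  have hb' : Summable fun k => b (k + K) := (summable_nat_add_iff K).2 hb
  have := ae_eventually_notMem (μ := ν) (s := fun k => E (k + K)) <| by
    have hle : ∀ k, ν (E (k + K)) ≤ ENNReal.ofReal (b (k + K)) := fun k => by
      have h0 := hK (k + K) (by omega)
      rw [← ofReal_measureReal]
      exact ENNReal.ofReal_le_ofReal h0
    refine ne_top_of_le_ne_top ?_ (ENNReal.tsum_le_tsum hle)
    rw [← ENNReal.ofReal_tsum_of_nonneg
      (fun k => measureReal_nonneg.trans (hK (k + K) (by omega))) hb']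
    exact ENNReal.ofReal_ne_top
  filter_upwards [this] with x hx
  obtain ⟨M, hM⟩ := eventually_atTop.1 hx
  filter_upwards [eventually_ge_atTop (M + K)] with k hk
  have := hM (k - K) (by omega)
  rwa [Nat.sub_add_cancel (by omega)] at this

lemma measurable_comp_floor (ℓ : ℝ) (g : ℤ → ℝ) : Measurable fun x : ℝ => g ⌊x / ℓ⌋ :=
  (measurable_from_top (f := g)).comp (Int.measurable_floor.comp (measurable_id.div_const ℓ))

/-- The points of the cells with index in `s` that do not return to the `q`-neighbourhood of
their cell at the times `p ≤ t < p + N`. -/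
def noReturn (F : ℝ → ℝ) (ℓ : ℝ) (q p N : ℕ) (s : Finset ℤ) : Set ℝ :=
  {x | ⌊x / ℓ⌋ ∈ s ∧ ∀ t ∈ Finset.Ico p (p + N), F^[t] x ∉ cell ℓ q ⌊x / ℓ⌋}

/-- For u = 1 the weight is the indicator that no visit occurs during the window. -/
lemma measureReal_noReturn_le [IsFiniteMeasure ν] (hF : Measurable F) {ℓ : ℝ} (hℓ : 0 < ℓ)
    (q p N : ℕ) (s : Finset ℤ) : ν.real (noReturn F ℓ q p N s) ≤
      ∑ i ∈ s, ∫ x, (cell ℓ 0 i).indicator 1 x * weight F (cell ℓ q i) 1 N (F^[p] x) ∂ν := by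
  set E : ℤ → Set ℝ := fun i =>
    cell ℓ 0 i ∩ ⋂ t ∈ Finset.Ico p (p + N), F^[t] ⁻¹' (cell ℓ q i)ᶜ with hE
  have hEm : ∀ i, MeasurableSet (E i) := fun i => (measurableSet_cell ℓ 0 i).inter <|
    Finset.measurableSet_biInter _ fun t _ => hF.iterate t (measurableSet_cell ℓ q i).compl
  have hsub : noReturn F ℓ q p N s ⊆ ⋃ i ∈ s, E i := by
    rintro x ⟨h1, h2⟩
    refine mem_iUnion₂.2 ⟨_, h1, mem_cell_floor hℓ 0 x, ?_⟩
    exact mem_iInter₂.2 h2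
  refine (measureReal_mono hsub (measure_ne_top _ _)).trans ((measureReal_biUnion_finset_le _ _).trans ?_)
  refine Finset.sum_le_sum fun i _ => ?_
  rw [← integral_indicator_one (hEm i)]
  refine integral_mono ((integrable_const (1 : ℝ)).indicator (hEm i)) ?_ fun x => ?_
  · refine Integrable.of_bound (C := 1) (((measurable_one.indicator
      (measurableSet_cell ℓ 0 i)).mul ((measurable_weight hF (measurableSet_cell ℓ q i) 1 N).comp
        (hF.iterate p))).aestronglyMeasurable) (Eventually.of_forall fun x => ?_)
    have h1 := weight_nonneg (F := F) (J := cell ℓ q i) (u := 1) ⟨zero_le_one, le_rfl⟩ N (F^[p] x)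
    have h2 := weight_le_one (F := F) (J := cell ℓ q i) (u := 1) ⟨zero_le_one, le_rfl⟩ N (F^[p] x)
    have h3 := indicator_one_nonneg (cell ℓ 0 i) x
    have h4 := indicator_one_le (cell ℓ 0 i) x
    rw [Real.norm_of_nonneg (mul_nonneg h3 h1)]
    exact mul_le_one₀ h4 h1 h2
  · by_cases hx : x ∈ E i
    · have hw : weight F (cell ℓ q i) 1 N (F^[p] x) = 1 := by
        refine Finset.prod_eq_one fun t ht => ?_
        have := mem_iInter₂.1 hx.2 (t + p) (by
          rw [Finset.mem_range] at ht; rw [Finset.mem_Ico]; omega)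
        rw [mem_preimage, Function.iterate_add_apply] at this
        rw [indicator_of_notMem this]; ring
      simp only [indicator_of_mem hx, indicator_of_mem hx.1, hw, Pi.one_apply, mul_one, le_refl]
    · rw [indicator_of_notMem hx]
      exact mul_nonneg (indicator_one_nonneg _ _) (weight_nonneg ⟨zero_le_one, le_rfl⟩ _ _)

lemma floor_div_mem_gridRange {ℓ : ℕ → ℝ} {n : ℕ} (hℓ : 0 < ℓ n) {x : ℝ} (hx : |x| ≤ n) :
    ⌊x / ℓ n⌋ ∈ gridRange ℓ n := by
  rw [abs_le] at hx
  rw [gridRange, Finset.mem_Icc, ← Int.floor_neg]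
  constructor
  · apply Int.floor_mono
    rw [← neg_div]
    gcongr; exact hx.1
  · refine (Int.floor_le_ceil _).trans (Int.ceil_mono ?_)
    gcongr; exact hx.2

/-- If on at least half of each cell with index in `s` the mean number of returns to the cell is at
least `h`, then it is unlikely not to return. -/
lemma sum_measureReal_cell_mul_pow_le [IsProbabilityMeasure ν] {ℓ : ℝ} (hℓ : 0 < ℓ) (q N : ℕ)
    (s : Finset ℤ) {A : Set ℝ} (hA : MeasurableSet A) {h : ℝ → ℝ} (hm : Measurable h)
    (h0 : ∀ x, 0 ≤ h x)
    (hs : ∀ i ∈ s, ν.real (cell ℓ 0 i) ≤ 2 * ν.real (A ∩ cell ℓ 0 i))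
    (hAh : ∀ x ∈ A, h x ≤ N * ν.real (cell ℓ q ⌊x / ℓ⌋)) :
    ∑ i ∈ s, ν.real (cell ℓ 0 i) * (1 - 1 * ν.real (cell ℓ q i)) ^ N ≤
      2 * ∫ x, Real.exp (-h x) ∂ν := by
  have hint : Integrable (fun x => Real.exp (-h x)) ν :=
    Integrable.of_bound hm.neg.exp.aestronglyMeasurable 1 <| Eventually.of_forall fun x => by
      rw [Real.norm_of_nonneg (Real.exp_pos _).le, Real.exp_le_one_iff]
      linarith [h0 x]
  have hAm : ∀ i, MeasurableSet (A ∩ cell ℓ 0 i) := fun i => hA.inter (measurableSet_cell ℓ 0 i)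
  calc ∑ i ∈ s, ν.real (cell ℓ 0 i) * (1 - 1 * ν.real (cell ℓ q i)) ^ N
      ≤ ∑ i ∈ s, 2 * ∫ x in A ∩ cell ℓ 0 i, Real.exp (-h x) ∂ν := by
        refine Finset.sum_le_sum fun i hi => ?_
        have hv1 : ν.real (cell ℓ q i) ≤ 1 := measureReal_le_one
        have e1 : (1 - 1 * ν.real (cell ℓ q i)) ^ N ≤ Real.exp (-(N * ν.real (cell ℓ q i))) := by
          rw [one_mul, ← mul_neg, Real.exp_nat_mul]
          refine pow_le_pow_left₀ (by linarith) ?_ N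
          linarith [Real.add_one_le_exp (-ν.real (cell ℓ q i))]
        calc _ ≤ (2 * ν.real (A ∩ cell ℓ 0 i)) * Real.exp (-(N * ν.real (cell ℓ q i))) :=
              mul_le_mul (hs i hi) e1 (pow_nonneg (by linarith) _)
                (mul_nonneg zero_le_two measureReal_nonneg)
          _ = 2 * ∫ _ in A ∩ cell ℓ 0 i, Real.exp (-(N * ν.real (cell ℓ q i))) ∂ν := by
              rw [setIntegral_const, smul_eq_mul]; ring
          _ ≤ _ := by
              refine mul_le_mul_of_nonneg_left (setIntegral_mono_on (integrable_const _).integrableOn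
                hint.integrableOn (hAm i) fun x hx => ?_) zero_le_two
              have := hAh x hx.1
              rw [(mem_cell_zero_iff hℓ i x).1 hx.2] at this
              exact Real.exp_le_exp.2 (neg_le_neg this)
    _ = 2 * ∫ x in ⋃ i ∈ s, A ∩ cell ℓ 0 i, Real.exp (-h x) ∂ν := by
        rw [← Finset.mul_sum, integral_biUnion_finset s (fun i _ => hAm i)]
        · intro i _ j _ hij
          rw [Function.onFun, Set.disjoint_left]
          rintro x ⟨_, hi⟩ ⟨_, hj⟩
          rw [mem_cell_zero_iff hℓ] at hi hj
          exact hij (hi.symm.trans hj)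
        · exact fun i _ => hint.integrableOn
    _ ≤ _ := mul_le_mul_of_nonneg_left
        (setIntegral_le_integral hint (Eventually.of_forall fun x => (Real.exp_pos _).le))
        zero_le_two

lemma cond_real_eq_div (hY : MeasurableSet Y) (E : Set ℝ) :
    (ProbabilityTheory.cond μ Y).real E = μ.real (Y ∩ E) / μ.real Y := by
  rw [measureReal_def, ProbabilityTheory.cond_apply hY, ENNReal.toReal_mul, ENNReal.toReal_inv,
    inv_mul_eq_div]; rfl

lemma admissibleMesh_div {w : ℕ → ℝ} {D : ℝ} (h1 : ∀ᶠ n : ℕ in atTop, ((n : ℝ) ^ 2)⁻¹ ≤ w n)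
    (h2 : ∀ᶠ n : ℕ in atTop, n * w n ≤ Real.log n ^ D) {c : ℝ} (hc : 1 ≤ c) :
    AdmissibleMesh fun n => w n / c := by
  refine ⟨D, ?_⟩
  have hc0 : 0 < c := by linarith
  filter_upwards [h1, h2, eventually_gt_atTop 0,
    tendsto_natCast_atTop_atTop.eventually_ge_atTop c] with n h1 h2 hn hnc
  have hn' : (0 : ℝ) < n := by exact_mod_cast hn
  have hw : 0 < w n := lt_of_lt_of_le (by positivity) h1
  constructor
  · rw [le_div_iff₀ hc0]
    refine le_trans ?_ h1
    calc ((n : ℝ) ^ 3)⁻¹ * c ≤ ((n : ℝ) ^ 3)⁻¹ * n := by gcongr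
      _ = _ := by field_simp
  · refine le_trans ?_ h2
    gcongr
    exact div_le_self hw.le hc

lemma eventually_of_div_tendsto_lt {a : ℕ → ℝ} {c c' : ℝ}
    (h : Tendsto (fun n : ℕ => a n / n) atTop (𝓝 c)) (hc : c' < c) :
    ∀ᶠ n : ℕ in atTop, c' * n < a n := by
  filter_upwards [h.eventually (lt_mem_nhds hc), eventually_gt_atTop 0] with n hn hn0
  rwa [lt_div_iff₀ (by exact_mod_cast hn0)] at hn

lemma tendsto_gap_div : Tendsto (fun n : ℕ => (gap n : ℝ) / n) atTop (𝓝 0) := by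
  refine squeeze_zero' (Eventually.of_forall fun n => by positivity) ?_
    ((tendsto_rpow_neg_atTop (y := 1 / 2) (by norm_num)).comp tendsto_natCast_atTop_atTop)
  filter_upwards [eventually_log_rpow_mul_le 1 2 (b := 1 / 2) (by norm_num),
    eventually_gt_atTop 0] with n h hn
  have hn' : (0 : ℝ) < n := by exact_mod_cast hn
  have := gap_le n
  rw [one_mul, Real.rpow_two] at h
  rw [div_le_iff₀ hn', Function.comp_apply]
  have e : (n : ℝ) ^ (-(1 / 2) : ℝ) * n = (n : ℝ) ^ (1 / 2 : ℝ) := by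
    rw [← Real.rpow_add_one hn'.ne']; norm_num
  rw [e]
  linarith

lemma tendsto_floor_mul_div {c : ℝ} (hc : 0 ≤ c) :
    Tendsto (fun n : ℕ => (⌊c * n⌋₊ : ℝ) / n) atTop (𝓝 c) :=
  (tendsto_nat_floor_mul_div_atTop hc).comp tendsto_natCast_atTop_atTop

end upperBound

/-! ### The almost sure upper bound along a geometric sequence of times. -/

section upperBound

variable {X : Set ℝ} {f : ℝ → ℝ} {μ : Measure ℝ} {ρ : ℝ → ℝ} {Y : Set ℝ} {F : ℝ → ℝ}
  {ν : Measure ℝ} {C κ S β : ℝ}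

lemma ae_tendsto_mul_cond_cell (hsys : IsErgodicAcip X f μ) (hρ : IsDensity X μ ρ)
    (hY : MeasurableSet Y) (hYX : Y ⊆ X) (hYpos : 0 < μ.real Y) {ℓ : ℕ → ℝ}
    (hℓ : AdmissibleMesh ℓ) (q : ℕ) {N : ℕ → ℕ} {c : ℝ}
    (hN : Tendsto (fun n : ℕ => (N n : ℝ) / n) atTop (𝓝 (c * μ.real Y))) :
    ∀ᵐ x ∂μ, x ∈ Y → Tendsto (fun n : ℕ =>
      N n * (ProbabilityTheory.cond μ Y).real (cell (ℓ n) q ⌊x / ℓ n⌋) / (n * ℓ n)) atTop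
        (𝓝 (c * (2 * q + 1) * ρ x)) := by
  have := hsys.isProbabilityMeasure
  filter_upwards [hsys.absolutelyContinuous.ae_le (hρ.ae_tendsto_cell hsys.measurableSet hY)]
    with x hx hxY
  have h := (hN.mul ((hx q ℓ hℓ.tendsto_zero).const_mul ((2 * q + 1) / μ.real Y)))
  rw [indicator_of_mem (show x ∈ Y ∩ X from ⟨hxY, hYX hxY⟩)] at h
  have e : c * μ.real Y * ((2 * q + 1) / μ.real Y * ρ x) = c * (2 * q + 1) * ρ x := by
    field_simp
  rw [e] at h
  refine h.congr' ?_
  filter_upwards [eventually_gt_atTop 0, hℓ.eventually_pos] with n hn hpos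
  rw [cond_real_eq_div hY]
  field_simp

lemma IsDensity.ae_pos (hρ : IsDensity X μ ρ) (hρm : Measurable ρ) :
    ∀ᵐ x ∂μ, 0 < ρ x := by
  rw [hρ.eq_withDensity, ae_withDensity_iff hρm.ennreal_ofReal]
  exact Eventually.of_forall fun x hx => by simpa using hx

lemma exists_returnMap_mem_of_notMem_noReturn {ℓ : ℝ} {q p N : ℕ} {s : Finset ℤ} {x : ℝ}
    (hs : ⌊x / ℓ⌋ ∈ s) (hx : x ∉ noReturn F ℓ q p N s) :
    ∃ t ∈ Finset.Ico p (p + N), F^[t] x ∈ cell ℓ q ⌊x / ℓ⌋ := by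
  by_contra! h
  exact hx ⟨hs, h⟩

/-- On cells where the local mean number of returns is at least (1-δ)2n·w(n)·ρ, the chance of no
return is about exp(-(1-δ)2n·w(n)·ρ), which is summable along n = ⌊a^k⌋. Since the minimum decreases
in time, the comparison of w with r covers the intermediate times. -/
theorem ae_eventually_recMin_lt (hsys : IsErgodicAcip X f μ) (hρ : IsDensity X μ ρ)
    (hρm : Measurable ρ) (hρ0 : ∀ x, 0 ≤ ρ x) (hasym : AsymptoticallyHyperbolic X f μ)
    {w r : ℕ → ℝ} {D δ a : ℝ} (h1 : ∀ᶠ n : ℕ in atTop, ((n : ℝ) ^ 2)⁻¹ ≤ w n)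
    (h2 : ∀ᶠ n : ℕ in atTop, n * w n ≤ Real.log n ^ D) (ha : 1 < a) (hδ0 : 0 < δ) (hδ1 : δ < 1)
    (hwr : ∀ᶠ n : ℕ in atTop, ∀ n' : ℕ, n ≤ n' → (n' : ℝ) ≤ a ^ 2 * n → w n ≤ r n')
    (hsum : Summable fun k : ℕ =>
      ∫ x, Real.exp (-((1 - δ) * 2 * ⌊a ^ k⌋₊ * w ⌊a ^ k⌋₊ * ρ x)) ∂μ) :
    ∀ᵐ x ∂μ, ∀ᶠ n : ℕ in atTop, recMin f n x < r n := by
  have := hsys.isProbabilityMeasure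
  refine ae_of_forall_exists_measure_compl_le fun ε hε => ?_
  obtain ⟨Y, C, κ, S, β, hY, hYX, hYε, hprob, hgood⟩ := hasym.exists_goodSystem hsys hε
  refine ⟨Y, hYε, ?_⟩
  have hYpos := measureReal_pos_of_cond (μ := μ) (Y := Y)
  set m := μ.real Y with hm
  have hm1 : m ≤ 1 := measureReal_le_one
  set F := returnMap f Y with hF
  set ν := ProbabilityTheory.cond μ Y with hν
  have hFm : Measurable F := hgood.measurePreserving.measurable
  -- With 1/(q+1) < δ one has 2(1-δ)(q+1) < (1-δ/2)(2q+1), so the discretisation fits within the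
  -- loss δ.
  obtain ⟨q, hq⟩ := exists_nat_one_div_lt hδ0
  have hq0 : (0 : ℝ) < q + 1 := by positivity
  set ℓ : ℕ → ℝ := fun n => w n / (q + 1) with hℓ
  have hmesh : AdmissibleMesh ℓ := admissibleMesh_div h1 h2 (by linarith [(Nat.cast_nonneg q : (0 : ℝ) ≤ q)])
  -- Slightly fewer than the typical mn returns, so that the gap and N further returns are completed
  -- by time n.
  set N : ℕ → ℕ := fun n => ⌊(1 - δ / 2) * m * n⌋₊ with hN
  have hc0 : 0 ≤ (1 - δ / 2) * m := mul_nonneg (by linarith) hYpos.le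
  have hNlim : Tendsto (fun n : ℕ => (N n : ℝ) / n) atTop (𝓝 ((1 - δ / 2) * m)) :=
    tendsto_floor_mul_div hc0
  have hNle : ∀ n, N n ≤ n := fun n => by
    refine Nat.floor_le_of_le ?_
    have : (1 - δ / 2) * m ≤ 1 := by nlinarith
    nlinarith [(Nat.cast_nonneg n : (0 : ℝ) ≤ n)]
  set G : ℕ → Set ℝ := fun n =>
    {x | (1 - δ) * 2 * n * w n * ρ x ≤ N n * ν.real (cell (ℓ n) q ⌊x / ℓ n⌋)} with hG
  have hGm : ∀ n, MeasurableSet (G n) := fun n => measurableSet_le (hρm.const_mul _)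
    ((measurable_comp_floor (ℓ n) fun i => ν.real (cell (ℓ n) q i)).const_mul _)
  set A : ℕ → Set ℝ := fun K => Y ∩ ⋂ k, ⋂ (_ : K ≤ k), G ⌊a ^ k⌋₊ with hA
  have hAm : ∀ K, MeasurableSet (A K) := fun K =>
    hY.inter (MeasurableSet.iInter fun k => MeasurableSet.iInter fun _ => hGm _)
  have htime := tendsto_floor_pow ha
  have hcover : ∀ᵐ x ∂μ, x ∈ Y → ∃ K, x ∈ A K := by
    filter_upwards [ae_tendsto_mul_cond_cell hsys hρ hY hYX hYpos hmesh q hNlim,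
      hρ.ae_pos hρm] with x hx hxρ hxY
    have hlt : 2 * (1 - δ) * (q + 1) * ρ x < (1 - δ / 2) * (2 * q + 1) * ρ x := by
      refine mul_lt_mul_of_pos_right ?_ hxρ
      rw [div_lt_iff₀ hq0] at hq
      nlinarith
    have hev := (hx hxY).eventually (lt_mem_nhds hlt)
    have hev' : ∀ᶠ n in atTop, x ∈ G n := by
      filter_upwards [hev, eventually_gt_atTop 0, hmesh.eventually_pos] with n hn hn0 hpos
      have hn' : (0 : ℝ) < n := by exact_mod_cast hn0
      rw [lt_div_iff₀ (by positivity)] at hn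
      have e : (1 - δ) * 2 * n * w n * ρ x = 2 * (1 - δ) * (q + 1) * ρ x * (n * ℓ n) := by
        simp only [hℓ]; field_simp
      change (1 - δ) * 2 * n * w n * ρ x ≤ N n * ν.real (cell (ℓ n) q ⌊x / ℓ n⌋)
      rw [e]; exact hn.le
    obtain ⟨K, hK⟩ := eventually_atTop.1 (htime.eventually hev')
    exact ⟨K, hxY, mem_iInter₂.2 hK⟩
  have hmain : ∀ K, ∀ᵐ x ∂μ, x ∈ A K → ∀ᶠ n : ℕ in atTop, recMin f n x < r n := by
    intro K
    classical
    -- The lower bound on the mean number of returns is known only on A K, and uniformly from K on.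
    -- Keeping the cells at least half filled by A K lets the rest of a cell be paid for by a factor
    -- 2.
    set s : ℕ → Finset ℤ := fun n => (gridRange ℓ n).filter fun i =>
      ν.real (cell (ℓ n) 0 i) ≤ 2 * ν.real (A K ∩ cell (ℓ n) 0 i) with hs
    set E : ℕ → Set ℝ := fun k => noReturn F (ℓ ⌊a ^ k⌋₊) q (gap ⌊a ^ k⌋₊) (N ⌊a ^ k⌋₊)
      (s ⌊a ^ k⌋₊) with hE
    obtain ⟨b, hb, hbound⟩ := hgood.sum_abs_le_rpow (u := 1) ⟨zero_le_one, le_rfl⟩ q hmesh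
      (N := N) (Eventually.of_forall fun n => (hNle n).trans (by omega))
    have hEle : ∀ᶠ k in atTop, ν.real (E k) ≤ (⌊a ^ k⌋₊ : ℝ) ^ (-b) +
        2 * (m⁻¹ * ∫ x, Real.exp (-((1 - δ) * 2 * ⌊a ^ k⌋₊ * w ⌊a ^ k⌋₊ * ρ x)) ∂μ) := by
      filter_upwards [htime.eventually hbound, htime.eventually hmesh.eventually_pos,
        eventually_ge_atTop K] with k hk hpos hkK
      set n := ⌊a ^ k⌋₊
      have hw0 : 0 ≤ w n := by
        have : w n = ℓ n * (q + 1) := by simp only [hℓ]; field_simp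
        rw [this]; positivity
      have hh0 : ∀ x, 0 ≤ (1 - δ) * 2 * n * w n * ρ x := fun x =>
        mul_nonneg (mul_nonneg (mul_nonneg (by linarith) (Nat.cast_nonneg n)) hw0) (hρ0 x)
      have hnoReturn := measureReal_noReturn_le (ν := ν) hFm hpos q (gap n) (N n) (s n)
      have hcells := sum_measureReal_cell_mul_pow_le (ν := ν) hpos q (N n) (s n) (hAm K)
        (hρm.const_mul ((1 - δ) * 2 * n * w n)) hh0
        (fun i hi => (Finset.mem_filter.1 hi).2) (fun x hx => mem_iInter₂.1 hx.2 k hkK)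
      have hexpInt : ∫ x, Real.exp (-((1 - δ) * 2 * n * w n * ρ x)) ∂ν ≤
          m⁻¹ * ∫ x, Real.exp (-((1 - δ) * 2 * n * w n * ρ x)) ∂μ := by
        rw [hν, ProbabilityTheory.cond, integral_smul_measure, ENNReal.toReal_inv, smul_eq_mul]
        refine mul_le_mul_of_nonneg_left (setIntegral_le_integral ?_
          (Eventually.of_forall fun x => (Real.exp_pos _).le)) (by positivity)
        exact Integrable.of_bound (hρm.const_mul _).neg.exp.aestronglyMeasurable 1 <|
          Eventually.of_forall fun x => by
            rw [Real.norm_of_nonneg (Real.exp_pos _).le, Real.exp_le_one_iff]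
            linarith [hh0 x]
      have hcellPow : ∑ i ∈ s n, (∫ x, (cell (ℓ n) 0 i).indicator 1 x *
          weight F (cell (ℓ n) q i) 1 (N n) (F^[gap n] x) ∂ν) -
          ∑ i ∈ s n, ν.real (cell (ℓ n) 0 i) * (1 - 1 * ν.real (cell (ℓ n) q i)) ^ N n ≤
            (n : ℝ) ^ (-b) := by
        rw [← Finset.sum_sub_distrib]
        refine le_trans ?_ hk
        exact (Finset.sum_le_sum fun i _ => le_abs_self _).trans
          (Finset.sum_le_sum_of_subset_of_nonneg (Finset.filter_subset _ _)
            fun _ _ _ => abs_nonneg _)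
      have : ν.real (E k) = ν.real (noReturn F (ℓ n) q (gap n) (N n) (s n)) := rfl
      linarith
    have hBC := ae_eventually_notMem_of_summable
      ((summable_floor_pow_rpow_neg ha hb).add ((hsum.mul_left m⁻¹).mul_left 2)) hEle
    filter_upwards [ae_mem_imp_of_ae_cond hY hBC, ae_tendsto_visits hsys.ergodic hY,
      hsys.absolutelyContinuous.ae_le (hρ.ae_tendsto_cell hsys.measurableSet (hAm K)),
      hsys.absolutelyContinuous.ae_le (hρ.ae_tendsto_cell hsys.measurableSet hY),
      hρ.ae_pos hρm] with x hxE hxv hxA hxYd hxρ hx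
    have hxY : x ∈ Y := hx.1
    have hA' := hxA 0 ℓ hmesh.tendsto_zero
    have hY' := hxYd 0 ℓ hmesh.tendsto_zero
    rw [indicator_of_mem (show x ∈ A K ∩ X from ⟨hx, hYX hxY⟩)] at hA'
    rw [indicator_of_mem (show x ∈ Y ∩ X from ⟨hxY, hYX hxY⟩)] at hY'
    -- Almost every point of A K is a density point: A K and Y have the same positive limiting
    -- density ρ(x) on the cells of x, so half is eventually exceeded.
    have hidx : ∀ᶠ n in atTop, ⌊x / ℓ n⌋ ∈ s n := by
      have hlt : ρ x < 2 * ρ x := by linarith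
      filter_upwards [hY'.eventually_lt (hA'.const_mul 2) hlt, hmesh.eventually_pos,
        tendsto_natCast_atTop_atTop.eventually_ge_atTop |x|] with n hn hpos hxn
      refine Finset.mem_filter.2 ⟨floor_div_mem_gridRange hpos hxn, ?_⟩
      have hAY : Y ∩ (A K ∩ cell (ℓ n) 0 ⌊x / ℓ n⌋) = A K ∩ cell (ℓ n) 0 ⌊x / ℓ n⌋ :=
        inter_eq_right.2 fun y hy => hy.1.1
      rw [cond_real_eq_div hY, cond_real_eq_div hY, hAY, ← mul_div_assoc]
      refine div_le_div_of_nonneg_right ?_ hYpos.le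
      have hpos' : (0 : ℝ) < (2 * (0 : ℕ) + 1) * ℓ n := by simpa using hpos
      rw [div_lt_iff₀ hpos', mul_assoc, div_mul_cancel₀ _ hpos'.ne'] at hn
      exact hn.le
    have hvis : ∀ᶠ n : ℕ in atTop, gap n + N n ≤ visits f Y n x := by
      have h3 : Tendsto (fun n : ℕ => ((visits f Y n x : ℝ) - gap n - N n) / n) atTop
          (𝓝 (m - 0 - (1 - δ / 2) * m)) := by
        simp only [sub_div]
        exact (hxv.sub tendsto_gap_div).sub hNlim
      filter_upwards [eventually_of_div_tendsto_lt h3 (c' := 0) (by nlinarith)] with n hn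
      have : ((gap n + N n : ℕ) : ℝ) ≤ visits f Y n x := by push_cast; linarith
      exact_mod_cast this
    have hhit : ∀ᶠ k in atTop, recMin f ⌊a ^ k⌋₊ x < w ⌊a ^ k⌋₊ := by
      filter_upwards [hxE hxY, htime.eventually hidx, htime.eventually hvis,
        htime.eventually eventually_one_le_gap, htime.eventually hmesh.eventually_pos]
        with k hk hidx hvis hgap hpos
      obtain ⟨t, ht, hmem⟩ := exists_returnMap_mem_of_notMem_noReturn hidx hk
      rw [Finset.mem_Ico] at ht
      obtain ⟨j, hj, e⟩ := exists_iterate_eq_iterate_returnMap (f := f) hxY (m := t) (by omega)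
        (show t ≤ visits f Y ⌊a ^ k⌋₊ x by omega)
      refine (recMin_le hj x).trans_lt ?_
      rw [e]
      refine (dist_lt_of_mem_cell hpos hmem).trans_le (le_of_eq ?_)
      simp only [hℓ]; field_simp
    obtain ⟨K₁, hK₁⟩ := eventually_atTop.1 (hhit.and (htime.eventually
      (hwr.and (eventually_ge_atTop 1))))
    filter_upwards [exists_floor_pow_le ha K₁] with n ⟨k, hk, hkn, hkn'⟩
    obtain ⟨h3, h4, h5⟩ := hK₁ k hk
    obtain ⟨j, hj, e⟩ := exists_recMin_eq (f := f) h5 x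
    exact ((recMin_le ⟨hj.1, hj.2.trans hkn⟩ x).trans_lt (e ▸ h3)).trans_le (h4 n hkn hkn')
  filter_upwards [hcover, ae_all_iff.2 hmain] with x hx1 hx2 hxY
  obtain ⟨K, hK⟩ := hx1 hxY
  exact hx2 K hK

end upperBound

/-! ### The two explicit almost sure upper bounds. -/

section upperBound

variable {X : Set ℝ} {f : ℝ → ℝ} {μ : Measure ℝ} {ρ : ℝ → ℝ}

lemma IsDensity.absolutelyContinuous_restrict (hρ : IsDensity X μ ρ) : μ ≪ volume.restrict X := by
  rw [hρ.eq_withDensity]; exact withDensity_absolutelyContinuous _ _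

lemma IsDensity.exists_measurable (hX : MeasurableSet X) (hρ : IsDensity X μ ρ) :
    ∃ ρ' : ℝ → ℝ, IsDensity X μ ρ' ∧ Measurable ρ' ∧ (∀ x, 0 ≤ ρ' x) ∧ ∀ᵐ x ∂μ, ρ' x = ρ x := by
  have hae : ∀ᵐ x ∂(volume.restrict X), max (hρ.aemeasurable.mk ρ x) 0 = ρ x := by
    filter_upwards [hρ.aemeasurable.ae_eq_mk, hρ.ae_nonneg hX] with x h1 h2
    rw [← h1]; exact max_eq_left h2
  have hm : Measurable fun x => max (hρ.aemeasurable.mk ρ x) 0 :=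
    hρ.aemeasurable.measurable_mk.max measurable_const
  refine ⟨_, ⟨hm.aemeasurable, fun x _ => le_max_right _ _, ?_⟩, hm, fun x => le_max_right _ _,
    hρ.absolutelyContinuous_restrict.ae_le hae⟩
  refine hρ.eq_withDensity.trans (withDensity_congr_ae ?_)
  filter_upwards [hae] with x hx
  rw [hx]

lemma exists_mul_le_log_floor_pow {a : ℝ} (ha : 1 < a) :
    ∃ c : ℝ, 0 < c ∧ ∀ᶠ k : ℕ in atTop, c * k ≤ Real.log ⌊a ^ k⌋₊ := by
  have hl := Real.log_pos ha
  refine ⟨Real.log a / 2, by positivity, ?_⟩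
  filter_upwards [tendsto_natCast_atTop_atTop.eventually_ge_atTop (2 * Real.log 2 / Real.log a)]
    with k hk
  rw [div_le_iff₀ hl] at hk
  have h1 := Real.log_le_log (by positivity) (half_pow_le_floor ha k)
  rw [Real.log_div (by positivity) (by norm_num), Real.log_pow] at h1
  linarith

lemma IsErgodicAcip.measure_setOf_mem_eq_one (hsys : IsErgodicAcip X f μ) {P : ℝ → Prop}
    (h : ∀ᵐ x ∂μ, P x) : μ {x ∈ X | P x} = 1 := by
  have := hsys.isProbabilityMeasure
  have hX : ∀ᵐ x ∂μ, x ∈ X := hsys.measure_compl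
  rw [← measure_univ (μ := μ)]
  refine measure_congr ?_
  filter_upwards [h, hX] with x h1 h2
  exact propext ⟨fun _ => mem_univ x, fun _ => ⟨h2, h1⟩⟩

lemma integrable_exp_neg [IsFiniteMeasure μ] {h : ℝ → ℝ} (hm : AEMeasurable h μ)
    (h0 : ∀ᵐ x ∂μ, 0 ≤ h x) : Integrable (fun x => Real.exp (-h x)) μ :=
  Integrable.of_bound (Real.measurable_exp.comp_aemeasurable hm.neg).aestronglyMeasurable 1 <| by
    filter_upwards [h0] with x hx
    rw [Real.norm_of_nonneg (Real.exp_pos _).le, Real.exp_le_one_iff]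
    linarith

theorem ae_eventually_recMin_lt_of_lt_sInf (hsys : IsErgodicAcip X f μ) (hρ : IsDensity X μ ρ)
    (hasym : AsymptoticallyHyperbolic X f μ) {r : ℕ → ℝ} {c : ℝ}
    (hc : 1 < 2 * c * sInf (ρ '' X))
    (hr : ∀ᶠ n : ℕ in atTop, c * Real.log (Real.log n) / n < r n) :
    ∀ᵐ x ∂μ, ∀ᶠ n : ℕ in atTop, recMin f n x < r n := by
  have := hsys.isProbabilityMeasure
  obtain ⟨ρ', hρ', hρm, hρ0, hae⟩ := hρ.exists_measurable hsys.measurableSet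
  set I := sInf (ρ '' X) with hI
  have hI0 : 0 ≤ I := Real.sInf_nonneg (by rintro _ ⟨x, hx, rfl⟩; exact hρ.nonneg x hx)
  have hIpos : 0 < I := lt_of_le_of_ne hI0 fun h => by rw [← h] at hc; norm_num at hc
  have hcpos : 0 < c := by
    by_contra! h
    nlinarith [mul_nonneg (neg_nonneg.2 h) hI0]
  have hIle : ∀ᵐ x ∂μ, I ≤ ρ' x := by
    have hX : ∀ᵐ x ∂μ, x ∈ X := hsys.measure_compl
    filter_upwards [hae, hX] with x h1 h2
    rw [h1]
    exact csInf_le ⟨0, by rintro _ ⟨y, hy, rfl⟩; exact hρ.nonneg y hy⟩ (mem_image_of_mem ρ h2)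
  set θ := 2 * c * I with hθ
  -- Here t < 1 but t²θ = (1+θ)²/(4θ) still exceeds 1. One factor t covers the gaps between
  -- consecutive times, as a² = 1/t, and the other is the loss 1-δ.
  set t := (1 + θ) / (2 * θ) with ht
  have hθ0 : 0 < θ := by linarith
  have ht0 : 0 < t := by positivity
  have ht1 : t < 1 := by rw [ht, div_lt_one (by positivity)]; linarith
  have hσ : 1 < t ^ 2 * θ := by
    have e : t ^ 2 * θ = (1 + θ) ^ 2 / (4 * θ) := by rw [ht]; field_simp; ring
    rw [e, one_lt_div (by positivity)]
    nlinarith [mul_pos (sub_pos.2 hc) (sub_pos.2 hc)]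
  set a := Real.sqrt (1 / t) with ha
  have ha1 : 1 < a := by
    rw [ha, Real.lt_sqrt zero_le_one, one_pow, lt_div_iff₀ ht0]; linarith
  have ha2 : a ^ 2 = 1 / t := Real.sq_sqrt (by positivity)
  have hloglog : Tendsto (fun n : ℕ => Real.log (Real.log n)) atTop atTop :=
    Real.tendsto_log_atTop.comp tendsto_log_natCast
  set w : ℕ → ℝ := fun n => t * c * Real.log (Real.log n) / n with hw
  refine ae_eventually_recMin_lt hsys hρ' hρm hρ0 hasym (w := w) (D := 2) (δ := 1 - t) (a := a)
    ?_ ?_ ha1 (by linarith) (by linarith) ?_ ?_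
  · filter_upwards [hloglog.eventually_ge_atTop (1 / (t * c)), eventually_ge_atTop 1] with n h1 h2
    have hn : (1 : ℝ) ≤ n := by exact_mod_cast h2
    rw [div_le_iff₀ (by positivity)] at h1
    rw [hw, inv_le_iff_one_le_mul₀ (by positivity)]
    have e : t * c * Real.log (Real.log n) / n * n ^ 2 = Real.log (Real.log n) * (t * c) * n := by
      field_simp
    dsimp only
    rw [e]; nlinarith
  · filter_upwards [tendsto_log_natCast.eventually_ge_atTop (t * c),
      tendsto_log_natCast.eventually_ge_atTop 1, eventually_ge_atTop 1] with n h1 h2 h3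
    have hn : (0 : ℝ) < n := by exact_mod_cast h3
    have e : n * w n = t * c * Real.log (Real.log n) := by rw [hw]; field_simp
    rw [e, Real.rpow_two]
    have h4 : Real.log (Real.log n) ≤ Real.log n := Real.log_le_self (by linarith)
    nlinarith [mul_pos ht0 hcpos, Real.log_nonneg h2]
  · obtain ⟨M, hM⟩ := eventually_atTop.1 hr
    filter_upwards [eventually_ge_atTop M, eventually_ge_atTop 1,
      tendsto_log_natCast.eventually_ge_atTop 1] with n h1 h2 h3 n' h4 h5
    refine le_trans ?_ (hM n' (h1.trans h4)).le
    have hn : (0 : ℝ) < n := by exact_mod_cast h2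
    have hnn : (n : ℝ) ≤ n' := by exact_mod_cast h4
    have hn' : (0 : ℝ) < n' := hn.trans_le hnn
    rw [ha2, div_mul_eq_mul_div, one_mul, le_div_iff₀ ht0] at h5
    have h6 : Real.log (Real.log n) ≤ Real.log (Real.log n') :=
      Real.log_le_log (by linarith) (Real.log_le_log hn hnn)
    have h7 : 0 ≤ Real.log (Real.log n) := Real.log_nonneg h3
    rw [hw]
    dsimp only
    rw [div_le_div_iff₀ hn hn']
    have h8 := h7.trans h6
    calc t * c * Real.log (Real.log n) * n' = c * Real.log (Real.log n) * (n' * t) := by ring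
      _ ≤ c * Real.log (Real.log n') * n := by gcongr
  · obtain ⟨d, hd, hdk⟩ := exists_mul_le_log_floor_pow ha1
    -- Since log ⌊a^k⌋ ≥ dk, the bound (log n)^(-t²θ) becomes a convergent p-series in k.
    have hs : Summable fun k : ℕ => d ^ (-(t ^ 2 * θ)) * (k : ℝ) ^ (-(t ^ 2 * θ)) :=
      (Real.summable_nat_rpow.2 (by linarith)).mul_left _
    refine Summable.of_norm_bounded_eventually_nat hs ?_
    filter_upwards [hdk, eventually_ge_atTop 1, (tendsto_floor_pow ha1).eventually
      (tendsto_log_natCast.eventually_ge_atTop 1),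
      (tendsto_floor_pow ha1).eventually_ge_atTop 1] with k h1 h2 h3 h4
    set n := ⌊a ^ k⌋₊
    have hk : (0 : ℝ) < k := by exact_mod_cast h2
    have hn : (0 : ℝ) < n := by exact_mod_cast h4
    have hL : 0 < Real.log n := by linarith
    have hLL : 0 ≤ Real.log (Real.log n) := Real.log_nonneg h3
    rw [Real.norm_of_nonneg (integral_nonneg fun x => (Real.exp_pos _).le)]
    calc ∫ x, Real.exp (-((1 - (1 - t)) * 2 * n * w n * ρ' x)) ∂μ
        ≤ ∫ _, (Real.log n) ^ (-(t ^ 2 * θ)) ∂μ := by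
          have e : ∀ x, (1 - (1 - t)) * 2 * n * w n * ρ' x =
              2 * t ^ 2 * c * Real.log (Real.log n) * ρ' x := fun x => by
            rw [hw]; field_simp; ring
          refine integral_mono_ae (integrable_exp_neg (hρm.const_mul _).aemeasurable
            (Eventually.of_forall fun x => ?_)) (integrable_const _) ?_
          · rw [e]; exact mul_nonneg (by positivity) (hρ0 x)
          · filter_upwards [hIle] with x hx
            rw [Real.rpow_def_of_pos hL, e]
            apply Real.exp_le_exp.2
            have : 2 * t ^ 2 * c * Real.log (Real.log n) * I ≤
                2 * t ^ 2 * c * Real.log (Real.log n) * ρ' x := by gcongr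
            rw [hθ]; linarith
      _ = (Real.log n) ^ (-(t ^ 2 * θ)) := by simp
      _ ≤ (d * k) ^ (-(t ^ 2 * θ)) :=
          Real.rpow_le_rpow_of_nonpos (by positivity) h1 (by linarith)
      _ = _ := Real.mul_rpow hd.le hk.le

theorem ae_eventually_recMin_lt_of_summable (hsys : IsErgodicAcip X f μ) (hρ : IsDensity X μ ρ)
    (hasym : AsymptoticallyHyperbolic X f μ) {r : ℕ → ℝ} {γ γ₀ : ℝ}
    (hsum : ∀ ε : ℝ, 0 < ε → Summable (fun k : ℕ =>
      ∫ x in X, ρ x * Real.exp (-(ε * ((k : ℝ) + 1) ^ γ₀ * ρ x))))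
    (hγ : γ₀ < γ) (hr : ∀ᶠ n : ℕ in atTop, Real.log n ^ γ / (2 * n) < r n) :
    ∀ᵐ x ∂μ, ∀ᶠ n : ℕ in atTop, recMin f n x < r n := by
  have := hsys.isProbabilityMeasure
  obtain ⟨ρ', hρ', hρm, hρ0, hae⟩ := hρ.exists_measurable hsys.measurableSet
  have hsum' : ∀ ε : ℝ, 0 < ε → Summable (fun k : ℕ =>
      ∫ x, Real.exp (-(ε * ((k : ℝ) + 1) ^ γ₀ * ρ' x)) ∂μ) := by
    intro ε hε
    refine (hsum ε hε).congr fun k => ?_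
    rw [← hρ.integral_eq hsys.measurableSet]
    refine integral_congr_ae ?_
    filter_upwards [hae] with x hx
    rw [hx]
  have hint : ∀ b : ℝ, 0 ≤ b → Integrable (fun x => Real.exp (-(b * ρ' x))) μ := fun b hb =>
    integrable_exp_neg (hρm.const_mul b).aemeasurable
      (Eventually.of_forall fun x => mul_nonneg hb (hρ0 x))
  -- For γ ≤ 0 the exponent γ₀ would be negative, and the terms of the series would stay above a
  -- positive constant.
  have hγ0 : 0 < γ := by
    by_contra! h
    have h0 := (hsum' 1 one_pos).tendsto_atTop_zero
    have hpos : 0 < ∫ x, Real.exp (-(1 * ρ' x)) ∂μ := by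
      rw [integral_pos_iff_support_of_nonneg (fun x => (Real.exp_pos _).le) (hint 1 zero_le_one)]
      have : Function.support (fun x => Real.exp (-(1 * ρ' x))) = univ :=
        eq_univ_of_forall fun x => (Real.exp_pos _).ne'
      rw [this]; simp
    refine absurd (ge_of_tendsto' h0 fun k => ?_) (not_le.2 hpos)
    refine integral_mono (hint 1 zero_le_one) (hint _ (by positivity)) fun x => ?_
    apply Real.exp_le_exp.2
    have h1 : ((k : ℝ) + 1) ^ γ₀ ≤ 1 :=
      Real.rpow_le_one_of_one_le_of_nonpos (by linarith [(Nat.cast_nonneg k : (0 : ℝ) ≤ k)])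
        (by linarith)
    have := mul_le_mul_of_nonneg_right h1 (hρ0 x)
    linarith
  set a := Real.sqrt 2 with ha
  have ha1 : 1 < a := by rw [ha, Real.lt_sqrt zero_le_one]; norm_num
  have ha2 : a ^ 2 = 2 := Real.sq_sqrt zero_le_two
  -- Half of the prescribed radius, because a² = 2 lets the time double.
  set w : ℕ → ℝ := fun n => Real.log n ^ γ / (4 * n) with hw
  refine ae_eventually_recMin_lt hsys hρ' hρm hρ0 hasym (w := w) (D := γ) (δ := 1 / 2) (a := a)
    ?_ ?_ ha1 (by norm_num) (by norm_num) ?_ ?_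
  · filter_upwards [tendsto_log_natCast.eventually_ge_atTop 1, eventually_ge_atTop 4] with n h1 h2
    have hn : (4 : ℝ) ≤ n := by exact_mod_cast h2
    have h3 : 1 ≤ Real.log n ^ γ := Real.one_le_rpow h1 hγ0.le
    rw [hw]
    dsimp only
    rw [inv_eq_one_div, div_le_div_iff₀ (by positivity) (by positivity)]
    nlinarith [mul_le_mul_of_nonneg_right h3 (sq_nonneg (n : ℝ))]
  · filter_upwards [eventually_ge_atTop 1] with n h1
    have hn : (0 : ℝ) < n := by exact_mod_cast h1
    have e : n * w n = Real.log n ^ γ / 4 := by rw [hw]; field_simp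
    rw [e]
    have : 0 ≤ Real.log n ^ γ := Real.rpow_nonneg (Real.log_natCast_nonneg n) γ
    linarith
  · obtain ⟨M, hM⟩ := eventually_atTop.1 hr
    filter_upwards [eventually_ge_atTop M, eventually_ge_atTop 1] with n h1 h2 n' h4 h5
    refine le_trans ?_ (hM n' (h1.trans h4)).le
    have hn : (0 : ℝ) < n := by exact_mod_cast h2
    have hnn : (n : ℝ) ≤ n' := by exact_mod_cast h4
    have hn' : (0 : ℝ) < n' := hn.trans_le hnn
    rw [ha2] at h5
    have h6 : Real.log n ^ γ ≤ Real.log n' ^ γ :=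
      Real.rpow_le_rpow (Real.log_natCast_nonneg n) (Real.log_le_log hn hnn) hγ0.le
    have h7 : 0 ≤ Real.log n ^ γ := Real.rpow_nonneg (Real.log_natCast_nonneg n) γ
    rw [hw]
    dsimp only
    rw [div_le_div_iff₀ (by positivity) (by positivity)]
    calc Real.log n ^ γ * (2 * n') ≤ Real.log n' ^ γ * (2 * (2 * n)) := by gcongr
      _ = _ := by ring
  · obtain ⟨d, hd, hdk⟩ := exists_mul_le_log_floor_pow ha1
    -- As log ⌊a^k⌋ ≥ dk ≥ (d/2)(k+1) for k ≥ 1, all constants are absorbed into ε, which is free in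
    -- the summability hypothesis.
    have hε : 0 < (d / 2) ^ γ / 4 := by positivity
    refine Summable.of_norm_bounded_eventually_nat (hsum' _ hε) ?_
    filter_upwards [hdk, eventually_ge_atTop 1,
      (tendsto_floor_pow ha1).eventually_ge_atTop 1] with k h1 h2 h4
    set n := ⌊a ^ k⌋₊
    have hk : (1 : ℝ) ≤ k := by exact_mod_cast h2
    have hn : (0 : ℝ) < n := by exact_mod_cast h4
    have e : (1 - 1 / 2) * 2 * n * w n = Real.log n ^ γ / 4 := by rw [hw]; field_simp; norm_num
    rw [Real.norm_of_nonneg (integral_nonneg fun x => (Real.exp_pos _).le), e]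
    have hL : 0 ≤ Real.log n ^ γ := Real.rpow_nonneg (Real.log_natCast_nonneg n) γ
    refine integral_mono (hint _ (by positivity)) (hint _ (by positivity)) fun x => ?_
    apply Real.exp_le_exp.2
    have h5 : (d / 2) ^ γ * ((k : ℝ) + 1) ^ γ₀ ≤ Real.log n ^ γ := by
      calc (d / 2) ^ γ * ((k : ℝ) + 1) ^ γ₀ ≤ (d / 2) ^ γ * ((k : ℝ) + 1) ^ γ := by
            gcongr
            linarith
        _ = (d / 2 * ((k : ℝ) + 1)) ^ γ := by rw [Real.mul_rpow (by positivity) (by positivity)]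
        _ ≤ Real.log n ^ γ := Real.rpow_le_rpow (by positivity) (by nlinarith) hγ0.le
    have := mul_le_mul_of_nonneg_right h5 (hρ0 x)
    nlinarith

end upperBound

/-! ### Limit of the generating function for the return map. -/

lemma tendsto_one_sub_pow_exp {v : ℕ → ℝ} {N : ℕ → ℕ} {L : ℝ} (hv : Tendsto v atTop (𝓝 0))
    (h : Tendsto (fun n => N n * v n) atTop (𝓝 L)) :
    Tendsto (fun n => (1 - v n) ^ N n) atTop (𝓝 (Real.exp (-L))) := by
  have h1 : Tendsto (fun n => Real.exp (-(N n * v n / (1 - v n)))) atTop (𝓝 (Real.exp (-L))) := by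
    refine (Real.continuous_exp.tendsto _).comp ?_
    have : Tendsto (fun n => N n * v n / (1 - v n)) atTop (𝓝 (L / (1 - 0))) :=
      h.div (tendsto_const_nhds.sub hv) (by norm_num)
    simpa using this.neg
  have h2 : Tendsto (fun n => Real.exp (-(N n * v n))) atTop (𝓝 (Real.exp (-L))) :=
    (Real.continuous_exp.tendsto _).comp h.neg
  -- For v < 1 one has exp(-v/(1-v)) ≤ 1 - v ≤ exp(-v); both bounds, raised to the power N, have the
  -- same limit.
  refine tendsto_of_tendsto_of_tendsto_of_le_of_le' h1 h2 ?_ ?_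
  · filter_upwards [hv.eventually (gt_mem_nhds one_pos)] with n hn
    have hpos : 0 < 1 - v n := by linarith
    have h3 := Real.one_sub_inv_le_log_of_pos hpos
    have e : -(N n * v n / (1 - v n)) = N n * (1 - (1 - v n)⁻¹) := by field_simp; ring
    calc Real.exp (-(N n * v n / (1 - v n))) ≤ Real.exp (N n * Real.log (1 - v n)) := by
          rw [e]; gcongr
      _ = (1 - v n) ^ N n := by rw [Real.exp_nat_mul, Real.exp_log hpos]
  · filter_upwards [hv.eventually (gt_mem_nhds one_pos)] with n hn
    rw [← mul_neg, Real.exp_nat_mul]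
    refine pow_le_pow_left₀ (by linarith) ?_ _
    linarith [Real.add_one_le_exp (-v n)]

section localWeight

variable {X : Set ℝ} {f : ℝ → ℝ} {μ : Measure ℝ} {ρ : ℝ → ℝ} {Y : Set ℝ} {F : ℝ → ℝ}
  {ν : Measure ℝ} {C κ S β : ℝ}

/-- The product of `1 - u` over the times `p ≤ t < p + N` at which the orbit of `x` is in the
`q`-neighbourhood of the grid cell of `x`. -/
def localWeight (F : ℝ → ℝ) (ℓ : ℝ) (q : ℕ) (u : ℝ) (p N : ℕ) (x : ℝ) : ℝ :=
  weight F (cell ℓ q ⌊x / ℓ⌋) u N (F^[p] x)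

lemma measurable_localWeight (hF : Measurable F) {ℓ : ℝ} (hℓ : 0 < ℓ) (q : ℕ) (u : ℝ) (p N : ℕ) :
    Measurable (localWeight F ℓ q u p N) := by
  unfold localWeight weight
  refine Finset.measurable_fun_prod _ fun t _ => measurable_const.sub (measurable_const.mul ?_)
  have hm : MeasurableSet {x | F^[t] (F^[p] x) ∈ cell ℓ q ⌊x / ℓ⌋} := by
    simp only [mem_cell_iff hℓ]
    have h1 : Measurable fun x : ℝ => ⌊x / ℓ⌋ := Int.measurable_floor.comp (measurable_id.div_const ℓ)
    have h2 : Measurable fun x : ℝ => ⌊F^[t] (F^[p] x) / ℓ⌋ :=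
      h1.comp ((hF.iterate t).comp (hF.iterate p))
    exact (measurableSet_le (h1.sub_const _) h2).inter (measurableSet_le h2 (h1.add_const _))
  have e : (fun x => (cell ℓ q ⌊x / ℓ⌋).indicator (1 : ℝ → ℝ) (F^[t] (F^[p] x))) =
      {x | F^[t] (F^[p] x) ∈ cell ℓ q ⌊x / ℓ⌋}.indicator 1 := by
    ext x
    by_cases hx : F^[t] (F^[p] x) ∈ cell ℓ q ⌊x / ℓ⌋
    · rw [indicator_of_mem hx, indicator_of_mem (show x ∈ {x | F^[t] (F^[p] x) ∈ cell ℓ q ⌊x / ℓ⌋} from hx)]; rfl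
    · rw [indicator_of_notMem hx, indicator_of_notMem (show x ∉ {x | F^[t] (F^[p] x) ∈ cell ℓ q ⌊x / ℓ⌋} from hx)]
  rw [e]
  exact measurable_one.indicator hm

lemma localWeight_mem_Icc {u : ℝ} (hu : u ∈ Icc (0 : ℝ) 1) (ℓ : ℝ) (q p N : ℕ) (x : ℝ) :
    localWeight F ℓ q u p N x ∈ Icc (0 : ℝ) 1 :=
  ⟨weight_nonneg hu _ _, weight_le_one hu _ _⟩

lemma integrable_of_mem_Icc [IsFiniteMeasure ν] {g : ℝ → ℝ} (hg : AEStronglyMeasurable g ν)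
    (h : ∀ x, g x ∈ Icc (0 : ℝ) 1) : Integrable g ν :=
  Integrable.of_bound hg 1 <| Eventually.of_forall fun x => by
    rw [Real.norm_of_nonneg (h x).1]; exact (h x).2

lemma sum_indicator_cell_zero_mul {ℓ : ℝ} (hℓ : 0 < ℓ) (s : Finset ℤ) (G : ℤ → ℝ) (x : ℝ) :
    ∑ i ∈ s, (cell ℓ 0 i).indicator 1 x * G i = if ⌊x / ℓ⌋ ∈ s then G ⌊x / ℓ⌋ else 0 := by
  rw [← Finset.sum_ite_eq s ⌊x / ℓ⌋ G]
  refine Finset.sum_congr rfl fun i _ => ?_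
  by_cases hx : x ∈ cell ℓ 0 i
  · rw [indicator_of_mem hx, if_pos ((mem_cell_zero_iff hℓ i x).1 hx)]; simp
  · rw [indicator_of_notMem hx, if_neg fun h => hx ((mem_cell_zero_iff hℓ i x).2 h)]; simp

/-- The function `g` freezes the interval of each point and converges by Lebesgue differentiation;
the factor μ(Y) in N cancels the normalisation of ν. The grid estimate compares `g` with the true
weight, and points outside the finite grid have vanishing measure. -/
lemma tendsto_integral_localWeight (hsys : IsErgodicAcip X f μ) (hρ : IsDensity X μ ρ)
    (hY : MeasurableSet Y) (hYX : Y ⊆ X) [IsProbabilityMeasure (ProbabilityTheory.cond μ Y)]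
    (hgood : GoodSystem (returnMap f Y) (ProbabilityTheory.cond μ Y) C κ S β) {u : ℝ}
    (hu : u ∈ Icc (0 : ℝ) 1) (q : ℕ) {ℓ : ℕ → ℝ} (hℓ : AdmissibleMesh ℓ) {N : ℕ → ℕ}
    (hN : ∀ᶠ n in atTop, N n ≤ 2 * n) {c L : ℝ}
    (hNc : Tendsto (fun n : ℕ => (N n : ℝ) / n) atTop (𝓝 (c * μ.real Y)))
    (hL : Tendsto (fun n : ℕ => n * ℓ n) atTop (𝓝 L)) :
    Tendsto (fun n => ∫ x, localWeight (returnMap f Y) (ℓ n) q u (gap n) (N n) x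
        ∂(ProbabilityTheory.cond μ Y)) atTop
      (𝓝 (∫ x, Real.exp (-(u * (c * (2 * q + 1) * L * ρ x))) ∂(ProbabilityTheory.cond μ Y))) := by
  have := hsys.isProbabilityMeasure
  have hYpos := measureReal_pos_of_cond (μ := μ) (Y := Y)
  set F := returnMap f Y with hF
  set ν := ProbabilityTheory.cond μ Y with hν
  have hFm : Measurable F := hgood.measurePreserving.measurable
  have hνμ : ν ≪ μ := ProbabilityTheory.cond_absolutelyContinuous
  have hYν : ∀ᵐ x ∂ν, x ∈ Y := by
    rw [hν, ProbabilityTheory.cond]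
    exact Measure.ae_smul_measure (ae_restrict_mem hY) _
  classical
  set g : ℕ → ℝ → ℝ := fun n x =>
    if ⌊x / ℓ n⌋ ∈ gridRange ℓ n then (1 - u * ν.real (cell (ℓ n) q ⌊x / ℓ n⌋)) ^ N n else 0 with hg
  set g' : ℕ → ℝ → ℝ := fun n x =>
    if ⌊x / ℓ n⌋ ∈ gridRange ℓ n then localWeight F (ℓ n) q u (gap n) (N n) x else 0 with hg'
  have hbase : ∀ n i, 1 - u * ν.real (cell (ℓ n) q i) ∈ Icc (0 : ℝ) 1 := fun n i => by
    have h1 : ν.real (cell (ℓ n) q i) ≤ 1 := measureReal_le_one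
    have h0 : 0 ≤ ν.real (cell (ℓ n) q i) := measureReal_nonneg
    constructor <;> nlinarith [hu.1, hu.2]
  have hgIcc : ∀ n x, g n x ∈ Icc (0 : ℝ) 1 := fun n x => by
    simp only [hg]
    split_ifs
    · exact ⟨pow_nonneg (hbase _ _).1 _, pow_le_one₀ (hbase _ _).1 (hbase _ _).2⟩
    · exact ⟨le_rfl, zero_le_one⟩
  have hgm : ∀ n, Measurable (g n) := fun n => measurable_comp_floor (ℓ n) fun i =>
    if i ∈ gridRange ℓ n then (1 - u * ν.real (cell (ℓ n) q i)) ^ N n else 0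
  have hsm : ∀ n, MeasurableSet {x : ℝ | ⌊x / ℓ n⌋ ∈ gridRange ℓ n} := fun n =>
    (Int.measurable_floor.comp (measurable_id.div_const (ℓ n))) (MeasurableSet.of_discrete
      (s := {i | i ∈ gridRange ℓ n}))
  have hrange : ∀ x, ∀ᶠ n in atTop, ⌊x / ℓ n⌋ ∈ gridRange ℓ n := fun x => by
    filter_upwards [hℓ.eventually_pos, tendsto_natCast_atTop_atTop.eventually_ge_atTop |x|]
      with n h1 h2
    exact floor_div_mem_gridRange h1 h2
  have lim1 : Tendsto (fun n => ∫ x, g n x ∂ν) atTop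
      (𝓝 (∫ x, Real.exp (-(u * (c * (2 * q + 1) * L * ρ x))) ∂ν)) := by
    refine tendsto_integral_of_dominated_convergence (fun _ => 1)
      (fun n => (hgm n).aestronglyMeasurable) (integrable_const _) (fun n =>
        Eventually.of_forall fun x => by
          rw [Real.norm_of_nonneg (hgIcc n x).1]; exact (hgIcc n x).2) ?_
    filter_upwards [hYν, hνμ.ae_le (ae_tendsto_mul_cond_cell hsys hρ hY hYX hYpos hℓ q hNc),
      hνμ.ae_le (hsys.absolutelyContinuous.ae_le (hρ.ae_tendsto_cell hsys.measurableSet hY))]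
      with x hxY hx hxd
    have h1 : Tendsto (fun n => N n * ν.real (cell (ℓ n) q ⌊x / ℓ n⌋)) atTop
        (𝓝 (c * (2 * q + 1) * L * ρ x)) := by
      have := (hx hxY).mul hL
      rw [show c * (2 * q + 1) * ρ x * L = c * (2 * q + 1) * L * ρ x by ring] at this
      refine this.congr' ?_
      filter_upwards [eventually_gt_atTop 0, hℓ.eventually_pos] with n hn hpos
      have : (0 : ℝ) < n := by exact_mod_cast hn
      exact div_mul_cancel₀ _ (by positivity)
    have h2 : Tendsto (fun n => ν.real (cell (ℓ n) q ⌊x / ℓ n⌋)) atTop (𝓝 0) := by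
      have hz : Tendsto ℓ atTop (𝓝 0) := (tendsto_nhdsWithin_iff.1 hℓ.tendsto_zero).1
      have h3 := ((hxd q ℓ hℓ.tendsto_zero).mul (hz.const_mul (2 * q + 1 : ℝ))).div_const (μ.real Y)
      rw [mul_zero, mul_zero, zero_div] at h3
      refine h3.congr' ?_
      filter_upwards [hℓ.eventually_pos] with n hpos
      rw [cond_real_eq_div hY, div_mul_cancel₀]
      positivity
    have h4 : Tendsto (fun n => (1 - u * ν.real (cell (ℓ n) q ⌊x / ℓ n⌋)) ^ N n) atTop
        (𝓝 (Real.exp (-(u * (c * (2 * q + 1) * L * ρ x))))) := by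
      refine tendsto_one_sub_pow_exp (by simpa using h2.const_mul u) ?_
      refine (h1.const_mul u).congr fun n => by ring
    refine h4.congr' ?_
    filter_upwards [hrange x] with n hn
    simp only [hg, if_pos hn]
  obtain ⟨b, hb, hbound⟩ := hgood.sum_abs_le_rpow hu q hℓ hN
  have hg'int : ∀ᶠ n in atTop, Integrable (g' n) ν := by
    filter_upwards [hℓ.eventually_pos] with n hpos
    refine integrable_of_mem_Icc (((measurable_localWeight hFm hpos q u (gap n) (N n)).ite (hsm n)
      measurable_const).aestronglyMeasurable) fun x => ?_
    simp only [hg']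
    split_ifs
    · exact localWeight_mem_Icc hu _ _ _ _ _
    · exact ⟨le_rfl, zero_le_one⟩
  have lim2 : Tendsto (fun n => ∫ x, g' n x ∂ν - ∫ x, g n x ∂ν) atTop (𝓝 0) := by
    refine squeeze_zero_norm' ?_ ((tendsto_rpow_neg_atTop hb).comp tendsto_natCast_atTop_atTop)
    filter_upwards [hbound, hℓ.eventually_pos] with n hn hpos
    have hwi : ∀ i, Integrable (fun x => (cell (ℓ n) 0 i).indicator 1 x *
        weight F (cell (ℓ n) q i) u (N n) (F^[gap n] x)) ν := fun i =>
      integrable_indicator_one_mul (measurableSet_cell _ _ _)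
        (((hgood.measurePreserving.iterate (gap n)).integrable_comp
          (integrable_weight hFm (measurableSet_cell _ _ _) hu _).aestronglyMeasurable).2
            (integrable_weight hFm (measurableSet_cell _ _ _) hu _))
    have e1 : ∫ x, g' n x ∂ν = ∑ i ∈ gridRange ℓ n, ∫ x, (cell (ℓ n) 0 i).indicator 1 x *
        weight F (cell (ℓ n) q i) u (N n) (F^[gap n] x) ∂ν := by
      rw [← integral_finsetSum _ fun i _ => hwi i]
      refine integral_congr_ae (Eventually.of_forall fun x => ?_)
      dsimp only
      rw [sum_indicator_cell_zero_mul hpos _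
        fun i => weight F (cell (ℓ n) q i) u (N n) (F^[gap n] x)]
      rfl
    have e2 : ∫ x, g n x ∂ν = ∑ i ∈ gridRange ℓ n, ν.real (cell (ℓ n) 0 i) *
        (1 - u * ν.real (cell (ℓ n) q i)) ^ N n := by
      calc ∫ x, g n x ∂ν = ∫ x, ∑ i ∈ gridRange ℓ n, (cell (ℓ n) 0 i).indicator 1 x *
            (1 - u * ν.real (cell (ℓ n) q i)) ^ N n ∂ν := by
            refine integral_congr_ae (Eventually.of_forall fun x => ?_)
            dsimp only
            rw [sum_indicator_cell_zero_mul hpos _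
              fun i => (1 - u * ν.real (cell (ℓ n) q i)) ^ N n]
        _ = _ := by
            rw [integral_finsetSum _ fun i _ => integrable_indicator_one_mul
              (measurableSet_cell _ _ _) (integrable_const _)]
            refine Finset.sum_congr rfl fun i _ => ?_
            rw [integral_mul_const, integral_indicator_one (measurableSet_cell _ _ _)]
    rw [e1, e2, ← Finset.sum_sub_distrib]
    exact (Finset.abs_sum_le_sum_abs _ _).trans hn
  have lim3 : Tendsto (fun n => ∫ x, localWeight F (ℓ n) q u (gap n) (N n) x ∂ν - ∫ x, g' n x ∂ν)
      atTop (𝓝 0) := by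
    have hmeas := tendsto_measure_of_ae_tendsto_indicator_of_isFiniteMeasure (μ := ν) atTop
      MeasurableSet.empty (fun n => (hsm n).compl) (Eventually.of_forall fun x => by
        filter_upwards [hrange x] with n hn
        exact iff_of_false (fun h => h hn) (fun h => h))
    rw [measure_empty] at hmeas
    have hmeas' := (ENNReal.tendsto_toReal ENNReal.zero_ne_top).comp hmeas
    rw [ENNReal.toReal_zero] at hmeas'
    refine squeeze_zero' ?_ ?_ hmeas'
    · filter_upwards [hg'int, hℓ.eventually_pos] with n hint hpos
      have hli : Integrable (localWeight F (ℓ n) q u (gap n) (N n)) ν :=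
        integrable_of_mem_Icc (measurable_localWeight hFm hpos _ _ _ _).aestronglyMeasurable
          (localWeight_mem_Icc hu _ _ _ _)
      rw [sub_nonneg]
      refine integral_mono hint hli fun x => ?_
      simp only [hg']
      split_ifs
      · exact le_rfl
      · exact (localWeight_mem_Icc hu _ _ _ _ _).1
    · filter_upwards [hg'int, hℓ.eventually_pos] with n hint hpos
      have hli : Integrable (localWeight F (ℓ n) q u (gap n) (N n)) ν :=
        integrable_of_mem_Icc (measurable_localWeight hFm hpos _ _ _ _).aestronglyMeasurable
          (localWeight_mem_Icc hu _ _ _ _)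
      rw [← integral_sub hli hint]
      calc _ ≤ ∫ x, {x : ℝ | ⌊x / ℓ n⌋ ∈ gridRange ℓ n}ᶜ.indicator 1 x ∂ν := by
            refine integral_mono (hli.sub hint)
              ((integrable_const (1 : ℝ)).indicator (hsm n).compl) fun x => ?_
            simp only [hg']
            split_ifs with hx
            · rw [sub_self]; exact indicator_one_nonneg _ _
            · rw [sub_zero, indicator_of_mem (show x ∈ {x : ℝ | ⌊x / ℓ n⌋ ∈ gridRange ℓ n}ᶜ from hx)]
              exact (localWeight_mem_Icc hu _ _ _ _ _).2
        _ = _ := integral_indicator_one (hsm n).compl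
  have := (lim3.add lim2).add lim1
  rw [zero_add, zero_add] at this
  exact this.congr fun n => by ring

end localWeight

/-! ### Negligible events: returns outside Y and early returns. -/

section badEvents

variable {X : Set ℝ} {f : ℝ → ℝ} {μ : Measure ℝ} {ρ : ℝ → ℝ} {Y : Set ℝ} {F : ℝ → ℝ}
  {ν : Measure ℝ} {C κ S β : ℝ}

lemma tendsto_measureReal_of_ae_eventually_notMem [IsFiniteMeasure ν] {B : ℕ → Set ℝ}
    (hB : ∀ n, MeasurableSet (B n)) (h : ∀ᵐ x ∂ν, ∀ᶠ n in atTop, x ∉ B n) :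
    Tendsto (fun n => ν.real (B n)) atTop (𝓝 0) := by
  have hmeas := tendsto_measure_of_ae_tendsto_indicator_of_isFiniteMeasure (μ := ν) atTop
    MeasurableSet.empty hB (by
      filter_upwards [h] with x hx
      filter_upwards [hx] with n hn
      exact iff_of_false hn (fun h => h))
  rw [measure_empty] at hmeas
  have := (ENNReal.tendsto_toReal ENNReal.zero_ne_top).comp hmeas
  rwa [ENNReal.toReal_zero] at this

/-- The points of `Y` that come `r`-close to themselves outside `Y` by time `n`. -/
def outsideReturn (f : ℝ → ℝ) (Y : Set ℝ) (n : ℕ) (r : ℝ) : Set ℝ :=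
  {x ∈ Y | ∃ j, 1 ≤ j ∧ j ≤ n ∧ dist (f^[j] x) x ≤ r ∧ f^[j] x ∉ Y}

/-- Where Yᶜ fills only a proportion θ of an interval, the excursion bound gains the factor θ. What
remains is of order ℓ plus an exponential in t, hence bounded when summed over t ≤ n for nℓ bounded.
-/
lemma cond_excursion_outside_le [IsProbabilityMeasure μ] (hf : MeasurePreserving f μ μ)
    [IsProbabilityMeasure (ProbabilityTheory.cond μ Y)] (hY : MeasurableSet Y)
    (hgood : GoodSystem (returnMap f Y) (ProbabilityTheory.cond μ Y) C κ S β) {ℓ : ℝ}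
    (hℓ : 0 < ℓ) {θ : ℝ} (hθ : 0 ≤ θ) (t : ℕ) :
    (ProbabilityTheory.cond μ Y).real
        {x | μ.real (Yᶜ ∩ cell ℓ 1 ⌊x / ℓ⌋) ≤ θ * μ.real (Y ∩ cell ℓ 1 ⌊x / ℓ⌋) ∧
          (returnMap f Y)^[t] x ∈ hull f Y (Yᶜ ∩ cell ℓ 1 ⌊x / ℓ⌋)} ≤
      θ * (3 * S * ℓ + 3 * (C * Real.exp (-κ * t))) := by
  obtain ⟨hC, hκ, hS, hβ⟩ := hgood.pos
  have hYpos := measureReal_pos_of_cond (μ := μ) (Y := Y)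
  set ν := ProbabilityTheory.cond μ Y with hν
  set a : ℝ := C * Real.exp (-κ * t) with ha
  set E : ℤ → Set ℝ := fun i => {x | x ∈ cell ℓ 0 i ∧
    μ.real (Yᶜ ∩ cell ℓ 1 i) ≤ θ * μ.real (Y ∩ cell ℓ 1 i) ∧
    (returnMap f Y)^[t] x ∈ hull f Y (Yᶜ ∩ cell ℓ 1 i)} with hE
  have hEle : ∀ i, ν (E i) ≤ ENNReal.ofReal θ *
      (ENNReal.ofReal (3 * S * ℓ) * ν (cell ℓ 0 i) + ENNReal.ofReal a * ν (cell ℓ 1 i)) := by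
    intro i
    by_cases hi : μ.real (Yᶜ ∩ cell ℓ 1 i) ≤ θ * μ.real (Y ∩ cell ℓ 1 i)
    · have h := cond_real_hull_inter_le hf hY hgood.measurePreserving.measurable hC
        hgood.decay (hY.compl.inter (measurableSet_cell ℓ 1 i)) ℓ i t
      have h0 : 0 ≤ ν.real (cell ℓ 0 i) := measureReal_nonneg
      have h1 : 0 ≤ ν.real (cell ℓ 1 i) := measureReal_nonneg
      have h2 : ν.real (cell ℓ 1 i) ≤ 3 * S * ℓ := by
        have := hgood.density ℓ hℓ 1 i
        push_cast at this
        linarith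
      have h3 : μ.real (Yᶜ ∩ cell ℓ 1 i) / μ.real Y ≤ θ * ν.real (cell ℓ 1 i) := by
        rw [cond_real_eq_div hY, ← mul_div_assoc]
        gcongr
      have h4 : ν.real (E i) ≤ θ * (3 * S * ℓ * ν.real (cell ℓ 0 i) + a * ν.real (cell ℓ 1 i)) := by
        calc ν.real (E i) ≤ ν.real (cell ℓ 0 i ∩
              (returnMap f Y)^[t] ⁻¹' hull f Y (Yᶜ ∩ cell ℓ 1 i)) :=
              measureReal_mono fun x hx => ⟨hx.1, hx.2.2⟩
          _ ≤ (ν.real (cell ℓ 0 i) + a) * (θ * ν.real (cell ℓ 1 i)) :=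
              h.trans (mul_le_mul_of_nonneg_left h3 (by positivity))
          _ = θ * (ν.real (cell ℓ 1 i) * ν.real (cell ℓ 0 i) + a * ν.real (cell ℓ 1 i)) := by ring
          _ ≤ _ := by gcongr
      rw [← ofReal_measureReal, ← ofReal_measureReal, ← ofReal_measureReal,
        ← ENNReal.ofReal_mul (by positivity), ← ENNReal.ofReal_mul (by positivity),
        ← ENNReal.ofReal_add (by positivity) (by positivity), ← ENNReal.ofReal_mul hθ]
      exact ENNReal.ofReal_le_ofReal h4
    · have : E i = ∅ := eq_empty_of_forall_notMem fun x hx => hi hx.2.1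
      rw [this, measure_empty]; exact zero_le
  refine ENNReal.toReal_le_of_le_ofReal (by positivity) ?_
  calc _ ≤ ν (⋃ i, E i) :=
        measure_mono fun x hx => mem_iUnion.2 ⟨⌊x / ℓ⌋, mem_cell_floor hℓ 0 x, hx.1, hx.2⟩
    _ ≤ ∑' i, ν (E i) := measure_iUnion_le _
    _ ≤ ∑' i, ENNReal.ofReal θ *
          (ENNReal.ofReal (3 * S * ℓ) * ν (cell ℓ 0 i) + ENNReal.ofReal a * ν (cell ℓ 1 i)) :=
        ENNReal.tsum_le_tsum hEle
    _ ≤ ENNReal.ofReal θ * (ENNReal.ofReal (3 * S * ℓ) * 1 + ENNReal.ofReal a * 3) := by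
        rw [ENNReal.tsum_mul_left, ENNReal.tsum_add, ENNReal.tsum_mul_left, ENNReal.tsum_mul_left,
          tsum_measure_cell_zero_one hℓ, measure_univ]
        gcongr
        have := tsum_measure_cell_one_le (μ := ν) hℓ
        rwa [measure_univ, mul_one] at this
    _ = _ := by
        rw [ENNReal.ofReal_mul hθ, ENNReal.ofReal_add (by positivity) (by positivity), mul_one,
          ENNReal.ofReal_mul (p := 3) (q := a) (by norm_num), mul_comm (ENNReal.ofReal a)]
        norm_num

/-- At almost every point of Y the density of Yᶜ is 0 while ρ is positive, so intervals with
proportion above any fixed θ carry vanishing mass; on the others the expected number of returns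
outside Y is at most θK. -/
lemma tendsto_outsideReturn (hsys : IsErgodicAcip X f μ) (hρ : IsDensity X μ ρ)
    (hρm : Measurable ρ) (hY : MeasurableSet Y) (hYX : Y ⊆ X)
    [IsProbabilityMeasure (ProbabilityTheory.cond μ Y)]
    (hgood : GoodSystem (returnMap f Y) (ProbabilityTheory.cond μ Y) C κ S β) {ℓ : ℕ → ℝ}
    (hℓ : AdmissibleMesh ℓ) {L : ℝ} (hL : Tendsto (fun n : ℕ => n * ℓ n) atTop (𝓝 L)) :
    Tendsto (fun n => (ProbabilityTheory.cond μ Y).real (outsideReturn f Y n (ℓ n))) atTop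
      (𝓝 0) := by
  have := hsys.isProbabilityMeasure
  obtain ⟨hC, hκ, hS, hβ⟩ := hgood.pos
  have hYpos := measureReal_pos_of_cond (μ := μ) (Y := Y)
  set ν := ProbabilityTheory.cond μ Y with hν
  have hνμ : ν ≪ μ := ProbabilityTheory.cond_absolutelyContinuous
  have hYν : ∀ᵐ x ∂ν, x ∈ Y := by
    rw [hν, ProbabilityTheory.cond]
    exact Measure.ae_smul_measure (ae_restrict_mem hY) _
  have hs : Summable fun t : ℕ => C * Real.exp (-κ * t) := by
    refine Summable.mul_left _ ?_
    have := Real.summable_exp_nat_mul_iff.2 (neg_lt_zero.2 hκ)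
    simpa only [mul_comm] using this
  set K := 6 * S * (L + 1) + 3 * ∑' t : ℕ, C * Real.exp (-κ * t) with hK
  have hL0 : 0 ≤ L := ge_of_tendsto hL <| by
    filter_upwards [hℓ.eventually_pos] with n hn; positivity
  have hK0 : 0 ≤ K := by
    have : 0 ≤ ∑' t : ℕ, C * Real.exp (-κ * t) := tsum_nonneg fun t => by positivity
    positivity
  have key : ∀ θ : ℝ, 0 < θ → ∃ b : ℕ → ℝ, Tendsto b atTop (𝓝 0) ∧
      ∀ᶠ n in atTop, ν.real (outsideReturn f Y n (ℓ n)) ≤ b n + θ * K := by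
    intro θ hθ
    set B : ℕ → Set ℝ := fun n => {x | ¬ μ.real (Yᶜ ∩ cell (ℓ n) 1 ⌊x / ℓ n⌋) ≤
      θ * μ.real (Y ∩ cell (ℓ n) 1 ⌊x / ℓ n⌋)} with hB
    refine ⟨fun n => ν.real (B n), tendsto_measureReal_of_ae_eventually_notMem (fun n => ?_) ?_, ?_⟩
    · exact (measurableSet_le (measurable_comp_floor (ℓ n) fun i => μ.real (Yᶜ ∩ cell (ℓ n) 1 i))
        ((measurable_comp_floor (ℓ n) fun i => μ.real (Y ∩ cell (ℓ n) 1 i)).const_mul θ)).compl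
    · filter_upwards [hYν, hνμ.ae_le (hρ.ae_pos hρm),
        hνμ.ae_le (hsys.absolutelyContinuous.ae_le (hρ.ae_tendsto_cell hsys.measurableSet hY)),
        hνμ.ae_le (hsys.absolutelyContinuous.ae_le (hρ.ae_tendsto_cell hsys.measurableSet hY.compl))]
        with x hxY hxρ h1 h2
      have h1' := (h1 1 ℓ hℓ.tendsto_zero).const_mul θ
      have h2' := h2 1 ℓ hℓ.tendsto_zero
      rw [indicator_of_mem (show x ∈ Y ∩ X from ⟨hxY, hYX hxY⟩)] at h1'
      rw [indicator_of_notMem (show x ∉ Yᶜ ∩ X from fun h => h.1 hxY)] at h2'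
      filter_upwards [h2'.eventually_lt h1' (mul_pos hθ hxρ), hℓ.eventually_pos] with n hn hpos
      have hpos' : (0 : ℝ) < (2 * (1 : ℕ) + 1) * ℓ n := by positivity
      rw [div_lt_iff₀ hpos', mul_assoc, div_mul_cancel₀ _ hpos'.ne'] at hn
      exact not_not.2 hn.le
    · filter_upwards [hℓ.eventually_pos, eventually_ge_atTop 1,
        hL.eventually (gt_mem_nhds (show L < L + 1 by linarith))] with n hpos hn hnL
      set E : ℕ → Set ℝ := fun t =>
        {x | μ.real (Yᶜ ∩ cell (ℓ n) 1 ⌊x / ℓ n⌋) ≤ θ * μ.real (Y ∩ cell (ℓ n) 1 ⌊x / ℓ n⌋) ∧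
          (returnMap f Y)^[t] x ∈ hull f Y (Yᶜ ∩ cell (ℓ n) 1 ⌊x / ℓ n⌋)} with hE
      -- Lag 0 is included: the approach may happen before the first return to Y.
      have hsub : outsideReturn f Y n (ℓ n) ⊆ B n ∪ ⋃ t ∈ Finset.range (n + 1), E t := by
        rintro x ⟨hxY, j, hj1, hjn, hd, hjY⟩
        by_cases hxB : x ∈ B n
        · exact Or.inl hxB
        · refine Or.inr (mem_iUnion₂.2 ⟨visits f Y j x, ?_, not_not.1 hxB, ?_⟩)
          · have := visits_le (f := f) (Y := Y) j x
            rw [Finset.mem_range]; omega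
          · exact mem_hull_of_mem hxY ⟨hjY, mem_cell_of_dist_le hpos (by simpa using hd)⟩
      have hn1 : (1 : ℝ) ≤ n := by exact_mod_cast hn
      calc ν.real (outsideReturn f Y n (ℓ n))
          ≤ ν.real (B n) + ∑ t ∈ Finset.range (n + 1), ν.real (E t) :=
            (measureReal_mono hsub (measure_ne_top _ _)).trans ((measureReal_union_le _ _).trans
              (add_le_add le_rfl (measureReal_biUnion_finset_le _ _)))
        _ ≤ ν.real (B n) + ∑ t ∈ Finset.range (n + 1),
              θ * (3 * S * ℓ n + 3 * (C * Real.exp (-κ * t))) := by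
            gcongr with t
            exact cond_excursion_outside_le hsys.ergodic.toMeasurePreserving hY hgood hpos hθ.le t
        _ = ν.real (B n) + θ * (3 * S * ((n + 1) * ℓ n) +
              3 * ∑ t ∈ Finset.range (n + 1), C * Real.exp (-κ * t)) := by
            rw [← Finset.mul_sum, Finset.sum_add_distrib,
              ← Finset.mul_sum (f := fun t : ℕ => C * Real.exp (-κ * t)), Finset.sum_const,
              Finset.card_range, nsmul_eq_mul]
            push_cast; ring
        _ ≤ ν.real (B n) + θ * (3 * S * (2 * (L + 1)) + 3 * ∑' t : ℕ, C * Real.exp (-κ * t)) := by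
            have h1 : (n + 1) * ℓ n ≤ 2 * (L + 1) := by nlinarith
            have h2 := hs.sum_le_tsum (Finset.range (n + 1)) fun t _ => by positivity
            refine add_le_add le_rfl (mul_le_mul_of_nonneg_left (add_le_add ?_ ?_) hθ.le)
            · exact mul_le_mul_of_nonneg_left h1 (by positivity)
            · exact mul_le_mul_of_nonneg_left h2 (by norm_num)
        _ = _ := by rw [hK]; ring
  rw [Metric.tendsto_atTop']
  intro η hη
  obtain ⟨b, hb, hle⟩ := key (η / (2 * (K + 1))) (by positivity)
  obtain ⟨M, hM⟩ := eventually_atTop.1 (hle.and (hb.eventually (gt_mem_nhds (half_pos hη))))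
  refine ⟨M, fun n hn => ?_⟩
  obtain ⟨h1, h2⟩ := hM n hn.le
  rw [Real.dist_0_eq_abs, abs_of_nonneg measureReal_nonneg]
  have : η / (2 * (K + 1)) * K ≤ η / 2 := by
    rw [div_mul_eq_mul_div, div_le_div_iff₀ (by positivity) (by norm_num)]
    nlinarith
  linarith

/-- The points that come `r`-close to themselves at one of the times `1 ≤ t < p`. -/
def earlyReturn (F : ℝ → ℝ) (p : ℕ) (r : ℝ) : Set ℝ :=
  {x | ∃ t, 1 ≤ t ∧ t < p ∧ dist (F^[t] x) x ≤ r}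

lemma GoodSystem.tendsto_earlyReturn [IsProbabilityMeasure ν] (h : GoodSystem F ν C κ S β)
    {ℓ : ℕ → ℝ} (hℓ : AdmissibleMesh ℓ) :
    Tendsto (fun n => ν.real (earlyReturn F (gap n) (ℓ n))) atTop (𝓝 0) := by
  obtain ⟨hC, hκ, hS, hβ⟩ := h.pos
  refine squeeze_zero' (Eventually.of_forall fun n => measureReal_nonneg) ?_
    ((tendsto_rpow_neg_atTop (half_pos hβ)).comp tendsto_natCast_atTop_atTop)
  filter_upwards [h.short, hℓ.eventually_mul_le 1 zero_le_one, eventually_gt_atTop 0,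
    eventually_log_rpow_mul_le C 2 (half_pos hβ)] with n hs hl hn hlog
  have hn' : (0 : ℝ) < n := by exact_mod_cast hn
  rw [one_mul] at hl
  have hsub : earlyReturn F (gap n) (ℓ n) ⊆ ⋃ t ∈ Finset.Ico 1 (gap n),
      {x | dist x (F^[t] x) ≤ (n : ℝ) ^ (-(1 / 2) : ℝ)} := by
    rintro x ⟨t, h1, h2, h3⟩
    refine mem_iUnion₂.2 ⟨t, Finset.mem_Ico.2 ⟨h1, h2⟩, ?_⟩
    rw [dist_comm] at h3
    exact h3.trans hl
  calc ν.real (earlyReturn F (gap n) (ℓ n))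
      ≤ ∑ t ∈ Finset.Ico 1 (gap n), ν.real {x | dist x (F^[t] x) ≤ (n : ℝ) ^ (-(1 / 2) : ℝ)} :=
        (measureReal_mono hsub (measure_ne_top _ _)).trans (measureReal_biUnion_finset_le _ _)
    _ ≤ ∑ t ∈ Finset.Ico 1 (gap n), C * (n : ℝ) ^ (-β) := by
        refine Finset.sum_le_sum fun t ht => ?_
        rw [Finset.mem_Ico] at ht
        have : (t : ℝ) ≤ gap n := by exact_mod_cast ht.2.le
        exact hs t ht.1 (this.trans (gap_le n))
    _ ≤ Real.log n ^ 2 * (C * (n : ℝ) ^ (-β)) := by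
        rw [Finset.sum_const, nsmul_eq_mul, Nat.card_Ico]
        gcongr
        refine le_trans ?_ (gap_le n)
        exact_mod_cast Nat.sub_le _ _
    _ = C * Real.log n ^ (2 : ℝ) * (n : ℝ) ^ (-β) := by rw [Real.rpow_two]; ring
    _ ≤ (n : ℝ) ^ (β / 2) * (n : ℝ) ^ (-β) := by gcongr
    _ = (n : ℝ) ^ (-(β / 2)) := by rw [← Real.rpow_add hn']; congr 1; ring

end badEvents

/-! ### Comparing close returns with visits to cells. -/

section sandwich

variable {f F : ℝ → ℝ} {Y : Set ℝ} {u : ℝ}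

lemma weight_eq_pow (F : ℝ → ℝ) (J : Set ℝ) [DecidablePred (· ∈ J)] (u : ℝ) (N : ℕ) (y : ℝ) :
    weight F J u N y = (1 - u) ^ ((Finset.range N).filter fun t => F^[t] y ∈ J).card := by
  rw [weight, ← Finset.prod_const, Finset.prod_filter]
  refine Finset.prod_congr rfl fun t _ => ?_
  by_cases h : F^[t] y ∈ J <;> simp [h]

/-- Inner approximation: with mesh r/(q+1) every visit to the enlarged cell is a close return, and
more returns mean a smaller power. -/
lemma pow_recCount_le_localWeight (hu : u ∈ Icc (0 : ℝ) 1) {q p N n : ℕ} {r x : ℝ} (hr : 0 < r)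
    (hp : 1 ≤ p) (hN : p + N ≤ n) :
    (1 - u) ^ recCount F n r x ≤ localWeight F (r / (q + 1)) q u p N x := by
  classical
  have hℓ : 0 < r / ((q : ℝ) + 1) := by positivity
  rw [localWeight, weight_eq_pow]
  refine pow_le_pow_of_le_one (by linarith [hu.2]) (by linarith [hu.1]) ?_
  refine Finset.card_le_card_of_injOn (fun t => t + p) (fun t ht => ?_)
    (fun a _ b _ h => by simpa using h)
  simp only [Finset.coe_filter, Finset.mem_range, mem_ofPred_eq, Finset.mem_Icc] at ht ⊢
  refine ⟨by omega, ?_⟩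
  rw [Function.iterate_add_apply]
  refine (dist_lt_of_mem_cell hℓ ht.2).le.trans (le_of_eq ?_)
  field_simp

/-- Outer approximation: with mesh r/q every close return is a visit to the enlarged cell. Returns
before the window opens would be missed, hence the exclusion of early ones. -/
lemma localWeight_le_pow_recCount (hu : u ∈ Icc (0 : ℝ) 1) {q p N n : ℕ} {r x : ℝ} (hr : 0 < r)
    (hq : 1 ≤ q) (hN : n < p + N) (hx : x ∉ earlyReturn F p r) :
    localWeight F (r / q) q u p N x ≤ (1 - u) ^ recCount F n r x := by
  classical
  have hq' : (0 : ℝ) < q := by exact_mod_cast hq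
  have hℓ : 0 < r / (q : ℝ) := by positivity
  rw [localWeight, weight_eq_pow]
  refine pow_le_pow_of_le_one (by linarith [hu.2]) (by linarith [hu.1]) ?_
  have hge : ∀ t, 1 ≤ t → dist (F^[t] x) x ≤ r → p ≤ t := by
    intro t h1 h2
    by_contra! h
    exact hx ⟨t, h1, h, h2⟩
  refine Finset.card_le_card_of_injOn (fun t => t - p) (fun t ht => ?_) (fun a ha b hb h => ?_)
  · simp only [Finset.coe_filter, Finset.mem_range, mem_ofPred_eq, Finset.mem_Icc] at ht ⊢
    have hpt := hge t ht.1.1 ht.2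
    refine ⟨by omega, ?_⟩
    rw [← Function.iterate_add_apply, Nat.sub_add_cancel hpt]
    refine mem_cell_of_dist_le hℓ (ht.2.trans (le_of_eq ?_))
    field_simp
  · simp only [Finset.coe_filter, mem_ofPred_eq, Finset.mem_Icc] at ha hb
    have h1 := hge a ha.1.1 ha.2
    have h2 := hge b hb.1.1 hb.2
    dsimp only at h
    omega

end sandwich

/-! ### Generating functions and mixed Poisson laws. -/

section generatingFunctions

lemma summable_mul_pow {a : ℕ → ℝ} (ha : ∀ k, a k ∈ Icc (0 : ℝ) 1) {z : ℝ}
    (hz : z ∈ Ioo (0 : ℝ) 1) : Summable fun k => a k * z ^ k :=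
  Summable.of_nonneg_of_le (fun k => mul_nonneg (ha k).1 (pow_nonneg hz.1.le k))
    (fun k => mul_le_of_le_one_left (pow_nonneg hz.1.le k) (ha k).2)
    (summable_geometric_of_lt_one hz.1.le hz.2)

lemma tsum_mul_pow_eq {a : ℕ → ℝ} (ha : ∀ k, a k ∈ Icc (0 : ℝ) 1) {z : ℝ}
    (hz : z ∈ Ioo (0 : ℝ) 1) :
    ∑' k, a k * z ^ k = a 0 + z * ∑' k, a (k + 1) * z ^ k := by
  rw [(summable_mul_pow ha hz).tsum_eq_zero_add, pow_zero, mul_one, ← tsum_mul_left]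
  congr 1
  exact tsum_congr fun k => by rw [pow_succ]; ring

lemma tsum_mul_pow_mem_Icc {a : ℕ → ℝ} (ha : ∀ k, a k ∈ Icc (0 : ℝ) 1) {z : ℝ}
    (hz : z ∈ Ioo (0 : ℝ) 1) : ∑' k, a k * z ^ k ∈ Icc 0 (1 - z)⁻¹ := by
  refine ⟨tsum_nonneg fun k => mul_nonneg (ha k).1 (pow_nonneg hz.1.le k), ?_⟩
  rw [← tsum_geometric_of_lt_one hz.1.le hz.2]
  exact (summable_mul_pow ha hz).tsum_le_tsum
    (fun k => mul_le_of_le_one_left (pow_nonneg hz.1.le k) (ha k).2)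
    (summable_geometric_of_lt_one hz.1.le hz.2)

/-- Convergence of generating functions on `(0, 1)` implies convergence of the coefficients. -/
lemma tendsto_coeff_of_tendsto_tsum {a : ℕ → ℕ → ℝ} {b : ℕ → ℝ}
    (ha : ∀ n k, a n k ∈ Icc (0 : ℝ) 1) (hb : ∀ k, b k ∈ Icc (0 : ℝ) 1)
    (h : ∀ z ∈ Ioo (0 : ℝ) 1,
      Tendsto (fun n => ∑' k, a n k * z ^ k) atTop (𝓝 (∑' k, b k * z ^ k))) (k : ℕ) :
    Tendsto (fun n => a n k) atTop (𝓝 (b k)) := by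
  -- The series differs from its constant term by at most z/(1-z), uniformly in n, so a small z
  -- isolates coefficient 0. Subtracting it and dividing by z then allows induction on the index.
  have h0 : ∀ {a : ℕ → ℕ → ℝ} {b : ℕ → ℝ}, (∀ n k, a n k ∈ Icc (0 : ℝ) 1) →
      (∀ k, b k ∈ Icc (0 : ℝ) 1) → (∀ z ∈ Ioo (0 : ℝ) 1,
        Tendsto (fun n => ∑' k, a n k * z ^ k) atTop (𝓝 (∑' k, b k * z ^ k))) →
      Tendsto (fun n => a n 0) atTop (𝓝 (b 0)) := by
    intro a b ha hb h
    rw [Metric.tendsto_atTop']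
    intro ε hε
    obtain ⟨z, hz, hzε⟩ : ∃ z ∈ Ioo (0 : ℝ) 1, z * (1 - z)⁻¹ < ε / 2 := by
      refine ⟨ε / (4 + ε), ⟨by positivity, by rw [div_lt_one (by positivity)]; linarith⟩, ?_⟩
      have e : 1 - ε / (4 + ε) = 4 / (4 + ε) := by field_simp; ring
      rw [e, inv_div, div_mul_div_cancel₀ (by positivity)]
      linarith
    obtain ⟨M, hM⟩ := Metric.tendsto_atTop'.1 (h z hz) (ε / 2) (half_pos hε)
    refine ⟨M, fun n hn => ?_⟩
    have h1 := hM n hn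
    rw [tsum_mul_pow_eq (ha n) hz, tsum_mul_pow_eq hb hz, Real.dist_eq, abs_lt] at h1
    obtain ⟨h2, h3⟩ := tsum_mul_pow_mem_Icc (fun k => ha n (k + 1)) hz
    obtain ⟨h4, h5⟩ := tsum_mul_pow_mem_Icc (fun k => hb (k + 1)) hz
    have h6 := mul_nonneg hz.1.le h2
    have h7 := mul_nonneg hz.1.le h4
    have h8 := mul_le_mul_of_nonneg_left h3 hz.1.le
    have h9 := mul_le_mul_of_nonneg_left h5 hz.1.le
    rw [Real.dist_eq, abs_lt]
    constructor <;> linarith [h1.1, h1.2]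
  induction k generalizing a b with
  | zero => exact h0 ha hb h
  | succ k ih =>
    refine ih (a := fun n k => a n (k + 1)) (b := fun k => b (k + 1)) (fun n k => ha n (k + 1))
      (fun k => hb (k + 1)) fun z hz => ?_
    have e : ∀ {c : ℕ → ℝ}, (∀ k, c k ∈ Icc (0 : ℝ) 1) →
        ∑' k, c (k + 1) * z ^ k = (∑' k, c k * z ^ k - c 0) / z := by
      intro c hc
      rw [tsum_mul_pow_eq hc hz, add_sub_cancel_left, mul_div_cancel_left₀ _ hz.1.ne']
    rw [e hb]
    simp only [e (ha _)]
    exact ((h z hz).sub (h0 ha hb h)).div_const z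

variable {μ : Measure ℝ}

lemma integral_pow_eq_tsum [IsProbabilityMeasure μ] {R : ℝ → ℕ} (hR : Measurable R) {z : ℝ}
    (hz : z ∈ Ioo (0 : ℝ) 1) : ∫ x, z ^ R x ∂μ = ∑' k, μ.real {x | R x = k} * z ^ k := by
  have := Measure.isProbabilityMeasure_map (μ := μ) hR.aemeasurable
  have h1 := integral_map (μ := μ) hR.aemeasurable (f := fun k : ℕ => z ^ k)
    (measurable_of_countable _).aestronglyMeasurable
  rw [← h1, integral_countable]
  · refine tsum_congr fun k => ?_
    rw [map_measureReal_apply hR (measurableSet_singleton k), smul_eq_mul]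
    rfl
  · refine Integrable.of_bound (measurable_of_countable _).aestronglyMeasurable 1
      (Eventually.of_forall fun k => ?_)
    rw [Real.norm_of_nonneg (pow_nonneg hz.1.le k)]
    exact pow_le_one₀ hz.1.le hz.2.le

lemma poisson_mem_Icc {t : ℝ} (ht : 0 ≤ t) (k : ℕ) :
    t ^ k / (k.factorial : ℝ) * Real.exp (-t) ∈ Icc (0 : ℝ) 1 := by
  refine ⟨by positivity, ?_⟩
  rw [Real.exp_neg, ← div_eq_mul_inv, div_le_one (Real.exp_pos t)]
  exact Real.pow_div_factorial_le_exp t ht k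

lemma integral_mixedPoisson_mem_Icc [IsProbabilityMeasure μ] {h : ℝ → ℝ} (h0 : ∀ x, 0 ≤ h x)
    (k : ℕ) : ∫ x, h x ^ k / (k.factorial : ℝ) * Real.exp (-h x) ∂μ ∈ Icc (0 : ℝ) 1 := by
  refine ⟨integral_nonneg fun x => (poisson_mem_Icc (h0 x) k).1, ?_⟩
  have : ∫ x, h x ^ k / (k.factorial : ℝ) * Real.exp (-h x) ∂μ ≤ ∫ _, (1 : ℝ) ∂μ :=
    integral_mono_of_nonneg (Eventually.of_forall fun x => (poisson_mem_Icc (h0 x) k).1)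
      (integrable_const _) (Eventually.of_forall fun x => (poisson_mem_Icc (h0 x) k).2)
  simpa using this

lemma integral_exp_eq_tsum_mixedPoisson [IsProbabilityMeasure μ] {h : ℝ → ℝ} (hm : Measurable h)
    (h0 : ∀ x, 0 ≤ h x) {z : ℝ} (hz : z ∈ Ioo (0 : ℝ) 1) :
    ∫ x, Real.exp (-((1 - z) * h x)) ∂μ =
      ∑' k : ℕ, (∫ x, h x ^ k / (k.factorial : ℝ) * Real.exp (-h x) ∂μ) * z ^ k := by
  have hmem := fun x k => poisson_mem_Icc (h0 x) k
  have hs := hasSum_integral_of_summable_integral_norm (μ := μ)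
    (F := fun (k : ℕ) x => h x ^ k / (k.factorial : ℝ) * Real.exp (-h x) * z ^ k)
    (fun k => by
      refine (integrable_of_mem_Icc ?_ fun x => hmem x k).mul_const _
      exact (((hm.pow_const k).div_const _).mul
        (Real.measurable_exp.comp hm.neg)).aestronglyMeasurable)
    (by
      have := summable_mul_pow (fun k => integral_mixedPoisson_mem_Icc (μ := μ) h0 k) hz
      refine this.congr fun k => ?_
      rw [← integral_mul_const]
      refine integral_congr_ae (Eventually.of_forall fun x => ?_)
      exact (Real.norm_of_nonneg (mul_nonneg (hmem x k).1 (pow_nonneg hz.1.le k))).symm)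
  simp only [integral_mul_const] at hs
  rw [hs.tsum_eq]
  refine integral_congr_ae (Eventually.of_forall fun x => ?_)
  have h1 : HasSum (fun k : ℕ => (z * h x) ^ k / (k.factorial : ℝ)) (Real.exp (z * h x)) := by
    rw [Real.exp_eq_exp_ℝ]; exact NormedSpace.expSeries_div_hasSum_exp (z * h x)
  have h2 := (h1.mul_right (Real.exp (-h x))).tsum_eq
  dsimp only
  rw [show -((1 - z) * h x) = z * h x + -h x by ring, Real.exp_add, ← h2]
  exact tsum_congr fun k => by rw [mul_pow]; ring

end generatingFunctions

/-! ### The distributional limit law. -/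

section limitLaw

variable {X : Set ℝ} {f : ℝ → ℝ} {μ : Measure ℝ} {ρ : ℝ → ℝ} {Y : Set ℝ} {F : ℝ → ℝ}
  {ν : Measure ℝ} {C κ S β : ℝ} {u τ : ℝ}

lemma measurable_recCount (hf : Measurable f) (n : ℕ) (r : ℝ) : Measurable (recCount f n r) := by
  induction n with
  | zero => exact measurable_const
  | succ n ih =>
    have : recCount f (n + 1) r =
        fun x => recCount f n r x + if dist (f^[n + 1] x) x ≤ r then 1 else 0 :=
      funext fun x => recCount_succ f n r x
    rw [this]
    exact ih.add (Measurable.ite (measurableSet_le ((hf.iterate _).dist measurable_id)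
      measurable_const) measurable_const measurable_const)

lemma integral_le_integral_add_of_notMem [IsFiniteMeasure ν] {g h : ℝ → ℝ}
    (hg : AEStronglyMeasurable g ν) (hh : AEStronglyMeasurable h ν) (hg1 : ∀ x, g x ∈ Icc (0 : ℝ) 1)
    (hh1 : ∀ x, h x ∈ Icc (0 : ℝ) 1) {B : Set ℝ} (hle : ∀ᵐ x ∂ν, x ∉ B → g x ≤ h x) :
    ∫ x, g x ∂ν ≤ ∫ x, h x ∂ν + ν.real B := by
  -- The exceptional set is not assumed measurable, so its measurable hull is used.
  have hT := measurableSet_toMeasurable ν B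
  have e : ν.real B = ∫ x, (toMeasurable ν B).indicator 1 x ∂ν := by
    rw [integral_indicator_one hT, measureReal_def, measureReal_def, measure_toMeasurable]
  have hi : Integrable ((toMeasurable ν B).indicator (1 : ℝ → ℝ)) ν :=
    (integrable_const (1 : ℝ)).indicator hT
  rw [e, ← integral_add (integrable_of_mem_Icc hh hh1) hi]
  refine integral_mono_ae (integrable_of_mem_Icc hg hg1)
    ((integrable_of_mem_Icc hh hh1).add hi) ?_
  filter_upwards [hle] with x hx
  by_cases hxB : x ∈ toMeasurable ν B
  · simp only [indicator_of_mem hxB, Pi.one_apply]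
    linarith [(hg1 x).2, (hh1 x).1]
  · simp only [indicator_of_notMem hxB, add_zero]
    exact hx fun h => hxB (subset_toMeasurable ν B h)

/-- The difference equals the integral over Yᶜ minus μ(Yᶜ) times the conditional mean; both lie
between 0 and μ(Yᶜ). -/
lemma abs_integral_sub_integral_cond_le [IsProbabilityMeasure μ]
    [IsProbabilityMeasure (ProbabilityTheory.cond μ Y)] (hY : MeasurableSet Y) {g : ℝ → ℝ}
    (hg : AEStronglyMeasurable g μ) (hg1 : ∀ x, g x ∈ Icc (0 : ℝ) 1) :
    |∫ x, g x ∂μ - ∫ x, g x ∂(ProbabilityTheory.cond μ Y)| ≤ μ.real Yᶜ := by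
  have hYpos := measureReal_pos_of_cond (μ := μ) (Y := Y)
  have hint := integrable_of_mem_Icc hg hg1
  have hνμ : ProbabilityTheory.cond μ Y ≪ μ := ProbabilityTheory.cond_absolutelyContinuous
  have h1 : ∫ x in Y, g x ∂μ = μ.real Y * ∫ x, g x ∂(ProbabilityTheory.cond μ Y) := by
    rw [ProbabilityTheory.cond, integral_smul_measure, ENNReal.toReal_inv, smul_eq_mul,
      ← measureReal_def, mul_inv_cancel_left₀ hYpos.ne']
  have h2 := integral_add_compl hY hint
  have h3 : ∫ x, g x ∂(ProbabilityTheory.cond μ Y) ∈ Icc (0 : ℝ) 1 := by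
    refine ⟨integral_nonneg fun x => (hg1 x).1, ?_⟩
    have := integral_mono (integrable_of_mem_Icc (hg.mono_ac hνμ) hg1)
      (integrable_const (1 : ℝ)) fun x => (hg1 x).2
    simpa using this
  have h4 : ∫ x in Yᶜ, g x ∂μ ∈ Icc (0 : ℝ) (μ.real Yᶜ) := by
    refine ⟨integral_nonneg fun x => (hg1 x).1, ?_⟩
    have := integral_mono (μ := μ.restrict Yᶜ) hint.integrableOn
      (integrable_const (1 : ℝ)) fun x => (hg1 x).2
    simpa using this
  have h5 : μ.real Yᶜ = 1 - μ.real Y := probReal_compl_eq_one_sub hY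
  rw [abs_le]
  constructor <;> nlinarith [h3.1, h3.2, h4.1, h4.2, measureReal_nonneg (μ := μ) (s := Yᶜ)]

lemma admissibleMesh_const_div (hτ : 0 < τ) {c : ℝ} (hc : 1 ≤ c) :
    AdmissibleMesh fun n : ℕ => τ / (2 * n) / c := by
  refine admissibleMesh_div (D := 1) ?_ ?_ hc
  · filter_upwards [eventually_gt_atTop 0,
      tendsto_natCast_atTop_atTop.eventually_ge_atTop (2 / τ)] with n hn hnτ
    have hn' : (0 : ℝ) < n := by exact_mod_cast hn
    rw [div_le_iff₀ hτ] at hnτ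
    rw [inv_eq_one_div, div_le_div_iff₀ (by positivity) (by positivity)]
    nlinarith
  · filter_upwards [eventually_gt_atTop 0, tendsto_log_natCast.eventually_ge_atTop τ] with n hn hl
    have hn' : (0 : ℝ) < n := by exact_mod_cast hn
    rw [Real.rpow_one]
    have : (n : ℝ) * (τ / (2 * n)) = τ / 2 := by field_simp
    linarith

lemma tendsto_mul_const_div (τ c : ℝ) :
    Tendsto (fun n : ℕ => n * (τ / (2 * n) / c)) atTop (𝓝 (τ / (2 * c))) := by
  refine tendsto_const_nhds.congr' ?_
  filter_upwards [eventually_gt_atTop 0] with n hn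
  have hn' : (n : ℝ) ≠ 0 := by exact_mod_cast hn.ne'
  field_simp

lemma pow_mem_Icc (hu : u ∈ Icc (0 : ℝ) 1) (k : ℕ) : (1 - u) ^ k ∈ Icc (0 : ℝ) 1 :=
  ⟨pow_nonneg (by linarith [hu.2]) k,
    pow_le_one₀ (by linarith [hu.2]) (by linarith [hu.1])⟩

lemma measurable_pow_recCount (hf : Measurable f) (u : ℝ) (n : ℕ) (r : ℝ) :
    Measurable fun x => (1 - u) ^ recCount f n r x :=
  (measurable_of_countable fun k : ℕ => (1 - u) ^ k).comp (measurable_recCount hf n r)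

lemma ae_mem_cond (hY : MeasurableSet Y) : ∀ᵐ x ∂(ProbabilityTheory.cond μ Y), x ∈ Y := by
  rw [ProbabilityTheory.cond]
  exact Measure.ae_smul_measure (ae_restrict_mem hY) _

lemma tendsto_gap_add_floor_div {c : ℝ} (hc : 0 ≤ c) :
    Tendsto (fun n : ℕ => ((gap n + ⌊c * n⌋₊ : ℕ) : ℝ) / n) atTop (𝓝 c) := by
  have := tendsto_gap_div.add (tendsto_floor_mul_div hc)
  rw [zero_add] at this
  refine this.congr fun n => ?_
  push_cast
  ring

/-- With c < 1, the gap and N returns to Y are typically completed by time n, so the inner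
approximation applies outside a set of vanishing measure. -/
lemma eventually_integral_pow_recCount_lt (hsys : IsErgodicAcip X f μ) (hρ : IsDensity X μ ρ)
    (hρm : Measurable ρ) (hY : MeasurableSet Y) (hYX : Y ⊆ X)
    [IsProbabilityMeasure (ProbabilityTheory.cond μ Y)]
    (hgood : GoodSystem (returnMap f Y) (ProbabilityTheory.cond μ Y) C κ S β)
    (hu : u ∈ Icc (0 : ℝ) 1) (hτ : 0 < τ) (q : ℕ) {c : ℝ} (hc : c ∈ Ico (0 : ℝ) 1) {η : ℝ}
    (hη : 0 < η) :
    ∀ᶠ n : ℕ in atTop,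
      ∫ x, (1 - u) ^ recCount f n (τ / (2 * n)) x ∂(ProbabilityTheory.cond μ Y) <
        ∫ x, Real.exp (-(u * (c * (2 * q + 1) * (τ / (2 * (q + 1))) * ρ x)))
          ∂(ProbabilityTheory.cond μ Y) + η := by
  have := hsys.isProbabilityMeasure
  have hYpos := measureReal_pos_of_cond (μ := μ) (Y := Y)
  have hY1 : μ.real Y ≤ 1 := measureReal_le_one
  have hfm : Measurable f := hsys.ergodic.measurable
  have hFm : Measurable (returnMap f Y) := hgood.measurePreserving.measurable
  have hcY : 0 ≤ c * μ.real Y := mul_nonneg hc.1 hYpos.le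
  have hνμ : ProbabilityTheory.cond μ Y ≪ μ := ProbabilityTheory.cond_absolutelyContinuous
  set N : ℕ → ℕ := fun n => ⌊c * μ.real Y * n⌋₊ with hN
  have hW := tendsto_integral_localWeight hsys hρ hY hYX hgood hu q
    (admissibleMesh_const_div hτ (c := q + 1) (by linarith [q.cast_nonneg (α := ℝ)])) (N := N)
    (Eventually.of_forall fun n => by
      refine Nat.floor_le_of_le ?_
      push_cast
      have : c * μ.real Y ≤ 2 := by nlinarith [hc.1, hc.2]
      gcongr)
    (tendsto_floor_mul_div hcY) (tendsto_mul_const_div τ (q + 1))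
  have hO := tendsto_outsideReturn hsys hρ hρm hY hYX hgood
    (admissibleMesh_const_div hτ le_rfl) (tendsto_mul_const_div τ 1)
  set B : ℕ → Set ℝ := fun n => {x | visits f Y n x < gap n + N n} with hB
  have hBt : Tendsto (fun n => (ProbabilityTheory.cond μ Y).real (B n)) atTop (𝓝 0) := by
    refine tendsto_measureReal_of_ae_eventually_notMem (fun n =>
      measurableSet_lt (measurable_visits hfm hY n) measurable_const) ?_
    filter_upwards [hνμ.ae_le (ae_tendsto_visits hsys.ergodic hY)] with x hx
    filter_upwards [(tendsto_gap_add_floor_div hcY).eventually_lt hx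
      (mul_lt_of_lt_one_left hYpos hc.2), eventually_gt_atTop 0] with n hn hn0
    rw [div_lt_div_iff_of_pos_right (by exact_mod_cast hn0)] at hn
    exact not_lt.2 (by exact_mod_cast hn.le)
  have hlim := (hW.add (hO.add hBt)).eventually (gt_mem_nhds (lt_add_of_pos_right _
    (show 0 < η by exact hη)))
  rw [add_zero, add_zero] at hlim
  filter_upwards [hlim, eventually_one_le_gap, eventually_gt_atTop 0] with n hn hgap hn0
  have hn' : (0 : ℝ) < n := by exact_mod_cast hn0
  have hr : 0 < τ / (2 * n) := by positivity
  refine lt_of_le_of_lt ?_ hn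
  refine (integral_le_integral_add_of_notMem
    (h := localWeight (returnMap f Y) (τ / (2 * n) / (q + 1)) q u (gap n) (N n))
    (B := outsideReturn f Y n (τ / (2 * n) / 1) ∪ B n)
    (measurable_pow_recCount hfm u n _).aestronglyMeasurable
    (measurable_localWeight hFm (by positivity) q u _ _).aestronglyMeasurable
    (fun x => pow_mem_Icc hu _) (localWeight_mem_Icc hu _ q _ _) ?_).trans
    (add_le_add le_rfl (measureReal_union_le _ _))
  filter_upwards [ae_mem_cond hY] with x hxY hx
  rw [mem_union, not_or, div_one] at hx
  rw [recCount_eq_recCount_returnMap hxY fun j h1 h2 h3 => by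
    by_contra h; exact hx.1 ⟨hxY, j, h1, h2, h3, h⟩]
  exact pow_recCount_le_localWeight hu hr hgap (not_lt.1 hx.2)

/-- With c > 1, the window of gap plus N returns typically outlasts the time n, so it contains every
close return that is neither early nor outside Y. -/
lemma eventually_lt_integral_pow_recCount (hsys : IsErgodicAcip X f μ) (hρ : IsDensity X μ ρ)
    (hρm : Measurable ρ) (hY : MeasurableSet Y) (hYX : Y ⊆ X)
    [IsProbabilityMeasure (ProbabilityTheory.cond μ Y)]
    (hgood : GoodSystem (returnMap f Y) (ProbabilityTheory.cond μ Y) C κ S β)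
    (hu : u ∈ Icc (0 : ℝ) 1) (hτ : 0 < τ) {q : ℕ} (hq : 1 ≤ q) {c : ℝ}
    (hc : c ∈ Ioc (1 : ℝ) 2) {η : ℝ} (hη : 0 < η) :
    ∀ᶠ n : ℕ in atTop,
      ∫ x, Real.exp (-(u * (c * (2 * q + 1) * (τ / (2 * q)) * ρ x)))
          ∂(ProbabilityTheory.cond μ Y) <
        ∫ x, (1 - u) ^ recCount f n (τ / (2 * n)) x ∂(ProbabilityTheory.cond μ Y) + η := by
  have := hsys.isProbabilityMeasure
  have hYpos := measureReal_pos_of_cond (μ := μ) (Y := Y)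
  have hY1 : μ.real Y ≤ 1 := measureReal_le_one
  have hfm : Measurable f := hsys.ergodic.measurable
  have hFm : Measurable (returnMap f Y) := hgood.measurePreserving.measurable
  have hc0 : 0 < c := by linarith [hc.1]
  have hq' : (1 : ℝ) ≤ q := by exact_mod_cast hq
  have hcY : 0 ≤ c * μ.real Y := by positivity
  have hνμ : ProbabilityTheory.cond μ Y ≪ μ := ProbabilityTheory.cond_absolutelyContinuous
  set N : ℕ → ℕ := fun n => ⌊c * μ.real Y * n⌋₊ with hN
  have hW := tendsto_integral_localWeight hsys hρ hY hYX hgood hu q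
    (admissibleMesh_const_div hτ (c := q) hq') (N := N)
    (Eventually.of_forall fun n => by
      refine Nat.floor_le_of_le ?_
      push_cast
      have : c * μ.real Y ≤ 2 := by nlinarith [hc.2]
      gcongr)
    (tendsto_floor_mul_div hcY) (tendsto_mul_const_div τ q)
  have hO := tendsto_outsideReturn hsys hρ hρm hY hYX hgood
    (admissibleMesh_const_div hτ le_rfl) (tendsto_mul_const_div τ 1)
  have hE := hgood.tendsto_earlyReturn (admissibleMesh_const_div hτ le_rfl)
  set B : ℕ → Set ℝ := fun n => {x | gap n + N n ≤ visits f Y n x} with hB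
  have hBt : Tendsto (fun n => (ProbabilityTheory.cond μ Y).real (B n)) atTop (𝓝 0) := by
    refine tendsto_measureReal_of_ae_eventually_notMem (fun n =>
      measurableSet_le measurable_const (measurable_visits hfm hY n)) ?_
    filter_upwards [hνμ.ae_le (ae_tendsto_visits hsys.ergodic hY)] with x hx
    filter_upwards [hx.eventually_lt (tendsto_gap_add_floor_div hcY)
      (lt_mul_of_one_lt_left hYpos hc.1), eventually_gt_atTop 0] with n hn hn0
    rw [div_lt_div_iff_of_pos_right (by exact_mod_cast hn0)] at hn
    exact not_le.2 (by exact_mod_cast hn)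
  have hlim := (hW.sub ((hO.add hE).add hBt)).eventually (lt_mem_nhds (sub_lt_self _
    (show 0 < η by exact hη)))
  rw [add_zero, add_zero, sub_zero] at hlim
  filter_upwards [hlim, eventually_gt_atTop 0] with n hn hn0
  have hn' : (0 : ℝ) < n := by exact_mod_cast hn0
  have hr : 0 < τ / (2 * n) := by positivity
  rw [sub_lt_iff_lt_add] at hn
  have key := integral_le_integral_add_of_notMem
    (g := localWeight (returnMap f Y) (τ / (2 * n) / q) q u (gap n) (N n))
    (h := fun x => (1 - u) ^ recCount f n (τ / (2 * n)) x)
    (ν := ProbabilityTheory.cond μ Y)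
    (B := outsideReturn f Y n (τ / (2 * n) / 1) ∪
      earlyReturn (returnMap f Y) (gap n) (τ / (2 * n) / 1) ∪ B n)
    (measurable_localWeight hFm (by positivity) q u _ _).aestronglyMeasurable
    (measurable_pow_recCount hfm u n _).aestronglyMeasurable
    (localWeight_mem_Icc hu _ q _ _) (fun x => pow_mem_Icc hu _) (by
      filter_upwards [ae_mem_cond hY] with x hxY hx
      rw [mem_union, mem_union, not_or, not_or, div_one] at hx
      rw [recCount_eq_recCount_returnMap hxY fun j h1 h2 h3 => by
        by_contra h; exact hx.1.1 ⟨hxY, j, h1, h2, h3, h⟩]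
      exact localWeight_le_pow_recCount hu hr hq (not_le.1 hx.2) hx.1.2)
  have hU := (measureReal_union_le (μ := ProbabilityTheory.cond μ Y)
    (outsideReturn f Y n (τ / (2 * n) / 1) ∪
      earlyReturn (returnMap f Y) (gap n) (τ / (2 * n) / 1)) (B n)).trans
    (add_le_add (measureReal_union_le _ _) le_rfl)
  linarith

lemma tendsto_integral_exp_neg_mul [IsProbabilityMeasure μ] (hρm : Measurable ρ)
    (hρ0 : ∀ x, 0 ≤ ρ x) {v : ℕ → ℝ} (hv : ∀ k, 0 ≤ v k) {w : ℝ} (hvw : Tendsto v atTop (𝓝 w)) :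
    Tendsto (fun k => ∫ x, Real.exp (-(v k * ρ x)) ∂μ) atTop
      (𝓝 (∫ x, Real.exp (-(w * ρ x)) ∂μ)) := by
  refine tendsto_integral_of_dominated_convergence (fun _ => 1)
    (fun k => (Real.measurable_exp.comp (hρm.const_mul _).neg).aestronglyMeasurable)
    (integrable_const _) (fun k => Eventually.of_forall fun x => ?_)
    (Eventually.of_forall fun x => ?_)
  · rw [Real.norm_of_nonneg (Real.exp_pos _).le, Real.exp_le_one_iff]
    linarith [mul_nonneg (hv k) (hρ0 x)]
  · exact (Real.continuous_exp.tendsto _).comp (hvw.mul_const _).neg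

lemma tendsto_integral_pow_recCount (hsys : IsErgodicAcip X f μ) (hρ : IsDensity X μ ρ)
    (hρm : Measurable ρ) (hρ0 : ∀ x, 0 ≤ ρ x) (hasym : AsymptoticallyHyperbolic X f μ)
    (hu : u ∈ Icc (0 : ℝ) 1) (hτ : 0 < τ) :
    Tendsto (fun n : ℕ => ∫ x, (1 - u) ^ recCount f n (τ / (2 * n)) x ∂μ) atTop
      (𝓝 (∫ x, Real.exp (-(u * τ * ρ x)) ∂μ)) := by
  have := hsys.isProbabilityMeasure
  have hfm : Measurable f := hsys.ergodic.measurable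
  have h1 : Tendsto (fun k : ℕ => 1 / ((k : ℝ) + 1)) atTop (𝓝 0) :=
    tendsto_one_div_add_atTop_nhds_zero_nat
  set δ : ℕ → ℝ := fun k => 1 / ((k : ℝ) + 1) with hδ
  have hδ0 : ∀ k, 0 < δ k := fun k => by positivity
  have hδ1 : ∀ k, δ k ≤ 1 := fun k => by
    rw [hδ]; exact (div_le_one (by positivity)).2 (by linarith [k.cast_nonneg (α := ℝ)])
  set a : ℕ → ℝ := fun k =>
    u * ((1 - δ k) * (2 * (k + 1 : ℕ) + 1) * (τ / (2 * ((k + 1 : ℕ) + 1)))) with ha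
  set b : ℕ → ℝ := fun k =>
    u * ((1 + δ k) * (2 * (k + 1 : ℕ) + 1) * (τ / (2 * (k + 1 : ℕ)))) with hb
  have hb0 : ∀ k, 0 ≤ b k := fun k => by
    have := hu.1; have := hδ0 k; positivity
  have ha0 : ∀ k, 0 ≤ a k := fun k => by
    have := hu.1; have := sub_nonneg.2 (hδ1 k); positivity
  have hbt : Tendsto b atTop (𝓝 (u * τ)) := by
    have : Tendsto (fun k => u * τ * ((1 + δ k) * (1 + δ k / 2))) atTop
        (𝓝 (u * τ * ((1 + 0) * (1 + 0 / 2)))) :=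
      (((h1.const_add 1).mul ((h1.div_const 2).const_add 1)).const_mul _)
    simp only [add_zero, zero_div, mul_one] at this
    refine this.congr fun k => ?_
    rw [hb, hδ]
    push_cast
    field_simp
  have hat : Tendsto a atTop (𝓝 (u * τ)) := by
    have h2 : Tendsto (fun k : ℕ => δ (k + 1)) atTop (𝓝 0) := h1.comp (tendsto_add_atTop_nat 1)
    have : Tendsto (fun k => u * τ * ((1 - δ k) * (1 - δ (k + 1) / 2))) atTop
        (𝓝 (u * τ * ((1 - 0) * (1 - 0 / 2)))) :=
      (((h1.const_sub 1).mul ((h2.div_const 2).const_sub 1)).const_mul _)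
    simp only [sub_zero, zero_div, mul_one] at this
    refine this.congr fun k => ?_
    rw [ha, hδ]
    push_cast
    field_simp
    ring
  rw [Metric.tendsto_atTop]
  intro η hη
  have hη4 : 0 < η / 4 := by positivity
  obtain ⟨k, hka, hkb⟩ := (((tendsto_integral_exp_neg_mul (μ := μ) hρm hρ0 ha0 hat).eventually
    (gt_mem_nhds (lt_add_of_pos_right _ hη4))).and
    ((tendsto_integral_exp_neg_mul (μ := μ) hρm hρ0 hb0 hbt).eventually
    (lt_mem_nhds (sub_lt_self _ hη4)))).exists
  -- The parameter k is fixed before Y, since the limits of a and b concern μ alone. Four errors of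
  -- η/4 then add up: replacing μ by ν on each side, the limit in n, and the choice of k.
  obtain ⟨Y, C, κ, S, β, hY, hYX, hYc, hYp, hgood⟩ := hasym.exists_goodSystem hsys hη4
  have hYc' : μ.real Yᶜ ≤ η / 4 := ENNReal.toReal_le_of_le_ofReal hη4.le hYc
  have hup := eventually_integral_pow_recCount_lt hsys hρ hρm hY hYX hgood hu hτ (k + 1)
    (c := 1 - δ k) ⟨sub_nonneg.2 (hδ1 k), by linarith [hδ0 k]⟩ hη4
  have hlo := eventually_lt_integral_pow_recCount hsys hρ hρm hY hYX hgood hu hτ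
    (q := k + 1) (by omega) (c := 1 + δ k) ⟨by linarith [hδ0 k], by linarith [hδ1 k]⟩ hη4
  have hexp : ∀ v : ℝ, 0 ≤ v → |∫ x, Real.exp (-(v * ρ x)) ∂μ -
      ∫ x, Real.exp (-(v * ρ x)) ∂(ProbabilityTheory.cond μ Y)| ≤ η / 4 := by
    intro v hv
    refine (abs_integral_sub_integral_cond_le hY
      (Real.measurable_exp.comp (hρm.const_mul v).neg).aestronglyMeasurable fun x =>
      ⟨(Real.exp_pos _).le, Real.exp_le_one_iff.2 ?_⟩).trans hYc'
    exact neg_nonpos.2 (mul_nonneg hv (hρ0 x))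
  have e : ∀ s : ℝ, (fun x => Real.exp (-(u * (s * ρ x)))) =
      fun x => Real.exp (-(u * s * ρ x)) := fun s => by simp only [mul_assoc]
  rw [e] at hup hlo
  obtain ⟨M, hM⟩ := eventually_atTop.1 (hup.and hlo)
  refine ⟨M, fun n hn => ?_⟩
  obtain ⟨h3, h4⟩ := hM n hn
  have h5 := abs_le.1 ((abs_integral_sub_integral_cond_le hY
    (measurable_pow_recCount hfm u n (τ / (2 * n))).aestronglyMeasurable
    fun x => pow_mem_Icc hu _).trans hYc')
  have h6 := abs_le.1 (hexp (a k) (ha0 k))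
  have h7 := abs_le.1 (hexp (b k) (hb0 k))
  rw [Real.dist_eq, abs_lt]
  constructor <;> linarith [h5.1, h5.2, h6.1, h6.2, h7.1, h7.2]

/-- Substituting z = 1-u identifies the limit as the generating function of a Poisson law of
parameter τρ averaged over μ; writing μ as ρ dx supplies the extra power of ρ. -/
theorem tendsto_measureReal_recCount_eq (hsys : IsErgodicAcip X f μ) (hρ : IsDensity X μ ρ)
    (hasym : AsymptoticallyHyperbolic X f μ) (hτ : 0 < τ) (k : ℕ) :
    Tendsto (fun n : ℕ => μ.real {x ∈ X | recCount f n (τ / (2 * n)) x = k}) atTop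
      (𝓝 (∫ x in X, τ ^ k * ρ x ^ (k + 1) / (k.factorial : ℝ) * Real.exp (-(ρ x * τ)))) := by
  have := hsys.isProbabilityMeasure
  have hfm : Measurable f := hsys.ergodic.measurable
  obtain ⟨ρ', hρ', hρm, hρ0, hae⟩ := hρ.exists_measurable hsys.measurableSet
  have hτρ : ∀ x, 0 ≤ τ * ρ' x := fun x => mul_nonneg hτ.le (hρ0 x)
  have hcoeff := tendsto_coeff_of_tendsto_tsum
    (a := fun n k => μ.real {x | recCount f n (τ / (2 * n)) x = k})
    (b := fun k => ∫ x, (τ * ρ' x) ^ k / (k.factorial : ℝ) * Real.exp (-(τ * ρ' x)) ∂μ)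
    (fun n k => ⟨measureReal_nonneg, measureReal_le_one⟩)
    (fun k => integral_mixedPoisson_mem_Icc hτρ k) (fun z hz => by
      rw [← integral_exp_eq_tsum_mixedPoisson (hρm.const_mul τ) hτρ hz]
      simp only [← integral_pow_eq_tsum (measurable_recCount hfm _ _) hz]
      have h := tendsto_integral_pow_recCount hsys hρ' hρm hρ0 hasym (u := 1 - z)
        ⟨by linarith [hz.2], by linarith [hz.1]⟩ hτ
      simpa only [sub_sub_cancel, mul_assoc] using h) k
  have e : ∫ x in X, τ ^ k * ρ x ^ (k + 1) / (k.factorial : ℝ) * Real.exp (-(ρ x * τ)) =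
      ∫ x, (τ * ρ' x) ^ k / (k.factorial : ℝ) * Real.exp (-(τ * ρ' x)) ∂μ := by
    have h1 : ∫ x, (τ * ρ' x) ^ k / (k.factorial : ℝ) * Real.exp (-(τ * ρ' x)) ∂μ =
        ∫ x, (τ * ρ x) ^ k / (k.factorial : ℝ) * Real.exp (-(τ * ρ x)) ∂μ :=
      integral_congr_ae <| by filter_upwards [hae] with x hx; rw [hx]
    rw [h1, hρ.integral_eq hsys.measurableSet]
    refine integral_congr_ae (Eventually.of_forall fun x => ?_)
    dsimp only
    rw [mul_comm (ρ x) τ, mul_pow, pow_succ]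
    ring
  rw [e]
  refine hcoeff.congr fun n => measureReal_congr ?_
  filter_upwards [show ∀ᵐ x ∂μ, x ∈ X from hsys.measure_compl] with x hx
  exact propext ⟨fun h => ⟨hx, h⟩, fun h => h.2⟩

end limitLaw

end Recurrence

end

/-! ### Assembly of the four statements. -/

theorem mainTheorem3 (X : Set ℝ) (f : ℝ → ℝ) (μ : Measure ℝ) (ρ : ℝ → ℝ)
    (hsys : Recurrence.IsErgodicAcip X f μ)
    (hρ : Recurrence.IsDensity X μ ρ)
    (hasym : Recurrence.AsymptoticallyHyperbolic X f μ) :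
    -- the distributional limit law
    (∀ τ : ℝ, 0 < τ → ∀ k : ℕ, 1 ≤ k →
      Tendsto (fun n : ℕ => μ.real {x ∈ X | Recurrence.recCount f n (τ / (2 * n)) x = k}) atTop
        (𝓝 (∫ x in X, τ ^ k * ρ x ^ (k + 1) / (k.factorial : ℝ) * Real.exp (-(ρ x * τ))))) ∧
    -- almost sure upper bound, density bounded below
    (∀ (r : ℕ → ℝ) (c : ℝ), (∀ x ∈ X, 0 < ρ x) → 1 < 2 * c * sInf (ρ '' X) →
      (∀ᶠ n : ℕ in atTop, c * Real.log (Real.log n) / n < r n) →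
      μ {x ∈ X | ∀ᶠ n : ℕ in atTop, Recurrence.recMin f n x < r n} = 1) ∧
    -- almost sure upper bound, Hölder density
    (∀ (r : ℕ → ℝ) (γ γ₀ : ℝ), Recurrence.UniformlyHolderOn X ρ →
      (∀ ε : ℝ, 0 < ε → Summable (fun k : ℕ =>
        ∫ x in X, ρ x * Real.exp (-(ε * ((k : ℝ) + 1) ^ γ₀ * ρ x)))) →
      γ₀ < γ →
      (∀ᶠ n : ℕ in atTop, Real.log n ^ γ / (2 * n) < r n) →
      μ {x ∈ X | ∀ᶠ n : ℕ in atTop, Recurrence.recMin f n x < r n} = 1) ∧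
    -- almost sure lower bound
    (∀ r : ℕ → ℝ, AntitoneOn r (Ici 1) →
      ∑' n : ℕ, ∫⁻ x, μ (Metric.ball x (r (n + 1))) ∂μ < ⊤ →
      μ {x ∈ X | ∀ᶠ n : ℕ in atTop, r n < Recurrence.recMin f n x} = 1) := by
  refine ⟨fun τ hτ k _ => Recurrence.tendsto_measureReal_recCount_eq hsys hρ hasym hτ k,
    fun r c _ hc hr => hsys.measure_setOf_mem_eq_one
      (Recurrence.ae_eventually_recMin_lt_of_lt_sInf hsys hρ hasym hc hr),
    fun r γ γ₀ _ hsum hγ hr => hsys.measure_setOf_mem_eq_one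
      (Recurrence.ae_eventually_recMin_lt_of_summable hsys hρ hasym hsum hγ hr),
    fun r hr hsum => hsys.measure_setOf_mem_eq_one
      (Recurrence.ae_eventually_lt_recMin hsys hasym hr hsum)⟩
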